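/- Consider the 2-spin model with parameters $B_1,B_2,\lambda\ge 0$: a configuration $\sigma:V\to\{-1,+1\}$ on a finite multigraph $G$ has weight $w_G(\sigma)=\lambda^{n_-(\sigma)}B_1^{m_-(\sigma)}B_2^{m_+(\sigma)}$, where $n_-(\sigma)$ is the number of vertices of spin $-1$ and $m_-(\sigma)$, $m_+(\sigma)$ are the numbers of edges with both endpoints of spin $-1$, respectively $+1$. Let $d\ge 2$ and $\Delta=d+1$, and assume that - the model is antiferromagnetic: $B_1B_2<1$; - $(B_1,B_2,\lambda)$ lies in the non-uniqueness region of the infinite $\Delta$-regular tree $\mathbb T_\Delta$, that is, the influence on the spin of the root of fixing the spins at distance $h$ from the root does not vanish as $h\to\infty$; - $\sqrt{B_1B_2}\ \ge\ \dfrac{\sqrt d-1}{\sqrt d+1}$. Let $p^+$ (resp. $p^-$) be the limit, as $\ell\to\infty$, of the probability that the root of $\mathbb T_\Delta$ has spin $-1$ when all vertices at distance $2\ell$ (resp. $2\ell+1$) from the root are conditioned to have spin $-1$. These limits exist; put $(\alpha,\beta)=(p^+,p^-)$. Let $G\sim\mathcal G(n,\Delta)$ be the bipartite multigraph with sides $V_1,V_2$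 of size $n$ that is the union of $\Delta$ independent uniformly random perfect matchings. Let $Y_G^{\gamma,\delta}=\sum w_G(\sigma_1)w_G(\sigma_2)$, the sum being over the pairs $(\sigma_1,\sigma_2)$ of configurations that each have $\alpha n$ vertices of spin $-1$ in $V_1$ and $\beta n$ in $V_2$, and that are simultaneously $-1$ on exactly $\gamma n$ vertices of $V_1$ and exactly $\delta n$ vertices of $V_2$. (Here $\alpha n,\beta n,\gamma n,\delta n$ stand for integers $a_n,b_n,g_n,k_n$ with $a_n/n\to\alpha$, $b_n/n\to\beta$, $g_n/n\to\gamma$, $k_n/n\to\delta$ for which such pairs exist for all large $n$.) Then, for every $(\gamma,\delta)$ in the region $$\gamma\ge 0,\quad \alpha-\gamma\ge 0,\quad 1-2\alpha+\gamma\ge 0,\quad \delta\ge 0,\quad \beta-\delta\ge 0,\quad 1-2\beta+\delta\ge 0,$$ such integers exist, the limit $$\phi(\gamma,\delta)=\lim_{n\to\infty}\frac1n\log \mathbb E_{\mathcal G(n,\Delta)}\big[Y_G^{\gamma,\delta}\big]$$ exists and does not depend on their choice, and $\phi$ attains its maximum over this region at $(\gamma,\delta)=(\alpha^2,\beta^2)$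 and at no other point. -/

import Mathlib

open Filter Topology

noncomputable section

namespace TwoSpin

/-! ### Two-spin systems on finite multigraphs

Spins are the elements `-1` and `1` of `ℤˣ`.  A finite multigraph on `V` is given by a finite
type `E` of edges and the map `ends` that sends an edge to its two endpoints, so that parallel
edges are counted with multiplicity. -/

/-- The weight `λ ^ n₋(σ) * B₁ ^ m₋(σ) * B₂ ^ m₊(σ)` of the configuration `σ`: here `n₋` is the
number of vertices of spin `-1`, and `m₋`, `m₊` are the numbers of edges with both endpoints of
spin `-1`, respectively `+1`. -/
def weight {V E : Type} [Fintype V] [Fintype E] (ends : E → V × V) (B₁ B₂ lam : ℝ)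
    (σ : V → ℤˣ) : ℝ :=
  lam ^ (Finset.univ.filter fun v : V => σ v = -1).card *
    B₁ ^ (Finset.univ.filter fun e : E => σ (ends e).1 = -1 ∧ σ (ends e).2 = -1).card *
    B₂ ^ (Finset.univ.filter fun e : E => σ (ends e).1 = 1 ∧ σ (ends e).2 = 1).card

/-! ### The infinite regular tree

The vertices of the infinite `(d+1)`-regular tree are the words over `d + 1` letters in which no
two consecutive letters agree, the root being the empty word.  A nonempty word `i :: w` is
joined to its parent `w`.  So the root has `d + 1` children, every other vertex `i :: w` has the
`d` children `j :: i :: w` with `j ≠ i`, and the length of a word is its distance from the root. -/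

/-- The ball of radius `h` about the root of the `(d+1)`-regular tree. -/
abbrev TreeBall (d h : ℕ) : Type :=
  {w : List (Fin (d + 1)) // w.IsChain (fun i j => i ≠ j) ∧ w.length ≤ h}

instance treeBallFinite (d h : ℕ) : Finite (TreeBall d h) :=
  Set.Finite.subset (List.finite_length_le (Fin (d + 1)) h) fun _ hw => hw.2

instance treeBallFintype (d h : ℕ) : Fintype (TreeBall d h) := Fintype.ofFinite _

/-- The root of the tree. -/
def treeRoot (d h : ℕ) : TreeBall d h := ⟨[], List.isChain_nil, Nat.zero_le h⟩

/-- The parent of a vertex (the root for the root itself, which is never used). -/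
def treeParent {d h : ℕ} (w : TreeBall d h) : TreeBall d h :=
  ⟨w.1.tail, w.2.1.tail, by
    have := w.2.2
    rw [List.length_tail]
    omega⟩

/-- The edges of the ball, one for every vertex other than the root: it joins the vertex to its
parent. -/
abbrev TreeEdge (d h : ℕ) : Type := {w : TreeBall d h // w.1 ≠ []}

/-- The endpoints of an edge of the ball. -/
def treeEnds {d h : ℕ} (e : TreeEdge d h) : TreeBall d h × TreeBall d h :=
  (e.1, treeParent e.1)

/-- The configurations on the ball of radius `h` that agree with `τ` on all vertices at
level `h`. -/
def boundaryConfigs {d h : ℕ} (τ : TreeBall d h → ℤˣ) : Finset (TreeBall d h → ℤˣ) :=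
  Finset.univ.filter fun σ => ∀ v : TreeBall d h, v.1.length = h → σ v = τ v

/-- The probability that the root has spin `-1` in the Gibbs distribution on the ball of
radius `h`, conditioned on the spins at level `h` being those of `τ`. -/
def rootMarginal (d : ℕ) (B₁ B₂ lam : ℝ) (h : ℕ) (τ : TreeBall d h → ℤˣ) : ℝ :=
  (∑ σ ∈ (boundaryConfigs τ).filter (fun σ => σ (treeRoot d h) = -1),
      weight treeEnds B₁ B₂ lam σ) /
    ∑ σ ∈ boundaryConfigs τ, weight treeEnds B₁ B₂ lam σ

/-- The parameters lie in the non-uniqueness region of the infinite `(d+1)`-regular tree: the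
influence on the root of the spins at level `h` does not vanish as `h → ∞`. -/
def NonUniqueness (d : ℕ) (B₁ B₂ lam : ℝ) : Prop :=
  ∃ ε : ℝ, 0 < ε ∧ ∀ H : ℕ, ∃ h : ℕ, H ≤ h ∧ ∃ τ τ' : TreeBall d h → ℤˣ,
    ε ≤ |rootMarginal d B₁ B₂ lam h τ - rootMarginal d B₁ B₂ lam h τ'|

/-- `p` is the probability `p⁺` that the root has spin `-1` in the measure obtained by
conditioning on the vertices at level `2 ℓ` having spin `-1` and letting `ℓ → ∞`. -/
def IsPPlus (d : ℕ) (B₁ B₂ lam p : ℝ) : Prop :=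
  Tendsto (fun l : ℕ => rootMarginal d B₁ B₂ lam (2 * l) fun _ => -1) atTop (𝓝 p)

/-- The analogue `p⁻` of `p⁺` for the vertices at the odd levels `2 ℓ + 1`. -/
def IsPMinus (d : ℕ) (B₁ B₂ lam p : ℝ) : Prop :=
  Tendsto (fun l : ℕ => rootMarginal d B₁ B₂ lam (2 * l + 1) fun _ => -1) atTop (𝓝 p)

/-! ### Random bipartite regular multigraphs and the overlap-restricted second moment -/

/-- The vertices of a bipartite graph with `n + n` vertices. -/
abbrev BipVertex (n : ℕ) : Type := Fin n ⊕ Fin n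

/-- The union of the perfect matchings `π 0, …, π (Δ - 1)` of the two sides: the `k`-th matching
joins `i` on the left to `π k i` on the right. -/
def matchingEnds {n Δ : ℕ} (π : Fin Δ → Equiv.Perm (Fin n)) (e : Fin Δ × Fin n) :
    BipVertex n × BipVertex n :=
  (Sum.inl e.2, Sum.inr (π e.1 e.2))

/-- `σ` has exactly `a` vertices of spin `-1` on the left side and `b` on the right side. -/
def HasCounts {n : ℕ} (a b : ℕ) (σ : BipVertex n → ℤˣ) : Prop :=
  (Finset.univ.filter fun i : Fin n => σ (Sum.inl i) = -1).card = a ∧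
    (Finset.univ.filter fun i : Fin n => σ (Sum.inr i) = -1).card = b

/-- `σ₁` and `σ₂` are both `-1` on exactly `g` vertices of the left side and on exactly `k`
vertices of the right side. -/
def HasOverlaps {n : ℕ} (g k : ℕ) (σ₁ σ₂ : BipVertex n → ℤˣ) : Prop :=
  (Finset.univ.filter fun i : Fin n => σ₁ (Sum.inl i) = -1 ∧ σ₂ (Sum.inl i) = -1).card = g ∧
    (Finset.univ.filter fun i : Fin n => σ₁ (Sum.inr i) = -1 ∧ σ₂ (Sum.inr i) = -1).card = k

open Classical in
/-- The pairs of configurations with `a`, `b` vertices of spin `-1` on the two sides each, and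
with overlaps `g`, `k` on the two sides. -/
def overlapPairs (n a b g k : ℕ) : Finset ((BipVertex n → ℤˣ) × (BipVertex n → ℤˣ)) :=
  Finset.univ.filter fun s => HasCounts a b s.1 ∧ HasCounts a b s.2 ∧ HasOverlaps g k s.1 s.2

/-- The contribution of these pairs to the square of the partition function of the graph formed
by the matchings `π`. -/
def overlapSum {Δ n : ℕ} (B₁ B₂ lam : ℝ) (a b g k : ℕ) (π : Fin Δ → Equiv.Perm (Fin n)) : ℝ :=
  ∑ s ∈ overlapPairs n a b g k,
    weight (matchingEnds π) B₁ B₂ lam s.1 * weight (matchingEnds π) B₁ B₂ lam s.2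

/-- The expectation of `overlapSum` over `Δ` independent uniform perfect matchings. -/
def expectedOverlapSum (Δ : ℕ) (B₁ B₂ lam : ℝ) (n a b g k : ℕ) : ℝ :=
  (∑ π : Fin Δ → Equiv.Perm (Fin n), overlapSum B₁ B₂ lam a b g k π) /
    Fintype.card (Fin Δ → Equiv.Perm (Fin n))

/-- The sequences `a, b, g, k` of integers approximate `α n, β n, γ n, δ n` and are realizable:
for all large `n`, some pair of configurations has these counts and overlaps. -/
def Approximates (α β γ δ : ℝ) (a b g k : ℕ → ℕ) : Prop :=
  Tendsto (fun n : ℕ => (a n : ℝ) / n) atTop (𝓝 α) ∧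
  Tendsto (fun n : ℕ => (b n : ℝ) / n) atTop (𝓝 β) ∧
  Tendsto (fun n : ℕ => (g n : ℝ) / n) atTop (𝓝 γ) ∧
  Tendsto (fun n : ℕ => (k n : ℝ) / n) atTop (𝓝 δ) ∧
  ∀ᶠ n in atTop, (overlapPairs n (a n) (b n) (g n) (k n)).Nonempty

/-- `r` is the exponential growth rate `lim (1/n) log E[Y^{γ,δ}]`, for the fractions `α, β` of
spins `-1`.  As `α n, β n, γ n, δ n` are in general not integers, the limit is required along all
realizable integer approximations of them, and there has to be at least one. -/
def HasGrowthRate (Δ : ℕ) (B₁ B₂ lam α β γ δ r : ℝ) : Prop :=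
  (∃ a b g k : ℕ → ℕ, Approximates α β γ δ a b g k) ∧
  ∀ a b g k : ℕ → ℕ, Approximates α β γ δ a b g k →
    Tendsto (fun n : ℕ =>
      1 / (n : ℝ) * Real.log (expectedOverlapSum Δ B₁ B₂ lam n (a n) (b n) (g n) (k n)))
      atTop (𝓝 r)

/-- The possible overlaps `(γ, δ)` of two configurations with fractions `α, β` of spins `-1`. -/
def overlapRegion (α β : ℝ) : Set (ℝ × ℝ) :=
  {x | 0 ≤ x.1 ∧ 0 ≤ α - x.1 ∧ 0 ≤ 1 - 2 * α + x.1 ∧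
    0 ≤ x.2 ∧ 0 ≤ β - x.2 ∧ 0 ≤ 1 - 2 * β + x.2}

end TwoSpin

end

namespace TwoSpin

open Finset

set_option linter.unusedSectionVars false

/-! ### Words with prescribed letter counts -/

section Words

variable {K : Type} [Fintype K] [DecidableEq K] {n : ℕ}

/-! Write θ = d/(d+1). Grouping pairs of configurations by their joint spin counts on each side
reduces the expectation to counting words. On a fixed side the joint spins form a word over four
letters, and one random matching between two words has expected weight equal to the average over all
pairs of words with the same letter counts. Hence `expectedOverlapSum_eq`. Stirling and the method
of types (`tendsto_log_pairSum`) give the growth rate as the maximum of `couplingRate` over the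
couplings P of the two overlap distributions μ, ν.

The key step trades this maximum for a bilinear form. By Gibbs' inequality (`couplingRate_le`) the
rate is at most (d+1) log Σ μ(s)^θ M(s,t) ν(t)^θ, where M is the tensor square of the 2×2 matrix
`spinMatrix` of the first moment. If the 2×2 form is bounded by S (Σμ)^θ (Σν)^θ, then applying this
bound inside the rows and then to the row sums bounds the tensor square by S². Equality forces every
pair of rows to be extremal; strict concavity of x ↦ x^θ makes the extremal distribution unique
(`momentForm_proportional`), so the rows are proportional and the two spins on a side are
independent. This is exactly γ = α² and δ = β². At that point the product of two copies of the
extremal edge distribution of the tree attains S².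

It remains to find S. Hölder's inequality eliminates ν, and homogeneity leaves a function of one
variable x, `firstMoment`. Its derivative has the sign of T(T(x)) - x, where T = `treeMap` is the
tree recursion. The iterates of T from the all-minus boundary condition converge along the two
parities to the extreme fixed points L ≤ U of T∘T, which fixes the sign outside [L, U]. Between them
a convexity argument shows that the sign changes only once, at a fixed point of T. So the maximum is
at L or U, where the values agree, and these two points encode the marginals β and α. -/

/-- The number of occurrences of the letter `k` in `w`. -/
def letterCount (w : Fin n → K) (k : K) : ℕ := (univ.filter fun i => w i = k).card

/-- The words of length `n` in which each letter `k` occurs `r k` times. -/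
def words (n : ℕ) (r : K → ℕ) : Finset (Fin n → K) :=
  univ.filter fun w => ∀ k, letterCount w k = r k

theorem mem_words {r : K → ℕ} {w : Fin n → K} :
    w ∈ words n r ↔ ∀ k, letterCount w k = r k := by
  simp [words]

theorem sum_letterCount (w : Fin n → K) : ∑ k, letterCount w k = n := by
  have := card_eq_sum_card_fiberwise (f := w) (s := univ) (t := univ) (by simp)
  simpa [letterCount] using this.symm

theorem letterCount_comp_perm (w : Fin n → K) (π : Equiv.Perm (Fin n)) (k : K) :
    letterCount (fun i => w (π i)) k = letterCount w k := by
  unfold letterCount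
  refine card_bij (fun i _ => π i) ?_ ?_ ?_
  · intro i hi
    simpa using hi
  · intro i _ j _ h
    exact π.injective h
  · intro j hj
    exact ⟨π.symm j, by simpa using hj, by simp⟩

theorem comp_perm_mem_words {r : K → ℕ} {w : Fin n → K} (hw : w ∈ words n r)
    (π : Equiv.Perm (Fin n)) : (fun i => w (π i)) ∈ words n r := by
  rw [mem_words] at hw ⊢
  intro k
  rw [letterCount_comp_perm, hw k]

theorem words_nonempty {r : K → ℕ} (hr : ∑ k, r k = n) : (words n r).Nonempty := by
  have hc : Fintype.card (Fin n) = Fintype.card (Σ k, Fin (r k)) := by simp [hr]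
  let e := Fintype.equivOfCardEq hc
  refine ⟨fun i => (e i).1, mem_words.2 fun k => ?_⟩
  unfold letterCount
  have : (univ.filter fun i => (e i).1 = k) = univ.image fun j : Fin (r k) => e.symm ⟨k, j⟩ := by
    ext i
    simp only [mem_filter, mem_univ, true_and, mem_image]
    constructor
    · intro h
      subst h
      exact ⟨(e i).2, by simp⟩
    · rintro ⟨j, rfl⟩
      simp
  rw [this, card_image_of_injective]
  · simp
  · intro j j' h
    simpa using h

theorem exists_perm_of_mem_words {r : K → ℕ} {w w' : Fin n → K} (hw : w ∈ words n r)
    (hw' : w' ∈ words n r) : ∃ π : Equiv.Perm (Fin n), w' = fun i => w (π i) := by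
  rw [mem_words] at hw hw'
  have hc : ∀ k, Nonempty ({i // w' i = k} ≃ {i // w i = k}) := fun k => by
    refine ⟨Fintype.equivOfCardEq ?_⟩
    rw [Fintype.card_subtype, Fintype.card_subtype]
    exact (hw' k).trans (hw k).symm
  let e : ∀ k, {i // w' i = k} ≃ {i // w i = k} := fun k => (hc k).some
  refine ⟨((Equiv.sigmaFiberEquiv w').symm.trans (Equiv.sigmaCongrRight e)).trans
    (Equiv.sigmaFiberEquiv w), ?_⟩
  funext i
  exact (e (w' i) ⟨i, rfl⟩).2.symm

/-- Orbit-stabilizer: permutations act transitively on these words, and each fibre of π ↦ w ∘ π is a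
coset of the stabilizer of w, of size ∏ (r k)!. -/
theorem card_words_mul {r : K → ℕ} (hr : ∑ k, r k = n) :
    (words n r).card * ∏ k, (r k).factorial = n.factorial := by
  obtain ⟨w, hw⟩ := words_nonempty hr
  have hmap : ∀ π ∈ (univ : Finset (Equiv.Perm (Fin n))), (fun i => w (π i)) ∈ words n r :=
    fun π _ => comp_perm_mem_words hw π
  have hcard := card_eq_sum_card_fiberwise hmap
  rw [card_univ, Fintype.card_perm, Fintype.card_fin] at hcard
  rw [hcard, ← smul_eq_mul, ← sum_const]
  refine sum_congr rfl fun w' hw' => ?_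
  obtain ⟨ρ, rfl⟩ := exists_perm_of_mem_words hw hw'
  have hstab := DomMulAct.stabilizer_card (α := Fin n) w
  have hfib : ∀ k, Fintype.card {a // w a = k} = r k := fun k => by
    rw [Fintype.card_subtype]
    exact mem_words.1 hw k
  simp only [hfib] at hstab
  rw [← hstab, Fintype.card_subtype]
  refine card_bij (fun g _ => g * ρ) ?_ ?_ ?_
  · intro g hg
    simp only [mem_filter, mem_univ, true_and] at hg ⊢
    funext i
    exact congrFun hg (ρ i)
  · intro g _ g' _ h
    exact mul_right_cancel h
  · intro g hg
    simp only [mem_filter, mem_univ, true_and] at hg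
    refine ⟨g * ρ⁻¹, ?_, by simp⟩
    simp only [mem_filter, mem_univ, true_and]
    funext i
    have := congrFun hg (ρ⁻¹ i)
    simpa using this

theorem prod_comp_eq_prod_pow_letterCount (w : Fin n → K) (f : K → ℝ) :
    ∏ i, f (w i) = ∏ k, f k ^ letterCount w k := by
  unfold letterCount
  rw [← prod_fiberwise' univ w f]
  simp [prod_const]

/-! ### Pairs of words -/

/-- The total weight of the pairs of words with letter counts `r` and `c`. -/
noncomputable def pairSum (W : K → K → ℝ) (n : ℕ) (r c : K → ℕ) : ℝ :=
  ∑ s ∈ words n r, ∑ t ∈ words n c, ∏ i, W (s i) (t i)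

/-- The total weight of the perfect matchings between two words. -/
noncomputable def matchingSum (W : K → K → ℝ) (s t : Fin n → K) : ℝ :=
  ∑ π : Equiv.Perm (Fin n), ∏ i, W (s i) (t (π i))

theorem matchingSum_comp_perm (W : K → K → ℝ) (s t : Fin n → K) (ρ τ : Equiv.Perm (Fin n)) :
    matchingSum W (fun i => s (ρ i)) (fun i => t (τ i)) = matchingSum W s t := by
  unfold matchingSum
  -- Substitute π ↦ τ π ρ⁻¹ in the sum and i ↦ ρ i in the product.
  refine Fintype.sum_equiv ((Equiv.mulLeft τ).trans (Equiv.mulRight ρ⁻¹)) _ _ fun π => ?_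
  refine Fintype.prod_equiv ρ _ _ fun i => ?_
  simp

theorem sum_words_comp_perm {r : K → ℕ} (f : (Fin n → K) → ℝ) (π : Equiv.Perm (Fin n)) :
    ∑ t ∈ words n r, f (fun i => t (π i)) = ∑ t ∈ words n r, f t := by
  refine sum_bij' (fun t _ i => t (π i)) (fun t _ i => t (π⁻¹ i)) ?_ ?_ ?_ ?_ ?_
  · intro t ht
    exact comp_perm_mem_words ht π
  · intro t ht
    exact comp_perm_mem_words ht π⁻¹
  · intro t _
    simp
  · intro t _
    simp
  · intro t _
    rfl

/-- The matching sum depends only on the letter counts, so it equals its average over all pairs of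
words. In the total over all pairs each permutation contributes the same `pairSum`, since composing
with it permutes the words. -/
theorem matchingSum_mul_card {r c : K → ℕ} (W : K → K → ℝ) {s t : Fin n → K}
    (hs : s ∈ words n r) (ht : t ∈ words n c) :
    matchingSum W s t * ((words n r).card * (words n c).card) =
      n.factorial * pairSum W n r c := by
  have h1 : ∑ s' ∈ words n r, ∑ t' ∈ words n c, matchingSum W s' t' =
      matchingSum W s t * ((words n r).card * (words n c).card) := by
    have : ∀ s' ∈ words n r, ∀ t' ∈ words n c, matchingSum W s' t' = matchingSum W s t := by
      intro s' hs' t' ht'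
      obtain ⟨ρ, rfl⟩ := exists_perm_of_mem_words hs hs'
      obtain ⟨τ, rfl⟩ := exists_perm_of_mem_words ht ht'
      exact matchingSum_comp_perm W s t ρ τ
    rw [sum_congr rfl fun s' hs' => sum_congr rfl (this s' hs')]
    simp only [sum_const, nsmul_eq_mul]
    ring
  rw [← h1]
  unfold matchingSum pairSum
  have h2 : ∀ s' : Fin n → K, ∑ t' ∈ words n c, ∑ π : Equiv.Perm (Fin n),
      ∏ i, W (s' i) (t' (π i)) = n.factorial * ∑ t' ∈ words n c, ∏ i, W (s' i) (t' i) := by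
    intro s'
    rw [sum_comm]
    rw [sum_congr rfl fun π _ => sum_words_comp_perm (r := c) (fun t' => ∏ i, W (s' i) (t' i)) π]
    simp [Fintype.card_perm]
  rw [sum_congr rfl fun s' _ => h2 s', mul_sum]

end Words

/-! ### The expected overlap sum in terms of words -/

/-- The weight of a vertex of spin `s`. -/
noncomputable def vertexWeight (lam : ℝ) (s : ℤˣ) : ℝ := if s = -1 then lam else 1

/-- The weight of an edge whose endpoints have spins `s` and `t`. -/
noncomputable def edgeWeight (B₁ B₂ : ℝ) (s t : ℤˣ) : ℝ :=
  if s = -1 ∧ t = -1 then B₁ else if s = 1 ∧ t = 1 then B₂ else 1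

/-- The weight of an edge in a pair of configurations. -/
noncomputable def pairEdgeWeight (B₁ B₂ : ℝ) (s t : ℤˣ × ℤˣ) : ℝ :=
  edgeWeight B₁ B₂ s.1 t.1 * edgeWeight B₁ B₂ s.2 t.2

theorem weight_eq_prod {V E : Type} [Fintype V] [Fintype E] (ends : E → V × V)
    (B₁ B₂ lam : ℝ) (σ : V → ℤˣ) :
    weight ends B₁ B₂ lam σ =
      (∏ v, vertexWeight lam (σ v)) * ∏ e, edgeWeight B₁ B₂ (σ (ends e).1) (σ (ends e).2) := by
  have h : ∀ s t : ℤˣ, edgeWeight B₁ B₂ s t =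
      (if s = -1 ∧ t = -1 then B₁ else 1) * if s = 1 ∧ t = 1 then B₂ else 1 := by
    intro s t
    rcases Int.units_eq_one_or s with rfl | rfl <;> rcases Int.units_eq_one_or t with rfl | rfl <;>
      simp [edgeWeight]
  simp only [h, prod_mul_distrib, vertexWeight, weight, prod_ite, prod_const, one_pow, mul_one,
    mul_assoc]

/-- The letter counts of a pair of binary words with `a` letters `-1` each and overlap `g`. -/
def overlapCounts (n a g : ℕ) (s : ℤˣ × ℤˣ) : ℕ :=
  if s = (-1, -1) then g else if s = (1, 1) then n + g - 2 * a else a - g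

theorem sum_units_prod {M : Type*} [AddCommMonoid M] (f : ℤˣ × ℤˣ → M) :
    ∑ s, f s = f (1, 1) + f (1, -1) + (f (-1, 1) + f (-1, -1)) := by
  rw [Fintype.sum_prod_type]
  have h : ∀ g : ℤˣ → M, ∑ s, g s = g 1 + g (-1) := fun g => by
    rw [show (univ : Finset ℤˣ) = {1, -1} from rfl, sum_pair (by decide)]
  simp only [h]

/-- The two marginal counts and the overlap determine all four joint counts. The inequalities say
that the subtractions in `overlapCounts` are not truncated. -/
theorem pair_mem_words_iff {n a g : ℕ} (f₁ f₂ : Fin n → ℤˣ) :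
    ((univ.filter fun i => f₁ i = -1).card = a ∧ (univ.filter fun i => f₂ i = -1).card = a ∧
      (univ.filter fun i => f₁ i = -1 ∧ f₂ i = -1).card = g) ↔
    (g ≤ a ∧ 2 * a ≤ n + g) ∧ (fun i => (f₁ i, f₂ i)) ∈ words n (overlapCounts n a g) := by
  set w : Fin n → ℤˣ × ℤˣ := fun i => (f₁ i, f₂ i) with hw
  have hor : ∀ s : ℤˣ, s = 1 ∨ s = -1 := Int.units_eq_one_or
  have hne : (1 : ℤˣ) ≠ -1 := by decide
  have h3 : (univ.filter fun i => f₁ i = -1 ∧ f₂ i = -1).card = letterCount w (-1, -1) := by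
    simp [letterCount, hw]
  have h1 : (univ.filter fun i => f₁ i = -1).card =
      letterCount w (-1, -1) + letterCount w (-1, 1) := by
    unfold letterCount
    rw [← card_union_of_disjoint]
    · congr 1
      ext i
      rcases hor (f₁ i) with h | h <;> rcases hor (f₂ i) with h' | h' <;> simp [hw, h, h']
    · rw [disjoint_filter]
      intro i _ h h'
      rw [h] at h'
      exact absurd h' (by decide)
  have h2 : (univ.filter fun i => f₂ i = -1).card =
      letterCount w (-1, -1) + letterCount w (1, -1) := by
    unfold letterCount
    rw [← card_union_of_disjoint]
    · congr 1
      ext i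
      rcases hor (f₁ i) with h | h <;> rcases hor (f₂ i) with h' | h' <;> simp [hw, h, h']
    · rw [disjoint_filter]
      intro i _ h h'
      rw [h] at h'
      exact absurd h' (by decide)
  have hs := sum_letterCount w
  rw [sum_units_prod] at hs
  rw [h1, h2, h3, mem_words]
  constructor
  · rintro ⟨e1, e2, e3⟩
    refine ⟨⟨by omega, by omega⟩, ?_⟩
    rintro ⟨s, t⟩
    rcases hor s with rfl | rfl <;> rcases hor t with rfl | rfl <;>
      simp [overlapCounts, hne, hne.symm] <;> omega
  · rintro ⟨⟨e1, e2⟩, e3⟩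
    have c1 := e3 (-1, -1)
    have c2 := e3 (-1, 1)
    have c3 := e3 (1, -1)
    simp [overlapCounts, hne, hne.symm] at c1 c2 c3
    refine ⟨by omega, by omega, by omega⟩

theorem sum_overlapCounts {n a g : ℕ} (h : g ≤ a) (h' : 2 * a ≤ n + g) :
    ∑ s, overlapCounts n a g s = n := by
  rw [sum_units_prod]
  have hne : (1 : ℤˣ) ≠ -1 := by decide
  simp [overlapCounts, hne, hne.symm]
  omega

theorem mem_overlapPairs {n a b g k : ℕ} (s : (BipVertex n → ℤˣ) × (BipVertex n → ℤˣ)) :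
    s ∈ overlapPairs n a b g k ↔
      HasCounts a b s.1 ∧ HasCounts a b s.2 ∧ HasOverlaps g k s.1 s.2 := by
  classical
  exact mem_filter.trans (and_iff_right (mem_univ s))

theorem mem_overlapPairs_iff {n a b g k : ℕ} (s : (BipVertex n → ℤˣ) × (BipVertex n → ℤˣ)) :
    s ∈ overlapPairs n a b g k ↔
      ((g ≤ a ∧ 2 * a ≤ n + g) ∧
        (fun i => (s.1 (Sum.inl i), s.2 (Sum.inl i))) ∈ words n (overlapCounts n a g)) ∧
      ((k ≤ b ∧ 2 * b ≤ n + k) ∧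
        (fun i => (s.1 (Sum.inr i), s.2 (Sum.inr i))) ∈ words n (overlapCounts n b k)) := by
  rw [← pair_mem_words_iff, ← pair_mem_words_iff, mem_overlapPairs]
  unfold HasCounts HasOverlaps
  tauto

theorem overlapPairs_nonempty_iff {n a b g k : ℕ} :
    (overlapPairs n a b g k).Nonempty ↔
      (g ≤ a ∧ 2 * a ≤ n + g) ∧ (k ≤ b ∧ 2 * b ≤ n + k) := by
  constructor
  · rintro ⟨s, hs⟩
    rw [mem_overlapPairs_iff] at hs
    exact ⟨hs.1.1, hs.2.1⟩
  · rintro ⟨h, h'⟩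
    obtain ⟨u, hu⟩ := words_nonempty (sum_overlapCounts h.1 h.2)
    obtain ⟨v, hv⟩ := words_nonempty (sum_overlapCounts h'.1 h'.2)
    exact ⟨(Sum.elim (fun i => (u i).1) fun i => (v i).1,
      Sum.elim (fun i => (u i).2) fun i => (v i).2),
      (mem_overlapPairs_iff _).2 ⟨⟨h, hu⟩, ⟨h', hv⟩⟩⟩

theorem sum_overlapPairs {n a b g k : ℕ} (h : (overlapPairs n a b g k).Nonempty)
    (F : (Fin n → ℤˣ × ℤˣ) → (Fin n → ℤˣ × ℤˣ) → ℝ) :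
    ∑ s ∈ overlapPairs n a b g k, F (fun i => (s.1 (Sum.inl i), s.2 (Sum.inl i)))
        (fun i => (s.1 (Sum.inr i), s.2 (Sum.inr i))) =
      ∑ u ∈ words n (overlapCounts n a g), ∑ v ∈ words n (overlapCounts n b k), F u v := by
  rw [overlapPairs_nonempty_iff] at h
  rw [← sum_product']
  refine sum_bij' (fun s _ => (fun i => (s.1 (Sum.inl i), s.2 (Sum.inl i)),
        fun i => (s.1 (Sum.inr i), s.2 (Sum.inr i))))
    (fun w _ => (Sum.elim (fun i => (w.1 i).1) fun i => (w.2 i).1,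
      Sum.elim (fun i => (w.1 i).2) fun i => (w.2 i).2)) ?_ ?_ ?_ ?_ ?_
  · intro s hs
    rw [mem_overlapPairs_iff] at hs
    exact mem_product.2 ⟨hs.1.2, hs.2.2⟩
  · intro w hw
    rw [mem_product] at hw
    exact (mem_overlapPairs_iff _).2 ⟨⟨h.1, hw.1⟩, ⟨h.2, hw.2⟩⟩
  · intro s _
    ext v <;> cases v <;> rfl
  · intro w _
    rfl
  · intro s _
    rfl

theorem prod_vertexWeight {n a : ℕ} (lam : ℝ) (f : Fin n → ℤˣ)
    (h : (univ.filter fun i => f i = -1).card = a) : ∏ i, vertexWeight lam (f i) = lam ^ a := by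
  simp [vertexWeight, prod_ite, h]

/-- The vertex factor is constant on the pairs considered, and the expected weight of one matching
is the same for all of them, so only the number of pairs and a Δ-th power remain. -/
theorem expectedOverlapSum_eq {Δ n a b g k : ℕ} (B₁ B₂ lam : ℝ)
    (h : (overlapPairs n a b g k).Nonempty) :
    expectedOverlapSum Δ B₁ B₂ lam n a b g k =
      lam ^ (2 * (a + b)) *
        ((words n (overlapCounts n a g)).card * (words n (overlapCounts n b k)).card : ℝ) *
        (pairSum (pairEdgeWeight B₁ B₂) n (overlapCounts n a g) (overlapCounts n b k) /
          ((words n (overlapCounts n a g)).card * (words n (overlapCounts n b k)).card)) ^ Δ := by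
  set R := words n (overlapCounts n a g) with hR
  set C := words n (overlapCounts n b k) with hC
  set Z := pairSum (pairEdgeWeight B₁ B₂) n (overlapCounts n a g) (overlapCounts n b k) with hZ
  have hne := overlapPairs_nonempty_iff.1 h
  have hRpos : (0 : ℝ) < R.card := by
    exact_mod_cast card_pos.2 (words_nonempty (sum_overlapCounts hne.1.1 hne.1.2))
  have hCpos : (0 : ℝ) < C.card := by
    exact_mod_cast card_pos.2 (words_nonempty (sum_overlapCounts hne.2.1 hne.2.2))
  have hfac : (0 : ℝ) < n.factorial := by exact_mod_cast n.factorial_pos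
  have hsum : ∑ π : Fin Δ → Equiv.Perm (Fin n), overlapSum B₁ B₂ lam a b g k π =
      ∑ s ∈ overlapPairs n a b g k, lam ^ (2 * (a + b)) *
        matchingSum (pairEdgeWeight B₁ B₂) (fun i => (s.1 (Sum.inl i), s.2 (Sum.inl i)))
          (fun i => (s.1 (Sum.inr i), s.2 (Sum.inr i))) ^ Δ := by
    unfold overlapSum
    rw [sum_comm]
    refine sum_congr rfl fun s hs => ?_
    rw [mem_overlapPairs] at hs
    unfold matchingSum
    -- Independence of the matchings: the sum over Δ-tuples of permutations of a product is the Δ-th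
    -- power of a sum over one permutation.
    rw [Fintype.sum_pow, mul_sum]
    refine sum_congr rfl fun π _ => ?_
    rw [weight_eq_prod, weight_eq_prod]
    simp only [Fintype.prod_sum_type, Fintype.prod_prod_type, matchingEnds, pairEdgeWeight,
      prod_mul_distrib]
    rw [prod_vertexWeight lam _ hs.1.1, prod_vertexWeight lam _ hs.1.2,
      prod_vertexWeight lam _ hs.2.1.1, prod_vertexWeight lam _ hs.2.1.2]
    ring
  unfold expectedOverlapSum
  rw [hsum, sum_overlapPairs h fun u v => lam ^ (2 * (a + b)) *
    matchingSum (pairEdgeWeight B₁ B₂) u v ^ Δ]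
  have hval : ∀ u ∈ R, ∀ v ∈ C, matchingSum (pairEdgeWeight B₁ B₂) u v =
      n.factorial * (Z / (R.card * C.card)) := by
    intro u hu v hv
    have := matchingSum_mul_card (pairEdgeWeight B₁ B₂) hu hv
    rw [← mul_div_assoc, eq_div_iff (by positivity), this]
  rw [sum_congr rfl fun u hu => sum_congr rfl fun v hv => by rw [hval u hu v hv]]
  simp only [sum_const, nsmul_eq_mul, Fintype.card_fun, Fintype.card_perm, Fintype.card_fin]
  push_cast
  rw [mul_pow, ← hR, ← hC]
  field_simp

/-! ### Entropy and the growth of the number of words -/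

theorem log_factorial_lower (m : ℕ) :
    (m : ℝ) * Real.log m - m ≤ Real.log m.factorial := by
  induction m with
  | zero => simp
  | succ m ih =>
    rw [Nat.factorial_succ]
    push_cast
    rw [Real.log_mul (by positivity) (by positivity)]
    rcases Nat.eq_zero_or_pos m with rfl | hm
    · simp
    have hm' : (0 : ℝ) < m := by exact_mod_cast hm
    have h1 : Real.log ((m + 1) / m) ≤ (m + 1) / m - 1 := Real.log_le_sub_one_of_pos (by positivity)
    rw [Real.log_div (by positivity) (by positivity)] at h1
    have h2 : (m : ℝ) * (Real.log (m + 1) - Real.log m) ≤ m * ((m + 1) / m - 1) :=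
      mul_le_mul_of_nonneg_left h1 hm'.le
    have h3 : (m : ℝ) * ((m + 1) / m - 1) = 1 := by field_simp; ring
    linarith

theorem log_factorial_upper (m : ℕ) :
    Real.log m.factorial ≤ (m : ℝ) * Real.log m - m + (Real.log (m + 1) + 1) := by
  -- For k = m + 1 the sharper error log k + 1 reproduces itself under induction; the weaker log (k
  -- + 1) + 1 of the statement also covers k = 0.
  have key : ∀ m : ℕ, Real.log (m + 1).factorial ≤
      ((m : ℝ) + 1) * Real.log (m + 1) - (m + 1) + (Real.log (m + 1) + 1) := by
    intro m
    induction m with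
    | zero => simp
    | succ m ih =>
      rw [Nat.factorial_succ]
      push_cast
      rw [Real.log_mul (by positivity) (by positivity)]
      have h1 : Real.log (((m : ℝ) + 1) / (m + 1 + 1)) ≤ ((m : ℝ) + 1) / (m + 1 + 1) - 1 :=
        Real.log_le_sub_one_of_pos (by positivity)
      rw [Real.log_div (by positivity) (by positivity)] at h1
      have h2 := mul_le_mul_of_nonneg_left h1 (by positivity : (0 : ℝ) ≤ m + 1 + 1)
      have h3 : ((m : ℝ) + 1 + 1) * ((m + 1) / (m + 1 + 1) - 1) = -1 := by field_simp; ring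
      linarith
  rcases m with _ | m
  · simp
  · have := key m
    have h2 : Real.log ((m : ℝ) + 1) ≤ Real.log ((m : ℝ) + 1 + 1) :=
      Real.log_le_log (by positivity) (by linarith)
    push_cast
    linarith

section Entropy

variable {K : Type} [Fintype K] [DecidableEq K]

/-- The entropy of a family of probabilities. -/
noncomputable def entropy (p : K → ℝ) : ℝ := ∑ k, Real.negMulLog (p k)

theorem continuous_entropy : Continuous (entropy : (K → ℝ) → ℝ) := by
  unfold entropy
  exact continuous_finsetSum _ fun k _ => Real.continuous_negMulLog.comp (continuous_apply k)

/-- Stirling for the multinomial coefficient. The error is uniform in the counts `r`, which the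
upper bound over all contingency tables needs. -/
theorem log_card_words_bound {n : ℕ} {r : K → ℕ} (hr : ∑ k, r k = n) :
    |Real.log (words n r).card - n * entropy fun k => (r k : ℝ) / n| ≤
      (Fintype.card K + 1) * (Real.log (n + 1) + 1) := by
  have hcard : ((words n r).card : ℝ) * ∏ k, ((r k).factorial : ℝ) = n.factorial := by
    exact_mod_cast card_words_mul hr
  have hpos : (0 : ℝ) < (words n r).card := by exact_mod_cast card_pos.2 (words_nonempty hr)
  have hlog : Real.log (words n r).card = Real.log n.factorial -
      ∑ k, Real.log (r k).factorial := by
    rw [← hcard, Real.log_mul hpos.ne' (prod_ne_zero_iff.2 fun k _ => by positivity),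
      Real.log_prod (fun k _ => by positivity)]
    ring
  have hent : (n : ℝ) * entropy (fun k => (r k : ℝ) / n) =
      (n * Real.log n - n) - ∑ k, ((r k : ℝ) * Real.log (r k) - r k) := by
    have hsum : ∑ k, (r k : ℝ) = n := by exact_mod_cast hr
    rcases Nat.eq_zero_or_pos n with rfl | hn
    · have : ∀ k, r k = 0 := fun k => by
        have := single_le_sum (f := r) (fun _ _ => Nat.zero_le _) (mem_univ k)
        omega
      simp [this]
    have hn' : (n : ℝ) ≠ 0 := by positivity
    have hterm : ∀ k, (n : ℝ) * Real.negMulLog ((r k : ℝ) / n) =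
        r k * Real.log n - r k * Real.log (r k) := by
      intro k
      rcases Nat.eq_zero_or_pos (r k) with h | h
      · simp [h]
      · have hk : (r k : ℝ) ≠ 0 := by positivity
        rw [Real.negMulLog, Real.log_div hk hn']
        field_simp
        ring
    unfold entropy
    rw [mul_sum, sum_congr rfl fun k _ => hterm k, sum_sub_distrib, ← sum_mul, hsum,
      sum_sub_distrib, hsum]
    ring
  have hn1 := log_factorial_lower n
  have hn2 := log_factorial_upper n
  have hs1 : ∑ k, ((r k : ℝ) * Real.log (r k) - r k) ≤ ∑ k, Real.log (r k).factorial :=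
    sum_le_sum fun k _ => log_factorial_lower (r k)
  have hs2 : ∑ k, Real.log (r k).factorial ≤
      ∑ k, ((r k : ℝ) * Real.log (r k) - r k) + Fintype.card K * (Real.log (n + 1) + 1) := by
    have : ∑ _k : K, (Real.log ((n : ℝ) + 1) + 1) = Fintype.card K * (Real.log (n + 1) + 1) := by
      rw [sum_const, card_univ, nsmul_eq_mul]
    rw [← this, ← sum_add_distrib]
    refine sum_le_sum fun k _ => (log_factorial_upper (r k)).trans ?_
    have hle : (r k : ℝ) ≤ n := by
      exact_mod_cast hr ▸ single_le_sum (f := r) (fun _ _ => Nat.zero_le _) (mem_univ k)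
    have : Real.log ((r k : ℝ) + 1) ≤ Real.log (n + 1) :=
      Real.log_le_log (by positivity) (by linarith)
    linarith
  have hL : 0 ≤ Real.log ((n : ℝ) + 1) := Real.log_nonneg (by linarith [n.cast_nonneg (α := ℝ)])
  have hKL : 0 ≤ (Fintype.card K : ℝ) * (Real.log (n + 1) + 1) := by positivity
  rw [hlog, hent, abs_le]
  constructor <;> linarith

theorem tendsto_log_div_nat (C : ℝ) :
    Tendsto (fun n : ℕ => C * (Real.log ((n : ℝ) + 1) + 1) / n) atTop (𝓝 0) := by
  have h1 : Tendsto (fun n : ℕ => Real.log ((n : ℝ) + 1) / ((n : ℝ) + 1)) atTop (𝓝 0) := by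
    have h := (Real.isLittleO_log_id_atTop).tendsto_div_nhds_zero
    have h2 : Tendsto (fun n : ℕ => (n : ℝ) + 1) atTop atTop :=
      tendsto_atTop_add_const_right _ _ tendsto_natCast_atTop_atTop
    exact h.comp h2
  have h2 : Tendsto (fun n : ℕ => ((n : ℝ) + 1) / n) atTop (𝓝 1) := by
    have : Tendsto (fun n : ℕ => 1 + 1 / (n : ℝ)) atTop (𝓝 (1 + 0)) :=
      tendsto_const_nhds.add tendsto_one_div_atTop_nhds_zero_nat
    rw [add_zero] at this
    refine this.congr' ?_
    filter_upwards [eventually_gt_atTop 0] with n hn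
    have : (n : ℝ) ≠ 0 := by positivity
    field_simp
  have h3 := ((h1.mul h2).add (tendsto_one_div_atTop_nhds_zero_nat (𝕜 := ℝ))).const_mul C
  simp only [zero_mul, add_zero, mul_zero] at h3
  refine h3.congr' ?_
  filter_upwards [eventually_gt_atTop 0] with n hn
  have : (n : ℝ) ≠ 0 := by positivity
  have : (n : ℝ) + 1 ≠ 0 := by positivity
  field_simp

theorem tendsto_log_card_words {r : ℕ → K → ℕ} {p : K → ℝ} (hr : ∀ᶠ n in atTop, ∑ k, r n k = n)
    (hp : ∀ k, Tendsto (fun n => (r n k : ℝ) / n) atTop (𝓝 (p k))) :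
    Tendsto (fun n : ℕ => 1 / (n : ℝ) * Real.log (words n (r n)).card) atTop
      (𝓝 (entropy p)) := by
  have hent : Tendsto (fun n => entropy fun k => (r n k : ℝ) / n) atTop (𝓝 (entropy p)) :=
    (continuous_entropy.tendsto p).comp (tendsto_pi_nhds.2 hp)
  refine tendsto_of_tendsto_of_dist hent
    (squeeze_zero' (Eventually.of_forall fun n => dist_nonneg) ?_
      (tendsto_log_div_nat (Fintype.card K + 1)))
  filter_upwards [hr, eventually_gt_atTop 0] with n hn h0
  have h0' : (0 : ℝ) < n := by exact_mod_cast h0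
  rw [dist_comm, Real.dist_eq, le_div_iff₀ h0', ← abs_of_pos h0', ← abs_mul, abs_of_pos h0']
  refine le_of_eq_of_le ?_ (log_card_words_bound hn)
  congr 1
  field_simp

end Entropy

section Tables

variable {K : Type} [Fintype K] [DecidableEq K]

/-! ### Contingency tables and couplings -/

/-- `N` is a table with row sums `r` and column sums `c`. -/
def IsTable {M : Type} [AddCommMonoid M] (N : K × K → M) (r c : K → M) : Prop :=
  (∀ i, ∑ j, N (i, j) = r i) ∧ ∀ j, ∑ i, N (i, j) = c j

theorem isTable_letterCount {n : ℕ} {r c : K → ℕ} {s t : Fin n → K} (hs : s ∈ words n r)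
    (ht : t ∈ words n c) : IsTable (letterCount fun i => (s i, t i)) r c := by
  rw [mem_words] at hs ht
  constructor
  · intro i
    rw [← hs i]
    unfold letterCount
    rw [card_eq_sum_card_fiberwise (f := t) (t := univ) (by simp)]
    refine sum_congr rfl fun j _ => ?_
    rw [filter_filter]
    simp only [Prod.mk.injEq]
  · intro j
    rw [← ht j]
    unfold letterCount
    rw [card_eq_sum_card_fiberwise (f := s) (t := univ) (by simp)]
    refine sum_congr rfl fun i _ => ?_
    rw [filter_filter]
    simp only [Prod.mk.injEq, and_comm]

theorem fst_snd_mem_words {n : ℕ} {r c : K → ℕ} {N : K × K → ℕ} (hN : IsTable N r c)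
    {w : Fin n → K × K} (hw : w ∈ words n N) :
    (fun i => (w i).1) ∈ words n r ∧ (fun i => (w i).2) ∈ words n c := by
  rw [mem_words] at hw
  have h := isTable_letterCount (s := fun i => (w i).1) (t := fun i => (w i).2)
    (r := letterCount fun i => (w i).1) (c := letterCount fun i => (w i).2)
    (mem_words.2 fun _ => rfl) (mem_words.2 fun _ => rfl)
  constructor
  · rw [mem_words]
    intro k
    rw [← h.1 k, ← hN.1 k]
    exact sum_congr rfl fun j _ => hw (k, j)
  · rw [mem_words]
    intro k
    rw [← h.2 k, ← hN.2 k]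
    exact sum_congr rfl fun j _ => hw (j, k)

theorem sum_table {M : Type} [AddCommMonoid M] {N : K × K → M} {r c : K → M}
    (hN : IsTable N r c) : ∑ x, N x = ∑ k, r k := by
  rw [Fintype.sum_prod_type]
  exact sum_congr rfl fun i _ => hN.1 i

theorem exists_table {r c : K → ℕ} (h : ∑ k, r k = ∑ k, c k) :
    ∃ N : K × K → ℕ, IsTable N r c := by
  obtain ⟨s, hs⟩ := words_nonempty (n := ∑ k, c k) h
  obtain ⟨t, ht⟩ := words_nonempty (n := ∑ k, c k) (r := c) rfl
  exact ⟨_, isTable_letterCount hs ht⟩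

/-- The total weight of the words of pairs with table `N`. -/
noncomputable def tableWeight (W : K → K → ℝ) (n : ℕ) (N : K × K → ℕ) : ℝ :=
  (words n N).card * ∏ x : K × K, W x.1 x.2 ^ N x

theorem sum_words_eq_tableWeight (W : K → K → ℝ) (n : ℕ) (N : K × K → ℕ) :
    ∑ w ∈ words n N, ∏ i, W (w i).1 (w i).2 = tableWeight W n N := by
  unfold tableWeight
  rw [← nsmul_eq_mul, ← sum_const]
  refine sum_congr rfl fun w hw => ?_
  rw [prod_comp_eq_prod_pow_letterCount w fun x => W x.1 x.2]
  exact prod_congr rfl fun x _ => by rw [mem_words.1 hw x]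

theorem pairSum_eq_sum (W : K → K → ℝ) (n : ℕ) (r c : K → ℕ) :
    pairSum W n r c = ∑ w ∈ univ.filter (fun w : Fin n → K × K =>
      (fun i => (w i).1) ∈ words n r ∧ (fun i => (w i).2) ∈ words n c),
        ∏ i, W (w i).1 (w i).2 := by
  unfold pairSum
  rw [← sum_product']
  refine sum_bij' (fun p _ i => (p.1 i, p.2 i)) (fun w _ => (fun i => (w i).1, fun i => (w i).2))
    ?_ ?_ ?_ ?_ ?_
  · intro p hp
    simpa using hp
  · intro w hw
    simpa using hw
  · intro p _
    rfl
  · intro w _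
    rfl
  · intro p _
    rfl

theorem tableWeight_le_pairSum {W : K → K → ℝ} (hW : ∀ i j, 0 < W i j) {n : ℕ} {r c : K → ℕ}
    {N : K × K → ℕ} (hN : IsTable N r c) : tableWeight W n N ≤ pairSum W n r c := by
  rw [pairSum_eq_sum, ← sum_words_eq_tableWeight]
  refine sum_le_sum_of_subset_of_nonneg ?_ fun w _ _ => prod_nonneg fun i _ => (hW _ _).le
  intro w hw
  simpa using fst_snd_mem_words hN hw

/-- Method of types: there are only polynomially many tables, so the sum over tables is, up to a
polynomial factor, bounded by the largest term. -/
theorem pairSum_le {W : K → K → ℝ} (hW : ∀ i j, 0 < W i j) {n : ℕ} {r c : K → ℕ} {A : ℝ}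
    (hA : 0 ≤ A) (h : ∀ N : K × K → ℕ, IsTable N r c → tableWeight W n N ≤ A) :
    pairSum W n r c ≤ ((n : ℝ) + 1) ^ Fintype.card (K × K) * A := by
  have hmaps : ∀ w ∈ univ.filter (fun w : Fin n → K × K =>
      (fun i => (w i).1) ∈ words n r ∧ (fun i => (w i).2) ∈ words n c),
      letterCount w ∈ Fintype.piFinset fun _ : K × K => range (n + 1) := by
    intro w _
    rw [Fintype.mem_piFinset]
    intro x
    rw [mem_range, Nat.lt_succ_iff]
    exact (card_le_univ _).trans (by simp)
  rw [pairSum_eq_sum, ← sum_fiberwise_of_maps_to hmaps]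
  have hle : ∀ N ∈ Fintype.piFinset fun _ : K × K => range (n + 1),
      ∑ w ∈ (univ.filter (fun w : Fin n → K × K =>
        (fun i => (w i).1) ∈ words n r ∧ (fun i => (w i).2) ∈ words n c)).filter
          (fun w => letterCount w = N), ∏ i, W (w i).1 (w i).2 ≤ A := by
    intro N _
    by_cases hN : IsTable N r c
    · refine le_trans ?_ (h N hN)
      rw [← sum_words_eq_tableWeight]
      refine sum_le_sum_of_subset_of_nonneg ?_ fun w _ _ => prod_nonneg fun i _ => (hW _ _).le
      intro w hw
      rw [mem_filter] at hw
      rw [mem_words]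
      exact congrFun hw.2
    · rw [sum_eq_zero]
      · exact hA
      intro w hw
      simp only [mem_filter, mem_univ, true_and] at hw
      exact absurd (hw.2 ▸ isTable_letterCount hw.1.1 hw.1.2) hN
  refine (sum_le_card_nsmul _ _ _ hle).trans (le_of_eq ?_)
  rw [nsmul_eq_mul, Fintype.card_piFinset]
  simp only [card_range, prod_const, card_univ]
  push_cast
  rfl

/-! ### Exponential growth of sums over contingency tables -/

/-- The exponential rate of the words of pairs with letter frequencies `P`. -/
noncomputable def tableRate (W : K → K → ℝ) (P : K × K → ℝ) : ℝ :=
  ∑ x, P x * Real.log (W x.1 x.2) + entropy P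

theorem continuous_tableRate (W : K → K → ℝ) : Continuous (tableRate W) :=
  (continuous_finsetSum _ fun x _ => (continuous_apply x).mul continuous_const).add
    continuous_entropy

theorem log_tableWeight_bound {W : K → K → ℝ} (hW : ∀ i j, 0 < W i j) {n : ℕ} (hn : 0 < n)
    {N : K × K → ℕ} (hN : ∑ x, N x = n) :
    |Real.log (tableWeight W n N) - n * tableRate W fun x => (N x : ℝ) / n| ≤
      (Fintype.card (K × K) + 1) * (Real.log (n + 1) + 1) := by
  have hpos : (0 : ℝ) < (words n N).card := by exact_mod_cast card_pos.2 (words_nonempty hN)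
  have hn' : (n : ℝ) ≠ 0 := by positivity
  have hpow : ∀ x ∈ (univ : Finset (K × K)), W x.1 x.2 ^ N x ≠ 0 :=
    fun x _ => pow_ne_zero _ (hW _ _).ne'
  unfold tableWeight tableRate
  rw [Real.log_mul hpos.ne' (prod_ne_zero_iff.2 hpow), Real.log_prod hpow, mul_add, mul_sum]
  have : ∀ x : K × K, (n : ℝ) * (N x / n * Real.log (W x.1 x.2)) = Real.log (W x.1 x.2 ^ N x) := by
    intro x
    rw [Real.log_pow]
    field_simp
  rw [sum_congr rfl fun x _ => this x]
  refine le_of_eq_of_le ?_ (log_card_words_bound hN)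
  congr 1
  ring

/-- The couplings of `μ` and `ν`. -/
def couplings (μ ν : K → ℝ) : Set (K × K → ℝ) := {P | (∀ x, 0 ≤ P x) ∧ IsTable P μ ν}

theorem tendsto_floor_div {y : ℕ → ℝ} {x : ℝ} (hy : ∀ n, 0 ≤ y n)
    (h : Tendsto (fun n => y n / n) atTop (𝓝 x)) :
    Tendsto (fun n => (⌊y n⌋₊ : ℝ) / n) atTop (𝓝 x) := by
  have h1 : Tendsto (fun n : ℕ => y n / n - 1 / (n : ℝ)) atTop (𝓝 (x - 0)) :=
    h.sub tendsto_one_div_atTop_nhds_zero_nat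
  rw [sub_zero] at h1
  refine tendsto_of_tendsto_of_tendsto_of_le_of_le h1 h ?_ ?_
  · intro n
    dsimp only
    rw [← sub_div]
    exact div_le_div_of_nonneg_right (Nat.sub_one_lt_floor _).le n.cast_nonneg
  · intro n
    exact div_le_div_of_nonneg_right (Nat.floor_le (hy n)) n.cast_nonneg

/-- A coupling has to be approximated by integer tables with exactly the prescribed margins.
Rounding down a rescaled `P` stays below all margins; the missing row and column sums have equal
totals, are o(n), and can be filled by any table. -/
theorem exists_tables_tendsto {μ ν : K → ℝ} {P : K × K → ℝ} (hP : P ∈ couplings μ ν)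
    {r c : ℕ → K → ℕ} (hr : ∀ᶠ n in atTop, ∑ k, r n k = n) (hc : ∀ᶠ n in atTop, ∑ k, c n k = n)
    (hμ : ∀ k, Tendsto (fun n => (r n k : ℝ) / n) atTop (𝓝 (μ k)))
    (hν : ∀ k, Tendsto (fun n => (c n k : ℝ) / n) atTop (𝓝 (ν k))) :
    ∃ N : ℕ → K × K → ℕ, (∀ᶠ n in atTop, IsTable (N n) (r n) (c n)) ∧
      ∀ x, Tendsto (fun n => (N n x : ℝ) / n) atTop (𝓝 (P x)) := by
  obtain ⟨hP0, hP1, hP2⟩ := hP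
  have hμ0 : ∀ i, 0 ≤ μ i := fun i => hP1 i ▸ sum_nonneg fun j _ => hP0 _
  have hν0 : ∀ j, 0 ≤ ν j := fun j => hP2 j ▸ sum_nonneg fun i _ => hP0 _
  -- The smaller of the row and column ratios keeps both margins from being exceeded. Division by a
  -- zero margin is harmless, as `P` vanishes there.
  let y : K × K → ℕ → ℝ := fun x n => P x * min (r n x.1 / μ x.1) (c n x.2 / ν x.2)
  have hy0 : ∀ x n, 0 ≤ y x n := fun x n => mul_nonneg (hP0 x) (le_min
    (div_nonneg (Nat.cast_nonneg _) (hμ0 _)) (div_nonneg (Nat.cast_nonneg _) (hν0 _)))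
  let F : ℕ → K × K → ℕ := fun n x => ⌊y x n⌋₊
  have hFrow : ∀ n i, ∑ j, F n (i, j) ≤ r n i := by
    intro n i
    have : (∑ j, F n (i, j) : ℝ) ≤ r n i := by
      calc (∑ j, F n (i, j) : ℝ) ≤ ∑ j, P (i, j) * (r n i / μ i) :=
            sum_le_sum fun j _ => (Nat.floor_le (hy0 _ _)).trans
              (mul_le_mul_of_nonneg_left (min_le_left _ _) (hP0 _))
        _ = μ i * (r n i / μ i) := by rw [← sum_mul, hP1]
        _ ≤ r n i := by
            rcases eq_or_ne (μ i) 0 with h | h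
            · simp [h]
            · rw [mul_div_cancel₀ _ h]
    exact_mod_cast this
  have hFcol : ∀ n j, ∑ i, F n (i, j) ≤ c n j := by
    intro n j
    have : (∑ i, F n (i, j) : ℝ) ≤ c n j := by
      calc (∑ i, F n (i, j) : ℝ) ≤ ∑ i, P (i, j) * (c n j / ν j) :=
            sum_le_sum fun i _ => (Nat.floor_le (hy0 _ _)).trans
              (mul_le_mul_of_nonneg_left (min_le_right _ _) (hP0 _))
        _ = ν j * (c n j / ν j) := by rw [← sum_mul, hP2]
        _ ≤ c n j := by
            rcases eq_or_ne (ν j) 0 with h | h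
            · simp [h]
            · rw [mul_div_cancel₀ _ h]
    exact_mod_cast this
  have hFlim : ∀ x, Tendsto (fun n => (F n x : ℝ) / n) atTop (𝓝 (P x)) := by
    rintro ⟨i, j⟩
    refine tendsto_floor_div (hy0 (i, j)) ?_
    rcases eq_or_ne (P (i, j)) 0 with h | h
    · simp [y, h]
    have hpos : 0 < P (i, j) := lt_of_le_of_ne (hP0 _) h.symm
    have hμi : μ i ≠ 0 := (lt_of_lt_of_le hpos
      (hP1 i ▸ single_le_sum (f := fun j => P (i, j)) (fun _ _ => hP0 _) (mem_univ j))).ne'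
    have hνj : ν j ≠ 0 := (lt_of_lt_of_le hpos
      (hP2 j ▸ single_le_sum (f := fun i => P (i, j)) (fun _ _ => hP0 _) (mem_univ i))).ne'
    have hlim : Tendsto (fun n : ℕ => P (i, j) * min ((r n i : ℝ) / n / μ i)
        ((c n j : ℝ) / n / ν j)) atTop (𝓝 (P (i, j) * min (μ i / μ i) (ν j / ν j))) :=
      ((hμ i).div_const _ |>.min ((hν j).div_const _)).const_mul _
    rw [div_self hμi, div_self hνj, min_self, mul_one] at hlim
    refine hlim.congr fun n => ?_
    simp only [y]
    rw [mul_div_assoc, ← min_div_div_right n.cast_nonneg, div_right_comm, div_right_comm (c n j : ℝ)]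
  have hres : ∀ n, ∃ R : K × K → ℕ, (∑ k, r n k = n → ∑ k, c n k = n →
      IsTable R (fun i => r n i - ∑ j, F n (i, j)) fun j => c n j - ∑ i, F n (i, j)) := by
    intro n
    by_cases h : ∑ k, r n k = n ∧ ∑ k, c n k = n
    · have heq : ∑ i, (r n i - ∑ j, F n (i, j)) = ∑ j, (c n j - ∑ i, F n (i, j)) := by
        zify [hFrow n, hFcol n]
        rw [sum_sub_distrib, sum_sub_distrib, sum_comm (f := fun i j => (F n (i, j) : ℤ))]
        have h1 : (∑ k, r n k : ℤ) = n := by exact_mod_cast h.1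
        have h2 : (∑ k, c n k : ℤ) = n := by exact_mod_cast h.2
        rw [h1, h2]
      obtain ⟨R, hR⟩ := exists_table heq
      exact ⟨R, fun _ _ => hR⟩
    · exact ⟨0, fun h1 h2 => absurd ⟨h1, h2⟩ h⟩
  choose R hR using hres
  refine ⟨fun n x => F n x + R n x, ?_, ?_⟩
  · filter_upwards [hr, hc] with n h1 h2
    have := hR n h1 h2
    constructor
    · intro i
      rw [sum_add_distrib, this.1 i]
      exact Nat.add_sub_cancel' (hFrow n i)
    · intro j
      rw [sum_add_distrib, this.2 j]
      exact Nat.add_sub_cancel' (hFcol n j)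
  · rintro ⟨i, j⟩
    -- An entry of the correction is at most its row sum, which is the defect of the rounded row.
    have hRlim : Tendsto (fun n => (R n (i, j) : ℝ) / n) atTop (𝓝 0) := by
      have hlim : Tendsto (fun n : ℕ => (r n i : ℝ) / n - ∑ j, (F n (i, j) : ℝ) / n) atTop
          (𝓝 (μ i - ∑ j, P (i, j))) :=
        (hμ i).sub (tendsto_finsetSum _ fun j _ => hFlim (i, j))
      rw [hP1, sub_self] at hlim
      refine squeeze_zero' (Eventually.of_forall fun n => by positivity) ?_ hlim
      filter_upwards [hr, hc] with n h1 h2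
      rw [← sum_div, ← sub_div]
      refine div_le_div_of_nonneg_right ?_ n.cast_nonneg
      have h3 : ∑ j, R n (i, j) = r n i - ∑ j, F n (i, j) := (hR n h1 h2).1 i
      have h4 : R n (i, j) ≤ ∑ j, R n (i, j) :=
        single_le_sum (f := fun j => R n (i, j)) (fun _ _ => Nat.zero_le _) (mem_univ j)
      have h5 := hFrow n i
      have h6 : R n (i, j) + ∑ j, F n (i, j) ≤ r n i := by omega
      have h7 : (R n (i, j) : ℝ) + ∑ j, (F n (i, j) : ℝ) ≤ r n i := by exact_mod_cast h6
      linarith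
    have := (hFlim (i, j)).add hRlim
    rw [add_zero] at this
    refine this.congr fun n => ?_
    push_cast
    ring

theorem isTable_div {N : K × K → ℕ} {r c : K → ℕ} (h : IsTable N r c) (n : ℕ) :
    IsTable (fun x => (N x : ℝ) / n) (fun k => (r k : ℝ) / n) fun k => (c k : ℝ) / n := by
  constructor
  · intro i
    dsimp only
    rw [← sum_div, ← h.1 i]
    push_cast
    rfl
  · intro j
    dsimp only
    rw [← sum_div, ← h.2 j]
    push_cast
    rfl

/-- Laplace's method. Tables approximating the maximizer give the lower bound. For the upper bound,
compactness shows that tables with margins near (μ, ν) cannot have a rate appreciably above the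
maximum. -/
theorem tendsto_log_pairSum {W : K → K → ℝ} (hW : ∀ i j, 0 < W i j) {μ ν : K → ℝ}
    {P : K × K → ℝ} (hP : P ∈ couplings μ ν)
    (hmax : ∀ P' ∈ couplings μ ν, tableRate W P' ≤ tableRate W P)
    {r c : ℕ → K → ℕ} (hr : ∀ᶠ n in atTop, ∑ k, r n k = n) (hc : ∀ᶠ n in atTop, ∑ k, c n k = n)
    (hμ : ∀ k, Tendsto (fun n => (r n k : ℝ) / n) atTop (𝓝 (μ k)))
    (hν : ∀ k, Tendsto (fun n => (c n k : ℝ) / n) atTop (𝓝 (ν k))) :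
    Tendsto (fun n : ℕ => 1 / (n : ℝ) * Real.log (pairSum W n (r n) (c n))) atTop
      (𝓝 (tableRate W P)) := by
  obtain ⟨N, hN, hNlim⟩ := exists_tables_tendsto hP hr hc hμ hν
  have htpos : ∀ {n : ℕ} {M : K × K → ℕ}, ∑ x, M x = n → 0 < tableWeight W n M := by
    intro n M hM
    have : (0 : ℝ) < (words n M).card := by exact_mod_cast card_pos.2 (words_nonempty hM)
    exact mul_pos this (prod_pos fun x _ => pow_pos (hW _ _) _)
  have hlow : Tendsto (fun n : ℕ => tableRate W (fun x => (N n x : ℝ) / n) -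
      (Fintype.card (K × K) + 1 : ℝ) * (Real.log ((n : ℝ) + 1) + 1) / n) atTop
      (𝓝 (tableRate W P - 0)) :=
    (((continuous_tableRate W).tendsto P).comp (tendsto_pi_nhds.2 hNlim)).sub
      (tendsto_log_div_nat _)
  rw [sub_zero] at hlow
  have hlow' : ∀ᶠ n : ℕ in atTop, tableRate W (fun x => (N n x : ℝ) / n) -
      (Fintype.card (K × K) + 1 : ℝ) * (Real.log ((n : ℝ) + 1) + 1) / n ≤
      1 / (n : ℝ) * Real.log (pairSum W n (r n) (c n)) := by
    filter_upwards [hN, hr, eventually_gt_atTop 0] with n h1 h2 h3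
    have hn : (0 : ℝ) < n := by exact_mod_cast h3
    have hsum : ∑ x, N n x = n := (sum_table h1).trans h2
    have h4 := (abs_le.1 (log_tableWeight_bound hW h3 hsum)).1
    have h5 := Real.log_le_log (htpos hsum) (tableWeight_le_pairSum hW h1)
    rw [one_div_mul_eq_div, le_div_iff₀ hn, sub_mul, div_mul_cancel₀ _ hn.ne']
    linarith
  refine tendsto_order.2 ⟨fun a ha => ?_, fun a ha => ?_⟩
  · filter_upwards [hlow', (tendsto_order.1 hlow).1 a ha] with n h1 h2
    exact h2.trans_le h1
  · obtain ⟨e, he1, he2⟩ := exists_between ha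
    -- The distributions of rate at least `e` form a compact set, so their margins form a closed
    -- set. It misses (μ, ν), hence eventually also the margins of the actual counts, and then every
    -- table has rate below `e`.
    let S : Set (K × K → ℝ) := stdSimplex ℝ (K × K) ∩ {Q | e ≤ tableRate W Q}
    have hScomp : IsCompact S := (isCompact_stdSimplex ℝ (K × K)).inter_right
      (isClosed_le continuous_const (continuous_tableRate W))
    let marg : (K × K → ℝ) → (K → ℝ) × (K → ℝ) :=
      fun Q => (fun i => ∑ j, Q (i, j), fun j => ∑ i, Q (i, j))
    have hmarg : Continuous marg := by
      refine Continuous.prodMk ?_ ?_ <;>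
        exact continuous_pi fun i => continuous_finsetSum _ fun j _ => continuous_apply _
    have hclosed : IsClosed (marg '' S) := (hScomp.image hmarg).isClosed
    have hnot : (μ, ν) ∈ (marg '' S)ᶜ := by
      rintro ⟨Q, ⟨hQ1, hQ2⟩, hQ3⟩
      have h1 : (fun i => ∑ j, Q (i, j)) = μ := congrArg Prod.fst hQ3
      have h2 : (fun j => ∑ i, Q (i, j)) = ν := congrArg Prod.snd hQ3
      have := hmax Q ⟨hQ1.1, fun i => congrFun h1 i, fun j => congrFun h2 j⟩
      have hQ2' : e ≤ tableRate W Q := hQ2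
      linarith
    have hlim : Tendsto (fun n : ℕ => ((fun k => (r n k : ℝ) / n : K → ℝ),
        (fun k => (c n k : ℝ) / n : K → ℝ))) atTop (𝓝 (μ, ν)) :=
      (tendsto_pi_nhds.2 hμ).prodMk_nhds (tendsto_pi_nhds.2 hν)
    have hev := hlim (hclosed.isOpen_compl.mem_nhds hnot)
    have hup : Tendsto (fun n : ℕ => e + (Fintype.card (K × K) +
        (Fintype.card (K × K) + 1) : ℝ) * (Real.log ((n : ℝ) + 1) + 1) / n) atTop (𝓝 (e + 0)) :=
      tendsto_const_nhds.add (tendsto_log_div_nat _)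
    rw [add_zero] at hup
    filter_upwards [hev, hN, hr, eventually_gt_atTop 0, (tendsto_order.1 hup).2 a he2]
      with n h1 h2 h3 h4 h5
    refine lt_of_le_of_lt ?_ h5
    have hn : (0 : ℝ) < n := by exact_mod_cast h4
    have hbound : ∀ M : K × K → ℕ, IsTable M (r n) (c n) → tableWeight W n M ≤
        Real.exp (n * e + (Fintype.card (K × K) + 1) * (Real.log ((n : ℝ) + 1) + 1)) := by
      intro M hM
      have hsum : ∑ x, M x = n := (sum_table hM).trans h3
      have hrate : tableRate W (fun x => (M x : ℝ) / n) < e := by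
        by_contra hcon
        refine h1 ⟨fun x => (M x : ℝ) / n, ⟨⟨fun x => by positivity, ?_⟩, not_lt.1 hcon⟩, ?_⟩
        · rw [← sum_div, div_eq_one_iff_eq hn.ne']
          exact_mod_cast hsum
        · have := isTable_div hM n
          exact Prod.ext (funext this.1) (funext this.2)
      rw [← Real.log_le_iff_le_exp (htpos hsum)]
      have h6 := (abs_le.1 (log_tableWeight_bound hW h4 hsum)).2
      have h7 := mul_lt_mul_of_pos_left hrate hn
      linarith
    have hpos : 0 < pairSum W n (r n) (c n) :=
      (htpos ((sum_table h2).trans h3)).trans_le (tableWeight_le_pairSum hW h2)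
    have h8 := Real.log_le_log hpos (pairSum_le hW (Real.exp_pos _).le hbound)
    rw [Real.log_mul (by positivity) (Real.exp_pos _).ne', Real.log_pow, Real.log_exp] at h8
    rw [one_div_mul_eq_div, div_le_iff₀ hn, add_mul, div_mul_cancel₀ _ hn.ne']
    have h9 : (0 : ℝ) ≤ Fintype.card (K × K) := Nat.cast_nonneg _
    linarith

end Tables

/-! ### The root marginal on the regular tree -/

section Tree

variable {d h : ℕ}

/-- The vertices of the tree at level `h + 1`. -/
abbrev TreeLeaf (d h : ℕ) : Type :=
  {w : List (Fin (d + 1)) // w.IsChain (fun i j => i ≠ j) ∧ w.length = h + 1}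

instance treeLeafFinite (d h : ℕ) : Finite (TreeLeaf d h) :=
  Set.Finite.subset (List.finite_length_le (Fin (d + 1)) (h + 1)) fun _ hw => hw.2.le

noncomputable instance treeLeafFintype (d h : ℕ) : Fintype (TreeLeaf d h) := Fintype.ofFinite _

/-- The ball of radius `h` inside the ball of radius `h + 1`. -/
def ballInclusion (v : TreeBall d h) : TreeBall d (h + 1) := ⟨v.1, v.2.1, v.2.2.trans h.le_succ⟩

/-- The last level inside the ball of radius `h + 1`. -/
def leafInclusion (v : TreeLeaf d h) : TreeBall d (h + 1) := ⟨v.1, v.2.1, v.2.2.le⟩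

/-- The parent of a vertex at level `h + 1`. -/
def leafParent (v : TreeLeaf d h) : TreeBall d h :=
  ⟨v.1.tail, v.2.1.tail, by rw [List.length_tail, v.2.2]; rfl⟩

theorem treeParent_ballInclusion (v : TreeBall d h) :
    treeParent (ballInclusion v) = ballInclusion (treeParent v) := rfl

theorem treeParent_leafInclusion (v : TreeLeaf d h) :
    treeParent (leafInclusion v) = ballInclusion (leafParent v) := rfl

theorem bijective_sum_inclusion (d h : ℕ) :
    Function.Bijective (Sum.elim ballInclusion leafInclusion :
      TreeBall d h ⊕ TreeLeaf d h → TreeBall d (h + 1)) := by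
  constructor
  · rintro (v | v) (w | w) hvw
    · have h1 : ballInclusion v = ballInclusion w := hvw
      exact congrArg Sum.inl (Subtype.ext (congrArg Subtype.val h1 :))
    · have h1 : v.1 = w.1 := congrArg Subtype.val hvw
      have h2 := v.2.2
      rw [h1, w.2.2] at h2
      omega
    · have h1 : v.1 = w.1 := congrArg Subtype.val hvw
      have h2 := w.2.2
      rw [← h1, v.2.2] at h2
      omega
    · have h1 : leafInclusion v = leafInclusion w := hvw
      exact congrArg Sum.inr (Subtype.ext (congrArg Subtype.val h1 :))
  · intro v
    rcases Nat.lt_or_ge h v.1.length with hv | hv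
    · exact ⟨Sum.inr ⟨v.1, v.2.1, le_antisymm v.2.2 hv⟩, rfl⟩
    · exact ⟨Sum.inl ⟨v.1, v.2.1, hv⟩, rfl⟩

/-- The ball of radius `h + 1` is the ball of radius `h` together with the last level. -/
noncomputable def ballSuccEquiv (d h : ℕ) : TreeBall d h ⊕ TreeLeaf d h ≃ TreeBall d (h + 1) :=
  Equiv.ofBijective _ (bijective_sum_inclusion d h)

/-- The number of children of a vertex at level `h`. -/
def childCount (d h : ℕ) : ℕ := if h = 0 then d + 1 else d

/-- A child prepends a letter different from the first one: d choices, or d + 1 at the empty word.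
-/
theorem card_leafParent_fiber (u : TreeBall d h) :
    (univ.filter fun v : TreeLeaf d h => leafParent v = u).card =
      if u.1.length = h then childCount d h else 0 := by
  obtain ⟨u, hu, hlen⟩ := u
  split_ifs with hl
  · simp only at hl
    have hcons : ∀ j : Fin (d + 1), (j :: u).IsChain (fun i j => i ≠ j) →
        ∃ v : TreeLeaf d h, v.1 = j :: u := fun j hj => ⟨⟨j :: u, hj, by simp [hl]⟩, rfl⟩
    have key : (univ.filter fun v : TreeLeaf d h => leafParent v = ⟨u, hu, hlen⟩).card =
        (univ.filter fun j : Fin (d + 1) => (j :: u).IsChain (fun i j => i ≠ j)).card := by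
      symm
      refine card_bij (fun j hj => ⟨j :: u, (mem_filter.1 hj).2, by simp [hl]⟩) ?_ ?_ ?_
      · intro j hj
        rw [mem_filter]
        exact ⟨mem_univ _, rfl⟩
      · intro j hj j' hj' he
        have := congrArg Subtype.val he
        simpa using this
      · rintro ⟨v, hv, hvl⟩ hmem
        have hp : v.tail = u := congrArg Subtype.val (mem_filter.1 hmem).2
        rcases v with _ | ⟨j, v⟩
        · simp at hvl
        · simp only [List.tail_cons] at hp
          subst hp
          exact ⟨j, by simpa using hv, rfl⟩
    rw [key]
    rcases u with _ | ⟨i, u⟩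
    · simp only [List.length_nil] at hl
      subst hl
      simp [childCount]
    · have h0 : h ≠ 0 := by
        rw [← hl]
        simp
      simp only [childCount, h0, if_false, List.isChain_cons_cons, hu, and_true]
      rw [filter_ne', card_erase_of_mem (mem_univ i)]
      simp
  · rw [card_eq_zero, filter_eq_empty_iff]
    intro v _ hv
    apply hl
    have : v.1.tail = u := congrArg Subtype.val hv
    simp only [← this, List.length_tail, v.2.2]
    rfl

variable (B₁ B₂ lam : ℝ)

/-- The factor contributed by a vertex and the edge to its parent, with additional weights `ω`
at level `h`. -/
noncomputable def treeFactor (ω : ℤˣ → ℝ) (σ : TreeBall d h → ℤˣ) (v : TreeBall d h) : ℝ :=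
  vertexWeight lam (σ v) * (if v.1 = [] then 1 else edgeWeight B₁ B₂ (σ v) (σ (treeParent v))) *
    if v.1.length = h then ω (σ v) else 1

/-- The partition function of the ball with weights `ω` at level `h` and root spin `s`. -/
noncomputable def leafSum (d h : ℕ) (ω : ℤˣ → ℝ) (s : ℤˣ) : ℝ :=
  ∑ σ : TreeBall d h → ℤˣ, if σ (treeRoot d h) = s then ∏ v, treeFactor B₁ B₂ lam ω σ v else 0

/-- The total weight of a vertex below one of spin `s`, when its own spin has weights `ω`. -/
noncomputable def childWeight (ω : ℤˣ → ℝ) (s : ℤˣ) : ℝ :=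
  ∑ t, edgeWeight B₁ B₂ t s * vertexWeight lam t * ω t

theorem leafSum_zero (ω : ℤˣ → ℝ) (s : ℤˣ) :
    leafSum B₁ B₂ lam d 0 ω s = vertexWeight lam s * ω s := by
  have huniq : ∀ v : TreeBall d 0, v = treeRoot d 0 := fun v =>
    Subtype.ext (List.eq_nil_of_length_eq_zero (Nat.le_zero.1 v.2.2))
  have : Unique (TreeBall d 0) := ⟨⟨treeRoot d 0⟩, huniq⟩
  unfold leafSum
  rw [← (Equiv.funUnique (TreeBall d 0) ℤˣ).symm.sum_comp]
  have hroot : treeRoot d 0 = default := (huniq default).symm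
  rw [sum_eq_single s]
  · simp only [Fintype.prod_unique, hroot, treeFactor]
    rw [← hroot]
    simp [treeRoot]
  · intro t _ ht
    simp [ht]
  · exact fun hs => absurd (mem_univ s) hs

/-- Given the spins in the smaller ball, the leaves are independent and can be summed out, which
replaces the boundary weight by a power of `childWeight` one level higher. -/
theorem leafSum_succ (ω : ℤˣ → ℝ) (s : ℤˣ) :
    leafSum B₁ B₂ lam d (h + 1) ω s =
      leafSum B₁ B₂ lam d h (fun u => childWeight B₁ B₂ lam ω u ^ childCount d h) s := by
  classical
  let E : (TreeBall d (h + 1) → ℤˣ) ≃ (TreeBall d h → ℤˣ) × (TreeLeaf d h → ℤˣ) :=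
    (Equiv.arrowCongr (ballSuccEquiv d h).symm (Equiv.refl ℤˣ)).trans
      (Equiv.sumArrowEquivProdArrow _ _ _)
  unfold leafSum
  rw [Fintype.sum_equiv E _ (fun p => if p.1 (treeRoot d h) = s then
    (∏ v, vertexWeight lam (p.1 v) *
      (if v.1 = [] then 1 else edgeWeight B₁ B₂ (p.1 v) (p.1 (treeParent v)))) *
    ∏ v : TreeLeaf d h, edgeWeight B₁ B₂ (p.2 v) (p.1 (leafParent v)) *
      vertexWeight lam (p.2 v) * ω (p.2 v) else 0), Fintype.sum_prod_type]
  · refine sum_congr rfl fun σ _ => ?_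
    split_ifs with hs
    · dsimp only
      rw [← mul_sum]
      have hsum : ∑ τ : TreeLeaf d h → ℤˣ, ∏ v : TreeLeaf d h,
          edgeWeight B₁ B₂ (τ v) (σ (leafParent v)) * vertexWeight lam (τ v) * ω (τ v) =
          ∏ v : TreeLeaf d h, childWeight B₁ B₂ lam ω (σ (leafParent v)) := by
        unfold childWeight
        rw [prod_univ_sum, Fintype.piFinset_univ]
      -- Group the leaves by parent, so that each parent receives one factor per child.
      rw [hsum, ← prod_fiberwise' univ leafParent fun u => childWeight B₁ B₂ lam ω (σ u),
        ← prod_mul_distrib]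
      refine prod_congr rfl fun u _ => ?_
      rw [prod_const, card_leafParent_fiber]
      unfold treeFactor
      split_ifs <;> simp
    · simp
  · intro σ
    have hball : ∀ v, (E σ).1 v = σ (ballInclusion v) := fun v => rfl
    have hleaf : ∀ v, (E σ).2 v = σ (leafInclusion v) := fun v => rfl
    have hroot : σ (treeRoot d (h + 1)) = (E σ).1 (treeRoot d h) := rfl
    rw [hroot]
    congr 1
    rw [← (ballSuccEquiv d h).prod_comp, Fintype.prod_sum_type]
    congr 1
    · refine prod_congr rfl fun v _ => ?_
      have h1 : ballSuccEquiv d h (Sum.inl v) = ballInclusion v := rfl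
      have h2 : (ballInclusion v).1.length ≠ h + 1 := (Nat.lt_succ_of_le v.2.2).ne
      rw [h1, treeFactor, if_neg h2, mul_one, treeParent_ballInclusion, hball, hball]
      rfl
    · refine prod_congr rfl fun v _ => ?_
      have h1 : ballSuccEquiv d h (Sum.inr v) = leafInclusion v := rfl
      have h2 : (leafInclusion v).1.length = h + 1 := v.2.2
      have h3 : (leafInclusion v).1 ≠ [] := fun h0 => by simp [h0] at h2
      rw [h1, treeFactor, if_pos h2, if_neg h3, treeParent_leafInclusion, hball, hleaf]
      ring

/-- Inner vertices have d children, which gives the iterated map; only the root has d + 1, which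
gives the last exponent. -/
theorem leafSum_succ_eq (ω : ℤˣ → ℝ) (s : ℤˣ) :
    leafSum B₁ B₂ lam d (h + 1) ω s = vertexWeight lam s *
      childWeight B₁ B₂ lam ((fun ω u => childWeight B₁ B₂ lam ω u ^ d)^[h] ω) s ^ (d + 1) := by
  induction h generalizing ω with
  | zero => rw [leafSum_succ, leafSum_zero]; simp [childCount]
  | succ h ih =>
    rw [leafSum_succ, ih, Function.iterate_succ_apply]
    simp [childCount]

theorem sum_boundaryConfigs (s : ℤˣ) :
    ∑ σ ∈ (boundaryConfigs (fun _ : TreeBall d h => -1)).filter (fun σ => σ (treeRoot d h) = s),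
      weight treeEnds B₁ B₂ lam σ =
      leafSum B₁ B₂ lam d h (fun t => if t = -1 then 1 else 0) s := by
  unfold leafSum boundaryConfigs
  rw [filter_filter, sum_filter]
  refine sum_congr rfl fun σ _ => ?_
  have hedge : ∏ e : TreeEdge d h, edgeWeight B₁ B₂ (σ (treeEnds e).1) (σ (treeEnds e).2) =
      ∏ v : TreeBall d h, if v.1 = [] then 1 else
        edgeWeight B₁ B₂ (σ v) (σ (treeParent v)) := by
    refine (prod_subtype (univ.filter fun v : TreeBall d h => v.1 ≠ [])
      (fun v => mem_filter.trans (and_iff_right (mem_univ v)))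
      (fun v => edgeWeight B₁ B₂ (σ v) (σ (treeParent v)))).symm.trans ?_
    rw [prod_filter]
    refine prod_congr rfl fun v _ => ?_
    split_ifs <;> simp_all
  have hω : ∏ v : TreeBall d h, (if v.1.length = h then (if σ v = -1 then (1 : ℝ) else 0) else 1) =
      if ∀ v : TreeBall d h, v.1.length = h → σ v = -1 then 1 else 0 := by
    split_ifs with hall
    · refine prod_eq_one fun v _ => ?_
      split_ifs with h1 h2
      · rfl
      · exact absurd (hall v h1) h2
      · rfl
    · push Not at hall
      obtain ⟨v, hv1, hv2⟩ := hall
      exact prod_eq_zero (mem_univ v) (by simp [hv1, hv2])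
  simp only [treeFactor, prod_mul_distrib]
  rw [hω, weight_eq_prod, hedge]
  by_cases h1 : ∀ v : TreeBall d h, v.1.length = h → σ v = -1
  · by_cases h2 : σ (treeRoot d h) = s
    · rw [if_pos ⟨h1, h2⟩, if_pos h2, if_pos h1, mul_one]
    · rw [if_neg fun h => h2 h.2, if_neg h2]
  · rw [if_neg fun h => h1 h.1, if_neg h1, mul_zero, ite_self]

theorem rootMarginal_eq :
    rootMarginal d B₁ B₂ lam h (fun _ => -1) =
      leafSum B₁ B₂ lam d h (fun t => if t = -1 then 1 else 0) (-1) /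
        (leafSum B₁ B₂ lam d h (fun t => if t = -1 then 1 else 0) (-1) +
          leafSum B₁ B₂ lam d h (fun t => if t = -1 then 1 else 0) 1) := by
  unfold rootMarginal
  rw [← sum_boundaryConfigs, ← sum_boundaryConfigs]
  congr 1
  rw [← sum_filter_add_sum_filter_not _ (fun σ : TreeBall d h → ℤˣ => σ (treeRoot d h) = -1)]
  congr 2
  ext σ
  rcases Int.units_eq_one_or (σ (treeRoot d h)) with hs | hs <;> simp [hs]

/-! ### The root marginal as an iterate of a one-variable map -/

/-- The tree recursion for the ratio of the total weights of a subtree seen from a parent of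
spin `-1` and from a parent of spin `1`. -/
noncomputable def treeMap (d : ℕ) (x : ℝ) : ℝ := (B₁ * (lam * x ^ d) + 1) / (lam * x ^ d + B₂)

theorem sum_units {M : Type*} [AddCommMonoid M] (f : ℤˣ → M) : ∑ s, f s = f (-1) + f 1 := by
  rw [show (univ : Finset ℤˣ) = {1, -1} from rfl, sum_pair (by decide), add_comm]

variable {B₁ B₂ lam}

/-- Only the ratio of the two child weights matters. It starts at `B₁`, since a child pinned to -1
has weight `B₁ * lam` below a parent of spin -1 and `lam` below one of spin 1, and it evolves by
`treeMap`. -/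
theorem childWeight_iterate (hB₁ : 0 < B₁) (hB₂ : 0 < B₂) (hlam : 0 < lam) (m : ℕ) :
    0 < childWeight B₁ B₂ lam ((fun ω u => childWeight B₁ B₂ lam ω u ^ d)^[m]
        fun t => if t = -1 then 1 else 0) 1 ∧
    childWeight B₁ B₂ lam ((fun ω u => childWeight B₁ B₂ lam ω u ^ d)^[m]
        fun t => if t = -1 then 1 else 0) (-1) =
      (treeMap B₁ B₂ lam d)^[m] B₁ *
      childWeight B₁ B₂ lam ((fun ω u => childWeight B₁ B₂ lam ω u ^ d)^[m]
        fun t => if t = -1 then 1 else 0) 1 ∧ 0 < (treeMap B₁ B₂ lam d)^[m] B₁ := by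
  have hne : (1 : ℤˣ) ≠ -1 := by decide
  have hp : ∀ ω : ℤˣ → ℝ, childWeight B₁ B₂ lam ω 1 = lam * ω (-1) + B₂ * ω 1 := by
    intro ω
    rw [childWeight, sum_units]
    simp [edgeWeight, vertexWeight, hne, hne.symm]
  have hm : ∀ ω : ℤˣ → ℝ, childWeight B₁ B₂ lam ω (-1) = B₁ * lam * ω (-1) + ω 1 := by
    intro ω
    rw [childWeight, sum_units]
    simp [edgeWeight, vertexWeight, hne]
  induction m with
  | zero =>
    simp only [Function.iterate_zero, id_eq]
    rw [hp, hm]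
    simp [hne, hlam, hB₁]
  | succ m ih =>
    obtain ⟨h1, h2, h3⟩ := ih
    simp only [Function.iterate_succ_apply']
    set ω := (fun ω u => childWeight B₁ B₂ lam ω u ^ d)^[m] fun t => if t = -1 then 1 else 0
    rw [hp fun u => childWeight B₁ B₂ lam ω u ^ d, hm fun u => childWeight B₁ B₂ lam ω u ^ d]
    rw [h2]
    set c := childWeight B₁ B₂ lam ω 1
    set x := (treeMap B₁ B₂ lam d)^[m] B₁
    refine ⟨by positivity, ?_, by unfold treeMap; positivity⟩
    unfold treeMap
    rw [mul_pow]
    field_simp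

/-- The index shift matters: the boundary at level m + 1 corresponds to the m-th iterate, so even
levels see odd iterates. -/
theorem rootMarginal_succ (hB₁ : 0 < B₁) (hB₂ : 0 < B₂) (hlam : 0 < lam) (m : ℕ) :
    rootMarginal d B₁ B₂ lam (m + 1) (fun _ => -1) =
      lam * ((treeMap B₁ B₂ lam d)^[m] B₁) ^ (d + 1) /
        (lam * ((treeMap B₁ B₂ lam d)^[m] B₁) ^ (d + 1) + 1) := by
  obtain ⟨h1, h2, h3⟩ := childWeight_iterate (d := d) hB₁ hB₂ hlam m
  have hne : (1 : ℤˣ) ≠ -1 := by decide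
  rw [rootMarginal_eq, leafSum_succ_eq, leafSum_succ_eq, h2]
  simp only [vertexWeight, hne, if_true, if_false, mul_pow]
  field_simp

/-- For `lam = 0` every configuration with root spin -1 has weight zero, so the boundary has no
influence. -/
theorem lam_pos_of_nonUniqueness (hlam : 0 ≤ lam) (h : NonUniqueness d B₁ B₂ lam) : 0 < lam := by
  refine lt_of_le_of_ne hlam fun h0 => ?_
  subst h0
  obtain ⟨ε, hε, hH⟩ := h
  obtain ⟨h, -, τ, τ', hle⟩ := hH 0
  have hz : ∀ τ : TreeBall d h → ℤˣ, rootMarginal d B₁ B₂ 0 h τ = 0 := by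
    intro τ
    unfold rootMarginal
    rw [sum_eq_zero, zero_div]
    intro σ hσ
    have hcard : (univ.filter fun v : TreeBall d h => σ v = -1).card ≠ 0 :=
      (card_pos.2 ⟨treeRoot d h, by simpa using (mem_filter.1 hσ).2⟩).ne'
    simp [weight, zero_pow hcard]
  rw [hz, hz] at hle
  simp at hle
  linarith

end Tree

end TwoSpin

namespace TwoSpin

/-! ### The limits of the tree recursion -/

section Recursion

variable {B₁ B₂ lam : ℝ} {d : ℕ}

theorem le_treeMap (hB₂ : 0 < B₂) (hlam : 0 < lam) (hanti : B₁ * B₂ < 1) {x : ℝ} (hx : 0 ≤ x) :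
    B₁ < treeMap B₁ B₂ lam d x := by
  have hz : 0 ≤ lam * x ^ d := by positivity
  unfold treeMap
  rw [lt_div_iff₀ (by positivity)]
  linarith

theorem treeMap_antitone (hB₂ : 0 < B₂) (hlam : 0 < lam) (hanti : B₁ * B₂ < 1) {x y : ℝ}
    (hx : 0 ≤ x) (hxy : x ≤ y) : treeMap B₁ B₂ lam d y ≤ treeMap B₁ B₂ lam d x := by
  have h0 : 0 ≤ lam * x ^ d := by positivity
  have h1 : lam * x ^ d ≤ lam * y ^ d := by gcongr
  unfold treeMap
  rw [div_le_div_iff₀ (by linarith) (by linarith)]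
  nlinarith [mul_nonneg (sub_nonneg.2 h1) (sub_nonneg.2 hanti.le)]

theorem continuousAt_treeMap (hB₂ : 0 < B₂) (hlam : 0 < lam) {x : ℝ} (hx : 0 ≤ x) :
    ContinuousAt (treeMap B₁ B₂ lam d) x := by
  have hz : 0 ≤ lam * x ^ d := by positivity
  unfold treeMap
  refine ContinuousAt.div (by fun_prop) (by fun_prop) ?_
  linarith

/-- The limits of the even and the odd iterates of the tree recursion, which are the smallest and
the largest fixed point of its square. -/
theorem exists_treeMap_limits (hB₁ : 0 < B₁) (hB₂ : 0 < B₂) (hlam : 0 < lam)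
    (hanti : B₁ * B₂ < 1) :
    ∃ L U : ℝ, 0 < L ∧ L ≤ U ∧ treeMap B₁ B₂ lam d L = U ∧ treeMap B₁ B₂ lam d U = L ∧
      Tendsto (fun n => (treeMap B₁ B₂ lam d)^[2 * n] B₁) atTop (𝓝 L) ∧
      Tendsto (fun n => (treeMap B₁ B₂ lam d)^[2 * n + 1] B₁) atTop (𝓝 U) ∧
      (∀ x, 0 ≤ x → x < L → x < treeMap B₁ B₂ lam d (treeMap B₁ B₂ lam d x)) ∧
      ∀ x, U < x → treeMap B₁ B₂ lam d (treeMap B₁ B₂ lam d x) < x := by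
  set q := treeMap B₁ B₂ lam d with hq
  have hlt : ∀ {x}, 0 ≤ x → B₁ < q x := fun hx => le_treeMap hB₂ hlam hanti hx
  have hpos : ∀ {x}, 0 ≤ x → 0 < q x := fun hx => hB₁.trans (hlt hx)
  have hant : ∀ {x y}, 0 ≤ x → x ≤ y → q y ≤ q x :=
    fun hx hxy => treeMap_antitone hB₂ hlam hanti hx hxy
  have hmono : ∀ {x y}, 0 ≤ x → x ≤ y → q (q x) ≤ q (q y) :=
    fun hx hxy => hant (hpos (hx.trans hxy)).le (hant hx hxy)
  set T : ℕ → ℝ := fun n => q^[n] B₁ with hT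
  have hsucc : ∀ n, T (n + 1) = q (T n) := fun n => Function.iterate_succ_apply' q n B₁
  have hT0 : ∀ n, B₁ ≤ T n := by
    intro n
    induction n with
    | zero => exact le_rfl
    | succ n ih => rw [hsucc]; exact (hlt (hB₁.le.trans ih)).le
  have hTpos : ∀ n, 0 ≤ T n := fun n => hB₁.le.trans (hT0 n)
  have hTup : ∀ n, T (n + 1) ≤ q B₁ := fun n => by rw [hsucc]; exact hant hB₁.le (hT0 n)
  -- The square of the antitone map is monotone, and the orbit starts at `B₁`, a lower bound for all
  -- values of the map; so the even iterates increase and the odd ones decrease.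
  have heven : Monotone fun n => T (2 * n) := by
    refine monotone_nat_of_le_succ fun n => ?_
    induction n with
    | zero => exact hT0 2
    | succ n ih =>
      have h := hmono (hTpos _) ih
      rw [← hsucc, ← hsucc, ← hsucc, ← hsucc] at h
      exact h
  have hodd : Antitone fun n => T (2 * n + 1) := by
    refine antitone_nat_of_succ_le fun n => ?_
    rw [hsucc, hsucc]
    exact hant (hTpos _) (heven n.le_succ)
  have hle : ∀ n, T (2 * n) ≤ T (2 * n + 1) := by
    intro n
    induction n with
    | zero => exact hT0 1
    | succ n ih =>
      have h := hmono (hTpos _) ih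
      rw [← hsucc (2 * n + 1), ← hsucc (2 * n), ← hsucc (2 * n + 1), ← hsucc (2 * n + 1 + 1)] at h
      exact h
  have hbdd : BddAbove (Set.range fun n => T (2 * n)) := by
    refine ⟨q B₁, ?_⟩
    rintro _ ⟨n, rfl⟩
    exact (hle n).trans (hTup _)
  have hbdd' : BddBelow (Set.range fun n => T (2 * n + 1)) := by
    refine ⟨B₁, ?_⟩
    rintro _ ⟨n, rfl⟩
    exact hT0 _
  have hL := tendsto_atTop_ciSup heven hbdd
  have hU := tendsto_atTop_ciInf hodd hbdd'
  set L := ⨆ n, T (2 * n)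
  set U := ⨅ n, T (2 * n + 1)
  have hLB : B₁ ≤ L := ge_of_tendsto' hL fun n => hT0 _
  have hUB : B₁ ≤ U := ge_of_tendsto' hU fun n => hT0 _
  have hqL : q L = U := by
    have h := (continuousAt_treeMap (B₁ := B₁) (d := d) hB₂ hlam (hB₁.le.trans hLB)).tendsto.comp hL
    refine tendsto_nhds_unique h (hU.congr fun n => ?_)
    exact hsucc _
  have hqU : q U = L := by
    have h := (continuousAt_treeMap (B₁ := B₁) (d := d) hB₂ hlam (hB₁.le.trans hUB)).tendsto.comp hU
    refine tendsto_nhds_unique h ((hL.comp (tendsto_add_atTop_nat 1)).congr fun n => ?_)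
    exact hsucc (2 * n + 1)
  refine ⟨L, U, hB₁.trans_le hLB, le_of_tendsto_of_tendsto' hL hU hle, hqL, hqU, hL, hU, ?_, ?_⟩
  -- If the square of the map sent `x` to a point at most `x`, monotonicity would keep all even
  -- iterates below `x`, against `x < L`. The case above `U` is symmetric.
  · intro x hx hxL
    by_contra hcon
    rw [not_lt] at hcon
    refine hxL.not_ge (le_of_tendsto' hL fun n => ?_)
    induction n with
    | zero => exact ((hlt (hpos hx).le).trans_le hcon).le
    | succ n ih =>
      have h := hmono (hTpos _) ih
      rw [← hsucc, ← hsucc] at h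
      exact h.trans hcon
  · intro x hUx
    have hx : 0 ≤ x := hB₁.le.trans (hUB.trans hUx.le)
    by_contra hcon
    rw [not_lt] at hcon
    refine hUx.not_ge (ge_of_tendsto' hU fun n => ?_)
    induction n with
    | zero => exact hcon.trans (hant hB₁.le (hlt hx).le)
    | succ n ih =>
      have h := hmono hx ih
      rw [← hsucc, ← hsucc] at h
      exact hcon.trans h

/-! ### The maximum of the first moment -/

/-- A polynomial with the sign of `treeMap (treeMap x) - x`. -/
noncomputable def squareDefect (B₁ B₂ lam : ℝ) (d : ℕ) (x : ℝ) : ℝ :=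
  (lam * x ^ d + B₂) ^ d * (1 - B₂ * x) - lam * (B₁ * (lam * x ^ d) + 1) ^ d * (x - B₁)

/-- Clear denominators in T(T(x)) - x, writing the powers of y = T(x) as quotients of powers of its
numerator and denominator. -/
theorem squareDefect_eq (hB₁ : 0 < B₁) (hB₂ : 0 < B₂) (hlam : 0 < lam) {x : ℝ} (hx : 0 ≤ x) :
    squareDefect B₁ B₂ lam d x = (lam * x ^ d + B₂) ^ d *
      (lam * treeMap B₁ B₂ lam d x ^ d + B₂) *
        (treeMap B₁ B₂ lam d (treeMap B₁ B₂ lam d x) - x) := by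
  have hC : 0 < lam * x ^ d + B₂ := by positivity
  have hA : 0 < B₁ * (lam * x ^ d) + 1 := by positivity
  have hy : 0 < treeMap B₁ B₂ lam d x := div_pos hA hC
  have hA' : (B₁ * (lam * x ^ d) + 1) ^ d =
      treeMap B₁ B₂ lam d x ^ d * (lam * x ^ d + B₂) ^ d := by
    rw [← mul_pow]
    unfold treeMap
    rw [div_mul_cancel₀ _ hC.ne']
  unfold squareDefect
  rw [hA']
  set y := treeMap B₁ B₂ lam d x
  have hC' : 0 < lam * y ^ d + B₂ := by positivity
  unfold treeMap
  field_simp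
  ring

theorem squareDefect_nonneg_iff (hB₁ : 0 < B₁) (hB₂ : 0 < B₂) (hlam : 0 < lam) {x : ℝ}
    (hx : 0 ≤ x) : 0 ≤ squareDefect B₁ B₂ lam d x ↔
      x ≤ treeMap B₁ B₂ lam d (treeMap B₁ B₂ lam d x) := by
  have hy : 0 < treeMap B₁ B₂ lam d x := by unfold treeMap; positivity
  rw [squareDefect_eq hB₁ hB₂ hlam hx, mul_nonneg_iff_of_pos_left (by positivity), sub_nonneg]

theorem squareDefect_nonpos_iff (hB₁ : 0 < B₁) (hB₂ : 0 < B₂) (hlam : 0 < lam) {x : ℝ}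
    (hx : 0 ≤ x) : squareDefect B₁ B₂ lam d x ≤ 0 ↔
      treeMap B₁ B₂ lam d (treeMap B₁ B₂ lam d x) ≤ x := by
  have hy : 0 < treeMap B₁ B₂ lam d x := by unfold treeMap; positivity
  rw [squareDefect_eq hB₁ hB₂ hlam hx, mul_nonpos_iff_pos_imp_nonpos]
  constructor
  · intro h
    exact sub_nonpos.1 (h.1 (by positivity))
  · intro h
    exact ⟨fun _ => sub_nonpos.2 h, fun h' => by
      have := sub_nonpos.2 h
      positivity⟩

/-- The logarithmic form of `squareDefect`, of opposite sign. -/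
noncomputable def logDefect (B₁ B₂ lam : ℝ) (d : ℕ) (x : ℝ) : ℝ :=
  Real.log (lam * (B₁ * (lam * x ^ d) + 1) ^ d * (x - B₁)) -
    Real.log ((lam * x ^ d + B₂) ^ d * (1 - B₂ * x))

/-- The convex function that has the sign of the derivative of `logDefect`. -/
noncomputable def logDefectSlope (B₁ B₂ lam : ℝ) (d : ℕ) (x : ℝ) : ℝ :=
  B₁ * lam * x ^ (d : ℤ) + B₂ / lam * x ^ (-(d : ℤ)) + (d : ℝ) ^ 2 * B₂ * x ^ (1 : ℤ) +
    (d : ℝ) ^ 2 * B₁ * x ^ (-1 : ℤ) + (1 + B₁ * B₂) * (1 - (d : ℝ) ^ 2)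

/-- All integer powers, including negative ones, are convex on the positive reals; the coefficients
are nonnegative, and only the constant term can be negative. -/
theorem convexOn_logDefectSlope (hB₁ : 0 < B₁) (hB₂ : 0 < B₂) (hlam : 0 < lam) :
    ConvexOn ℝ (Set.Ioi 0) (logDefectSlope B₁ B₂ lam d) := by
  unfold logDefectSlope
  have h : ∀ (c : ℝ) (m : ℤ), 0 ≤ c → ConvexOn ℝ (Set.Ioi 0) fun x : ℝ => c * x ^ m :=
    fun c m hc => (convexOn_zpow m).smul hc
  exact ((((h _ _ (by positivity)).add (h _ _ (by positivity))).add (h _ _ (by positivity))).add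
    (h _ _ (by positivity))).add_const _

/-- Passing to logarithms makes the derivative rational in x and x^d. Its numerator, divided by a
positive multiple of x^d, is a combination of pure powers, to which convexity applies. -/
theorem hasDerivAt_logDefect (hd : 1 ≤ d) (hB₁ : 0 < B₁) (hB₂ : 0 < B₂) (hlam : 0 < lam) {x : ℝ}
    (h1 : B₁ < x) (h2 : B₂ * x < 1) :
    HasDerivAt (logDefect B₁ B₂ lam d)
      ((1 - B₁ * B₂) * lam * x ^ d / ((B₁ * (lam * x ^ d) + 1) * (lam * x ^ d + B₂) *
        (1 - B₂ * x) * (x - B₁)) * logDefectSlope B₁ B₂ lam d x) x := by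
  obtain ⟨e, rfl⟩ : ∃ e, d = e + 1 := ⟨d - 1, by omega⟩
  have hx : 0 < x := hB₁.trans h1
  have hA : 0 < B₁ * (lam * x ^ (e + 1)) + 1 := by positivity
  have hC : 0 < lam * x ^ (e + 1) + B₂ := by positivity
  have h1' : 0 < x - B₁ := sub_pos.2 h1
  have h2' : 0 < 1 - B₂ * x := sub_pos.2 h2
  have hp : HasDerivAt (fun x : ℝ => lam * x ^ (e + 1)) (lam * ((e + 1 : ℕ) * x ^ e)) x := by
    simpa using (hasDerivAt_pow (e + 1) x).const_mul lam
  have hA' : HasDerivAt (fun x : ℝ => lam * (B₁ * (lam * x ^ (e + 1)) + 1) ^ (e + 1))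
      (lam * ((e + 1 : ℕ) * (B₁ * (lam * x ^ (e + 1)) + 1) ^ e *
        (B₁ * (lam * ((e + 1 : ℕ) * x ^ e))))) x := by
    simpa using (((hp.const_mul B₁).add_const 1).fun_pow (e + 1)).const_mul lam
  have hC' : HasDerivAt (fun x : ℝ => (lam * x ^ (e + 1) + B₂) ^ (e + 1))
      ((e + 1 : ℕ) * (lam * x ^ (e + 1) + B₂) ^ e * (lam * ((e + 1 : ℕ) * x ^ e))) x := by
    simpa using (hp.add_const B₂).fun_pow (e + 1)
  have hx1 : HasDerivAt (fun x : ℝ => x - B₁) 1 x := (hasDerivAt_id x).sub_const B₁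
  have hx2 : HasDerivAt (fun x : ℝ => 1 - B₂ * x) (-B₂) x := by
    simpa using ((hasDerivAt_id x).const_mul B₂).const_sub 1
  have key := ((hA'.fun_mul hx1).log (by positivity)).sub
    ((hC'.fun_mul hx2).log (by positivity))
  refine HasDerivAt.congr_deriv key ?_
  unfold logDefectSlope
  rw [zpow_neg, zpow_natCast, zpow_one, zpow_neg_one]
  rw [pow_succ (B₁ * (lam * x ^ (e + 1)) + 1) e, pow_succ (lam * x ^ (e + 1) + B₂) e]
  have hA2 := pow_pos hA e
  have hC2 := pow_pos hC e
  set a := (B₁ * (lam * x ^ (e + 1)) + 1) ^ e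
  set c := (lam * x ^ (e + 1) + B₂) ^ e
  rw [pow_succ] at *
  have hxe := pow_pos hx e
  set z := x ^ e
  have hA3 := hA.ne'
  have hC3 := hC.ne'
  have h1'' := h1'.ne'
  have h2'' : 1 - x * B₂ ≠ 0 := by
    rw [mul_comm]
    exact h2'.ne'
  push_cast
  field_simp
  ring

end Recursion

/-! ### Sign changes of the defect and the maximum over one message -/

section Maximum

/-- The mean value theorem, read for `G`, which agrees with the derivative up to a positive factor.
-/
theorem exists_slope_sign {D p G : ℝ → ℝ} {a b : ℝ} (hab : a < b)
    (hp : ∀ x ∈ Set.Icc a b, 0 < p x) (hD : ∀ x ∈ Set.Icc a b, HasDerivAt D (p x * G x) x) :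
    ∃ s ∈ Set.Ioo a b, ∃ r, 0 < r ∧ G s = r * (D b - D a) := by
  obtain ⟨s, hs, he⟩ := exists_hasDerivAt_eq_slope D (fun x => p x * G x) hab
    (fun x hx => (hD x hx).continuousAt.continuousWithinAt)
    (fun x hx => hD x (Set.Ioo_subset_Icc_self hx))
  have hps := hp s (Set.Ioo_subset_Icc_self hs)
  have hba : 0 < b - a := sub_pos.2 hab
  refine ⟨s, hs, 1 / (p s * (b - a)), by positivity, ?_⟩
  field_simp at he ⊢
  linarith

/-- If `D` were negative at some t in (a, c), the mean value theorem would give successive points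
with `G` negative before t, positive between t and c, and zero between c and b. But {G ≤ 0} is an
interval by convexity. The other half is the mirror image. -/
theorem sign_of_convex_slope {D p G : ℝ → ℝ} {a c b : ℝ} (hac : a < c) (hcb : c < b)
    (hp : ∀ x ∈ Set.Icc a b, 0 < p x) (hD : ∀ x ∈ Set.Icc a b, HasDerivAt D (p x * G x) x)
    {S : Set ℝ} (hS : Set.Icc a b ⊆ S) (hG : ConvexOn ℝ S G) (ha0 : D a = 0) (hc0 : D c = 0)
    (hb0 : D b = 0) :
    (∀ x ∈ Set.Icc a c, 0 ≤ D x) ∧ ∀ x ∈ Set.Icc c b, D x ≤ 0 := by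
  have hslope : ∀ {y z}, a ≤ y → y < z → z ≤ b → ∃ s ∈ Set.Ioo y z, ∃ r, 0 < r ∧
      G s = r * (D z - D y) := fun hy hyz hz => exists_slope_sign hyz
    (fun x hx => hp x ⟨hy.trans hx.1, hx.2.trans hz⟩)
    (fun x hx => hD x ⟨hy.trans hx.1, hx.2.trans hz⟩)
  have hconv : ∀ {s t u}, a ≤ s → s ≤ t → t ≤ u → u ≤ b → G s ≤ 0 → G u ≤ 0 → G t ≤ 0 := by
    intro s t u hs hst htu hu h1 h2
    exact (hG.le_max_of_mem_Icc (hS ⟨hs, (hst.trans htu).trans hu⟩)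
      (hS ⟨(hs.trans hst).trans htu, hu⟩) ⟨hst, htu⟩).trans (max_le h1 h2)
  constructor
  · rintro t ⟨h1, h2⟩
    by_contra hcon
    rw [not_le] at hcon
    have h1' : a < t := lt_of_le_of_ne h1 fun h => by rw [← h, ha0] at hcon; exact hcon.false
    have h2' : t < c := lt_of_le_of_ne h2 fun h => by rw [h, hc0] at hcon; exact hcon.false
    obtain ⟨s₁, hs₁, r₁, hr₁, e₁⟩ := hslope le_rfl h1' (h2.trans hcb.le)
    obtain ⟨s₂, hs₂, r₂, hr₂, e₂⟩ := hslope h1 h2' hcb.le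
    obtain ⟨s₃, hs₃, r₃, hr₃, e₃⟩ := hslope hac.le hcb le_rfl
    rw [ha0, sub_zero] at e₁
    rw [hc0, zero_sub] at e₂
    rw [hb0, hc0, sub_zero, mul_zero] at e₃
    have := hconv hs₁.1.le (hs₁.2.trans hs₂.1).le (hs₂.2.trans hs₃.1).le hs₃.2.le
      (by rw [e₁]; exact (mul_neg_of_pos_of_neg hr₁ hcon).le) e₃.le
    have hpos : 0 < G s₂ := by rw [e₂]; exact mul_pos hr₂ (neg_pos.2 hcon)
    linarith
  · rintro t ⟨h1, h2⟩
    by_contra hcon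
    rw [not_le] at hcon
    have h1' : c < t := lt_of_le_of_ne h1 fun h => by rw [← h, hc0] at hcon; exact hcon.false
    have h2' : t < b := lt_of_le_of_ne h2 fun h => by rw [h, hb0] at hcon; exact hcon.false
    obtain ⟨s₁, hs₁, r₁, hr₁, e₁⟩ := hslope le_rfl hac hcb.le
    obtain ⟨s₂, hs₂, r₂, hr₂, e₂⟩ := hslope hac.le h1' h2
    obtain ⟨s₃, hs₃, r₃, hr₃, e₃⟩ := hslope (hac.le.trans h1) h2' le_rfl
    rw [ha0, hc0, sub_zero, mul_zero] at e₁
    rw [hc0, sub_zero] at e₂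
    rw [hb0, zero_sub] at e₃
    have := hconv hs₁.1.le (hs₁.2.trans hs₂.1).le (hs₂.2.trans hs₃.1).le hs₃.2.le e₁.le
      (by rw [e₃]; exact (mul_neg_of_pos_of_neg hr₃ (neg_lt_zero.2 hcon)).le)
    have hpos : 0 < G s₂ := by rw [e₂]; exact mul_pos hr₂ hcon
    linarith

variable {B₁ B₂ lam : ℝ} {d : ℕ}

theorem mul_treeMap_lt_one (hB₂ : 0 < B₂) (hlam : 0 < lam) (hanti : B₁ * B₂ < 1) {x : ℝ}
    (hx : 0 < x) : B₂ * treeMap B₁ B₂ lam d x < 1 := by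
  have hz : 0 < lam * x ^ d := by positivity
  unfold treeMap
  rw [← mul_div_assoc, div_lt_one (by positivity)]
  nlinarith

/-- The intermediate value theorem gives a fixed point c of `treeMap` in (L, U). Then `logDefect`
vanishes at L, c and U, and the convexity of its slope function determines its signs in between. -/
theorem squareDefect_sign_between (hd : 1 ≤ d) (hB₁ : 0 < B₁) (hB₂ : 0 < B₂) (hlam : 0 < lam)
    (hanti : B₁ * B₂ < 1) {L U : ℝ} (hL : 0 < L) (hLU : L < U)
    (hqL : treeMap B₁ B₂ lam d L = U) (hqU : treeMap B₁ B₂ lam d U = L) :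
    ∃ c ∈ Set.Icc L U, (∀ x ∈ Set.Icc L c, squareDefect B₁ B₂ lam d x ≤ 0) ∧
      ∀ x ∈ Set.Icc c U, 0 ≤ squareDefect B₁ B₂ lam d x := by
  have hU : 0 < U := hL.trans hLU
  have hLB : B₁ < L := hqU ▸ le_treeMap hB₂ hlam hanti hU.le
  have hUB : B₂ * U < 1 := hqL ▸ mul_treeMap_lt_one hB₂ hlam hanti hL
  have hcont : ContinuousOn (fun x => x - treeMap B₁ B₂ lam d x) (Set.Icc L U) := fun x hx =>
    (continuousAt_id.sub
      (continuousAt_treeMap hB₂ hlam (hL.le.trans hx.1))).continuousWithinAt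
  obtain ⟨c, hc, hc0⟩ := intermediate_value_Ioo hLU.le hcont
    (show (0 : ℝ) ∈ Set.Ioo _ _ from ⟨by rw [hqL]; linarith, by rw [hqU]; linarith⟩)
  have hqc : treeMap B₁ B₂ lam d c = c := (sub_eq_zero.1 hc0).symm
  have hx1 : ∀ x ∈ Set.Icc L U, 0 < x - B₁ := fun x hx => sub_pos.2 (hLB.trans_le hx.1)
  have hx2 : ∀ x ∈ Set.Icc L U, 0 < 1 - B₂ * x := fun x hx =>
    sub_pos.2 ((mul_le_mul_of_nonneg_left hx.2 hB₂.le).trans_lt hUB)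
  have hx0 : ∀ x ∈ Set.Icc L U, 0 < x := fun x hx => hL.trans_le hx.1
  have hpos1 : ∀ x ∈ Set.Icc L U, 0 < lam * (B₁ * (lam * x ^ d) + 1) ^ d * (x - B₁) := by
    intro x hx
    have h1 := hx1 x hx
    have h0 := hx0 x hx
    positivity
  have hpos2 : ∀ x ∈ Set.Icc L U, 0 < (lam * x ^ d + B₂) ^ d * (1 - B₂ * x) := by
    intro x hx
    have h1 := hx2 x hx
    have h0 := hx0 x hx
    positivity
  have hzero : ∀ x ∈ Set.Icc L U, treeMap B₁ B₂ lam d (treeMap B₁ B₂ lam d x) = x →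
      logDefect B₁ B₂ lam d x = 0 := by
    intro x hx h
    have h0 := squareDefect_eq hB₁ hB₂ hlam (d := d) (hx0 x hx).le
    rw [h, sub_self, mul_zero, squareDefect, sub_eq_zero] at h0
    rw [logDefect, h0, sub_self]
  have hsub : Set.Icc L U ⊆ Set.Ioi 0 := fun x hx => hx0 x hx
  have hmain := sign_of_convex_slope (D := logDefect B₁ B₂ lam d)
    (p := fun x => (1 - B₁ * B₂) * lam * x ^ d / ((B₁ * (lam * x ^ d) + 1) * (lam * x ^ d + B₂) *
        (1 - B₂ * x) * (x - B₁))) hc.1 hc.2 (fun x hx => by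
      have h1 := hx1 x hx
      have h2 := hx2 x hx
      have h0 := hx0 x hx
      have h3 := sub_pos.2 hanti
      positivity)
    (fun x hx => hasDerivAt_logDefect hd hB₁ hB₂ hlam (sub_pos.1 (hx1 x hx))
      (sub_pos.1 (hx2 x hx))) hsub (convexOn_logDefectSlope hB₁ hB₂ hlam)
    (hzero L ⟨le_rfl, hLU.le⟩ (by rw [hqL, hqU]))
    (hzero c ⟨hc.1.le, hc.2.le⟩ (by rw [hqc, hqc]))
    (hzero U ⟨hLU.le, le_rfl⟩ (by rw [hqU, hqL]))
  refine ⟨c, ⟨hc.1.le, hc.2.le⟩, fun x hx => ?_, fun x hx => ?_⟩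
  · have hx' : x ∈ Set.Icc L U := ⟨hx.1, hx.2.trans hc.2.le⟩
    have h := sub_nonneg.1 (hmain.1 x hx)
    rw [Real.log_le_log_iff (hpos2 x hx') (hpos1 x hx')] at h
    exact sub_nonpos.2 h
  · have hx' : x ∈ Set.Icc L U := ⟨hc.1.le.trans hx.1, hx.2⟩
    have h := sub_nonpos.1 (hmain.2 x hx)
    rw [Real.log_le_log_iff (hpos1 x hx') (hpos2 x hx')] at h
    exact sub_nonneg.2 h

/-- The logarithm of the first moment as a function of one of the two tree messages. -/
noncomputable def firstMoment (B₁ B₂ lam : ℝ) (d : ℕ) (x : ℝ) : ℝ :=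
  Real.log (lam * (B₁ * (lam * x ^ d) + 1) ^ (d + 1) + (lam * x ^ d + B₂) ^ (d + 1)) -
    d * Real.log (lam * x ^ (d + 1) + 1)

/-- The link between the first moment and the tree: up to a nonnegative factor the derivative is
`squareDefect`, so the positive critical points are the fixed points of the squared recursion. -/
theorem hasDerivAt_firstMoment (hd : 1 ≤ d) (hB₁ : 0 < B₁) (hB₂ : 0 < B₂) (hlam : 0 < lam)
    {x : ℝ} (hx : 0 ≤ x) :
    HasDerivAt (firstMoment B₁ B₂ lam d)
      ((d + 1) * d * lam * x ^ (d - 1) /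
        ((lam * (B₁ * (lam * x ^ d) + 1) ^ (d + 1) + (lam * x ^ d + B₂) ^ (d + 1)) *
          (lam * x ^ (d + 1) + 1)) * squareDefect B₁ B₂ lam d x) x := by
  obtain ⟨e, rfl⟩ : ∃ e, d = e + 1 := ⟨d - 1, by omega⟩
  have hp : HasDerivAt (fun x : ℝ => lam * x ^ (e + 1)) (lam * ((e + 1 : ℕ) * x ^ e)) x := by
    simpa using (hasDerivAt_pow (e + 1) x).const_mul lam
  have hp' : HasDerivAt (fun x : ℝ => lam * x ^ (e + 1 + 1) + 1)
      (lam * ((e + 1 + 1 : ℕ) * x ^ (e + 1))) x := by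
    simpa using ((hasDerivAt_pow (e + 1 + 1) x).const_mul lam).add_const 1
  have hA' : HasDerivAt (fun x : ℝ => lam * (B₁ * (lam * x ^ (e + 1)) + 1) ^ (e + 1 + 1))
      (lam * ((e + 1 + 1 : ℕ) * (B₁ * (lam * x ^ (e + 1)) + 1) ^ (e + 1) *
        (B₁ * (lam * ((e + 1 : ℕ) * x ^ e))))) x := by
    simpa using (((hp.const_mul B₁).add_const 1).fun_pow (e + 1 + 1)).const_mul lam
  have hC' : HasDerivAt (fun x : ℝ => (lam * x ^ (e + 1) + B₂) ^ (e + 1 + 1))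
      ((e + 1 + 1 : ℕ) * (lam * x ^ (e + 1) + B₂) ^ (e + 1) * (lam * ((e + 1 : ℕ) * x ^ e))) x := by
    simpa using (hp.add_const B₂).fun_pow (e + 1 + 1)
  have hN : 0 < lam * (B₁ * (lam * x ^ (e + 1)) + 1) ^ (e + 1 + 1) +
      (lam * x ^ (e + 1) + B₂) ^ (e + 1 + 1) := by positivity
  have hM : 0 < lam * x ^ (e + 1 + 1) + 1 := by positivity
  have key := ((hA'.fun_add hC').log hN.ne').sub ((hp'.log hM.ne').const_mul ((e + 1 : ℕ) : ℝ))
  refine HasDerivAt.congr_deriv key ?_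
  have hN' := hN.ne'
  have hM' := hM.ne'
  rw [div_mul_eq_mul_div, mul_div_assoc', div_sub_div _ _ hN' hM']
  congr 1
  unfold squareDefect
  rw [pow_succ (B₁ * (lam * x ^ (e + 1)) + 1) (e + 1), pow_succ (lam * x ^ (e + 1) + B₂) (e + 1),
    pow_succ x (e + 1), pow_succ x e]
  simp only [Nat.add_sub_cancel]
  push_cast
  set a := (B₁ * (lam * (x ^ e * x)) + 1) ^ (e + 1)
  set c := (lam * (x ^ e * x) + B₂) ^ (e + 1)
  ring

/-- The function increases up to L, decreases to c, increases to U and decreases afterwards. -/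
theorem firstMoment_le (hd : 1 ≤ d) (hB₁ : 0 < B₁) (hB₂ : 0 < B₂) (hlam : 0 < lam)
    (hanti : B₁ * B₂ < 1) {L U : ℝ} (hL : 0 < L) (hLU : L ≤ U)
    (hqL : treeMap B₁ B₂ lam d L = U) (hqU : treeMap B₁ B₂ lam d U = L)
    (hlow : ∀ x, 0 ≤ x → x < L → x < treeMap B₁ B₂ lam d (treeMap B₁ B₂ lam d x))
    (hup : ∀ x, U < x → treeMap B₁ B₂ lam d (treeMap B₁ B₂ lam d x) < x) {x : ℝ} (hx : 0 ≤ x) :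
    firstMoment B₁ B₂ lam d x ≤
      max (firstMoment B₁ B₂ lam d L) (firstMoment B₁ B₂ lam d U) := by
  have hU : 0 < U := hL.trans_le hLU
  have hmono : ∀ y z, 0 ≤ y → (∀ t ∈ Set.Ioo y z, 0 ≤ squareDefect B₁ B₂ lam d t) → y ≤ z →
      firstMoment B₁ B₂ lam d y ≤ firstMoment B₁ B₂ lam d z := by
    intro y z hy h hyz
    refine monotoneOn_of_hasDerivWithinAt_nonneg (convex_Icc y z)
      (fun t ht => (hasDerivAt_firstMoment hd hB₁ hB₂ hlam
        (hy.trans ht.1)).continuousAt.continuousWithinAt)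
      (fun t ht => (hasDerivAt_firstMoment hd hB₁ hB₂ hlam
        (hy.trans (interior_subset ht).1)).hasDerivWithinAt) ?_ ⟨le_rfl, hyz⟩ ⟨hyz, le_rfl⟩ hyz
    intro t ht
    have ht0 : 0 ≤ t := hy.trans (interior_subset ht).1
    rw [interior_Icc] at ht
    exact mul_nonneg (by positivity) (h t ht)
  have hanti' : ∀ y z, 0 ≤ y → (∀ t ∈ Set.Ioo y z, squareDefect B₁ B₂ lam d t ≤ 0) → y ≤ z →
      firstMoment B₁ B₂ lam d z ≤ firstMoment B₁ B₂ lam d y := by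
    intro y z hy h hyz
    refine antitoneOn_of_hasDerivWithinAt_nonpos (convex_Icc y z)
      (fun t ht => (hasDerivAt_firstMoment hd hB₁ hB₂ hlam
        (hy.trans ht.1)).continuousAt.continuousWithinAt)
      (fun t ht => (hasDerivAt_firstMoment hd hB₁ hB₂ hlam
        (hy.trans (interior_subset ht).1)).hasDerivWithinAt) ?_ ⟨le_rfl, hyz⟩ ⟨hyz, le_rfl⟩ hyz
    intro t ht
    have ht0 : 0 ≤ t := hy.trans (interior_subset ht).1
    rw [interior_Icc] at ht
    exact mul_nonpos_of_nonneg_of_nonpos (by positivity) (h t ht)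
  rcases le_total x L with hxL | hxL
  · refine le_max_of_le_left (hmono x L hx (fun t ht => ?_) hxL)
    exact (squareDefect_nonneg_iff hB₁ hB₂ hlam (hx.trans ht.1.le)).2
      (hlow t (hx.trans ht.1.le) ht.2).le
  rcases le_total U x with hxU | hxU
  · refine le_max_of_le_right (hanti' U x hU.le (fun t ht => ?_) hxU)
    exact (squareDefect_nonpos_iff hB₁ hB₂ hlam (hU.le.trans ht.1.le)).2 (hup t ht.1).le
  rcases hLU.eq_or_lt with rfl | hlt
  · exact le_max_of_le_left (by rw [le_antisymm hxL hxU])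
  obtain ⟨c, hc, h1, h2⟩ := squareDefect_sign_between hd hB₁ hB₂ hlam hanti hL hlt hqL hqU
  rcases le_total x c with hxc | hxc
  · exact le_max_of_le_left (hanti' L x hL.le
      (fun t ht => h1 t ⟨ht.1.le, ht.2.le.trans hxc⟩) hxL)
  · exact le_max_of_le_right (hmono x U hx
      (fun t ht => h2 t ⟨hxc.trans ht.1.le, ht.2.le⟩) hxU)

theorem add_pow_eq_of_treeMap (hB₂ : 0 < B₂) (hlam : 0 < lam) {x y : ℝ} (hx : 0 ≤ x)
    (h : treeMap B₁ B₂ lam d x = y) :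
    lam * (B₁ * (lam * x ^ d) + 1) ^ (d + 1) + (lam * x ^ d + B₂) ^ (d + 1) =
      (lam * x ^ d + B₂) ^ (d + 1) * (lam * y ^ (d + 1) + 1) := by
  have hC : 0 < lam * x ^ d + B₂ := by positivity
  have hA : B₁ * (lam * x ^ d) + 1 = y * (lam * x ^ d + B₂) := by
    rw [← h, treeMap, div_mul_cancel₀ _ hC.ne']
  rw [hA, mul_pow]
  ring

/-- The right side is the partition function of an edge with messages x and y. Its symmetry in x and
y is why L and U give the same value. -/
theorem add_mul_eq_of_treeMap (hB₂ : 0 < B₂) (hlam : 0 < lam) {x y : ℝ} (hx : 0 ≤ x)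
    (h : treeMap B₁ B₂ lam d x = y) :
    (lam * x ^ d + B₂) * (lam * y ^ (d + 1) + 1) =
      lam * y ^ d * (B₁ * (lam * x ^ d) + 1) + (lam * x ^ d + B₂) := by
  have hC : 0 < lam * x ^ d + B₂ := by positivity
  have hA : B₁ * (lam * x ^ d) + 1 = y * (lam * x ^ d + B₂) := by
    rw [← h, treeMap, div_mul_cancel₀ _ hC.ne']
  rw [hA]
  ring

theorem firstMoment_eq (hB₂ : 0 < B₂) (hlam : 0 < lam) {L U : ℝ} (hL : 0 < L)
    (hU : 0 < U) (hqL : treeMap B₁ B₂ lam d L = U) (hqU : treeMap B₁ B₂ lam d U = L) :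
    firstMoment B₁ B₂ lam d L = firstMoment B₁ B₂ lam d U := by
  have h1 : (lam * L ^ d + B₂) * (lam * U ^ (d + 1) + 1) =
      (lam * U ^ d + B₂) * (lam * L ^ (d + 1) + 1) := by
    rw [add_mul_eq_of_treeMap hB₂ hlam hL.le hqL, add_mul_eq_of_treeMap hB₂ hlam hU.le hqU]
    ring
  have h2 := congrArg Real.log h1
  rw [Real.log_mul (by positivity) (by positivity), Real.log_mul (by positivity) (by positivity)]
    at h2
  unfold firstMoment
  rw [add_pow_eq_of_treeMap hB₂ hlam hL.le hqL, add_pow_eq_of_treeMap hB₂ hlam hU.le hqU,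
    Real.log_mul (by positivity) (by positivity), Real.log_mul (by positivity) (by positivity),
    Real.log_pow, Real.log_pow]
  push_cast
  linear_combination (d + 1 : ℝ) * h2

/-- The bound on the first moment in multiplicative form. -/
theorem firstMoment_bound (hd : 1 ≤ d) (hB₁ : 0 < B₁) (hB₂ : 0 < B₂) (hlam : 0 < lam)
    (hanti : B₁ * B₂ < 1) {L U : ℝ} (hL : 0 < L) (hLU : L ≤ U)
    (hqL : treeMap B₁ B₂ lam d L = U) (hqU : treeMap B₁ B₂ lam d U = L)
    (hlow : ∀ x, 0 ≤ x → x < L → x < treeMap B₁ B₂ lam d (treeMap B₁ B₂ lam d x))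
    (hup : ∀ x, U < x → treeMap B₁ B₂ lam d (treeMap B₁ B₂ lam d x) < x) {x : ℝ} (hx : 0 ≤ x) :
    lam * (B₁ * (lam * x ^ d) + 1) ^ (d + 1) + (lam * x ^ d + B₂) ^ (d + 1) ≤
      (lam * L ^ d + B₂) ^ (d + 1) * (lam * U ^ (d + 1) + 1) / (lam * L ^ (d + 1) + 1) ^ d *
        (lam * x ^ (d + 1) + 1) ^ d := by
  have hU : 0 < U := hL.trans_le hLU
  have h := firstMoment_le hd hB₁ hB₂ hlam hanti hL hLU hqL hqU hlow hup hx
  rw [← firstMoment_eq hB₂ hlam hL hU hqL hqU, max_self] at h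
  unfold firstMoment at h
  rw [add_pow_eq_of_treeMap hB₂ hlam hL.le hqL] at h
  rw [← Real.log_le_log_iff (by positivity) (by positivity),
    Real.log_mul (by positivity) (by positivity), Real.log_div (by positivity) (by positivity),
    Real.log_pow, Real.log_pow]
  linarith

end Maximum

end TwoSpin

namespace TwoSpin

open Finset

set_option linter.unusedSectionVars false

/-! ### The bilinear form of the moments -/

section Bilinear

/-- The bilinear form of the first moment. -/
noncomputable def momentForm {K : Type} [Fintype K] (M : K → K → ℝ) (θ : ℝ) (μ ν : K → ℝ) : ℝ :=
  ∑ s, ∑ t, μ s ^ θ * M s t * ν t ^ θ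

/-- The tensor square of a matrix. -/
def tensorSquare {K : Type} (M : K → K → ℝ) (x y : K × K) : ℝ := M x.1 y.1 * M x.2 y.2

variable {K : Type} [Fintype K] {M : K → K → ℝ} {θ κ : ℝ}

theorem momentForm_smul_left (a : ℝ) (ha : 0 ≤ a) {μ ν : K → ℝ} (hμ : ∀ s, 0 ≤ μ s) :
    momentForm M θ (fun s => a * μ s) ν = a ^ θ * momentForm M θ μ ν := by
  unfold momentForm
  simp only [mul_sum]
  refine sum_congr rfl fun s _ => sum_congr rfl fun t _ => ?_
  rw [Real.mul_rpow ha (hμ s)]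
  ring

theorem momentForm_tensorSquare (μ ν : K × K → ℝ) :
    momentForm (tensorSquare M) θ μ ν =
      ∑ s, ∑ t, M s t * momentForm M θ (fun s' => μ (s, s')) fun t' => ν (t, t') := by
  unfold momentForm tensorSquare
  simp only [Fintype.sum_prod_type, mul_sum]
  refine sum_congr rfl fun s _ => ?_
  rw [sum_comm]
  refine sum_congr rfl fun t _ => sum_congr rfl fun s' _ => sum_congr rfl fun t' _ => ?_
  ring

/-- The tensor square is a combination, with weights `M s t`, of forms of rows. Bounding each of
these by `hbound` leaves κ times the form of the row sums, which `hbound` bounds again. If the total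
κ² is reached, no step can lose, and since `M` is positive this holds for each pair of rows. -/
theorem momentForm_rows_eq (hM : ∀ s t, 0 < M s t) (hκ : 0 ≤ κ)
    (hbound : ∀ μ ν : K → ℝ, (∀ s, 0 ≤ μ s) → (∀ s, 0 ≤ ν s) →
      momentForm M θ μ ν ≤ κ * (∑ s, μ s) ^ θ * (∑ s, ν s) ^ θ)
    {μ ν : K × K → ℝ} (hμ : ∀ x, 0 ≤ μ x) (hν : ∀ x, 0 ≤ ν x)
    (heq : κ ^ 2 * (∑ x, μ x) ^ θ * (∑ x, ν x) ^ θ ≤ momentForm (tensorSquare M) θ μ ν) (s t : K) :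
    momentForm M θ (fun s' => μ (s, s')) (fun t' => ν (t, t')) =
      κ * (∑ s', μ (s, s')) ^ θ * (∑ t', ν (t, t')) ^ θ := by
  by_contra hne
  have hlt := lt_of_le_of_ne (hbound (fun s' => μ (s, s')) (fun t' => ν (t, t'))
    (fun _ => hμ _) fun _ => hν _) hne
  have h2 := hbound (fun s => ∑ s', μ (s, s')) (fun t => ∑ t', ν (t, t'))
    (fun s => sum_nonneg fun _ _ => hμ _) fun t => sum_nonneg fun _ _ => hν _
  have hle : ∀ s t, M s t * momentForm M θ (fun s' => μ (s, s')) (fun t' => ν (t, t')) ≤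
      M s t * (κ * (∑ s', μ (s, s')) ^ θ * (∑ t', ν (t, t')) ^ θ) := fun s t =>
    mul_le_mul_of_nonneg_left (hbound _ _ (fun _ => hμ _) fun _ => hν _) (hM s t).le
  have h1 : momentForm (tensorSquare M) θ μ ν <
      ∑ s, ∑ t, M s t * (κ * (∑ s', μ (s, s')) ^ θ * (∑ t', ν (t, t')) ^ θ) := by
    rw [momentForm_tensorSquare]
    refine sum_lt_sum (fun s _ => sum_le_sum fun t _ => hle s t) ⟨s, mem_univ s, ?_⟩
    exact sum_lt_sum (fun t _ => hle s t) ⟨t, mem_univ t, mul_lt_mul_of_pos_left hlt (hM s t)⟩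
  have h3 : ∑ s, ∑ t, M s t * (κ * (∑ s', μ (s, s')) ^ θ * (∑ t', ν (t, t')) ^ θ) =
      κ * momentForm M θ (fun s => ∑ s', μ (s, s')) fun t => ∑ t', ν (t, t') := by
    unfold momentForm
    simp only [mul_sum]
    refine sum_congr rfl fun s _ => sum_congr rfl fun t _ => ?_
    ring
  rw [h3] at h1
  have h4 := h1.trans_le (mul_le_mul_of_nonneg_left h2 hκ)
  rw [Fintype.sum_prod_type, Fintype.sum_prod_type] at heq
  have h5 : κ * (κ * (∑ s, ∑ s', μ (s, s')) ^ θ * (∑ s, ∑ s', ν (s, s')) ^ θ) =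
      κ ^ 2 * (∑ s, ∑ s', μ (s, s')) ^ θ * (∑ s, ∑ s', ν (s, s')) ^ θ := by ring
  linarith

/-- For fixed nonzero `ν` the form is a combination of the μ(s)^θ with positive coefficients, hence
strictly concave; the midpoint of two different maximizers would exceed the bound. -/
theorem momentForm_eq_unique (hM : ∀ s t, 0 < M s t) (hθ : 0 < θ) (hθ1 : θ < 1)
    (hbound : ∀ μ ν : K → ℝ, (∀ s, 0 ≤ μ s) → (∀ s, 0 ≤ ν s) →
      momentForm M θ μ ν ≤ κ * (∑ s, μ s) ^ θ * (∑ s, ν s) ^ θ)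
    {a b ν : K → ℝ} (ha : ∀ s, 0 ≤ a s) (hb : ∀ s, 0 ≤ b s) (hν : ∀ s, 0 ≤ ν s)
    (ha1 : ∑ s, a s = 1) (hb1 : ∑ s, b s = 1) (hν1 : 0 < ∑ s, ν s)
    (hae : momentForm M θ a ν = κ * (∑ s, ν s) ^ θ)
    (hbe : momentForm M θ b ν = κ * (∑ s, ν s) ^ θ) : a = b := by
  by_contra hne
  obtain ⟨s₀, hs₀⟩ := Function.ne_iff.1 hne
  obtain ⟨t₀, -, ht₀⟩ := exists_lt_of_sum_lt (s := univ) (f := fun _ : K => (0 : ℝ)) (g := ν)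
    (by simpa using hν1)
  set c : K → ℝ := fun s => ∑ t, M s t * ν t ^ θ
  have hc : ∀ s, 0 < c s := fun s => by
    have h0 : ∀ t ∈ univ, 0 ≤ M s t * ν t ^ θ :=
      fun t _ => mul_nonneg (hM s t).le (Real.rpow_nonneg (hν t) θ)
    exact lt_of_lt_of_le (mul_pos (hM s t₀) (Real.rpow_pos_of_pos ht₀ θ))
      (single_le_sum h0 (mem_univ t₀))
  have hform : ∀ μ : K → ℝ, momentForm M θ μ ν = ∑ s, μ s ^ θ * c s := by
    intro μ
    unfold momentForm
    refine sum_congr rfl fun s _ => ?_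
    rw [mul_sum]
    exact sum_congr rfl fun t _ => by ring
  have hconc := Real.strictConcaveOn_rpow hθ hθ1
  have hmid : ∀ s, (a s ^ θ + b s ^ θ) / 2 ≤ ((a s + b s) / 2) ^ θ := by
    intro s
    have := hconc.concaveOn.2 (x := a s) (y := b s) (ha s) (hb s)
      (by norm_num : (0 : ℝ) ≤ 1 / 2) (by norm_num : (0 : ℝ) ≤ 1 / 2) (by norm_num)
    simp only [smul_eq_mul] at this
    calc (a s ^ θ + b s ^ θ) / 2 = 1 / 2 * a s ^ θ + 1 / 2 * b s ^ θ := by ring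
      _ ≤ _ := this
      _ = _ := by congr 1; ring
  have hmid' : (a s₀ ^ θ + b s₀ ^ θ) / 2 < ((a s₀ + b s₀) / 2) ^ θ := by
    have := hconc.2 (x := a s₀) (y := b s₀) (ha s₀) (hb s₀) hs₀
      (by norm_num : (0 : ℝ) < 1 / 2) (by norm_num : (0 : ℝ) < 1 / 2) (by norm_num)
    simp only [smul_eq_mul] at this
    calc (a s₀ ^ θ + b s₀ ^ θ) / 2 = 1 / 2 * a s₀ ^ θ + 1 / 2 * b s₀ ^ θ := by ring
      _ < _ := this
      _ = _ := by congr 1; ring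
  have hsum : ∑ s, (a s ^ θ + b s ^ θ) / 2 * c s < ∑ s, ((a s + b s) / 2) ^ θ * c s :=
    sum_lt_sum (fun s _ => mul_le_mul_of_nonneg_right (hmid s) (hc s).le)
      ⟨s₀, mem_univ _, mul_lt_mul_of_pos_right hmid' (hc s₀)⟩
  have hle := hbound (fun s => (a s + b s) / 2) ν (fun s => by
    have := ha s
    have := hb s
    positivity) hν
  have h1 : ∑ s, (a s + b s) / 2 = 1 := by
    rw [← sum_div, sum_add_distrib, ha1, hb1]
    norm_num
  rw [h1, Real.one_rpow, mul_one, hform] at hle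
  rw [hform] at hae hbe
  have h2 : ∑ s, (a s ^ θ + b s ^ θ) / 2 * c s =
      (∑ s, a s ^ θ * c s + ∑ s, b s ^ θ * c s) / 2 := by
    rw [← sum_add_distrib, sum_div]
    exact sum_congr rfl fun s _ => by ring
  rw [h2, hae, hbe] at hsum
  linarith

/-- A maximizer of the form of the second moment has proportional rows. -/
theorem momentForm_proportional (hM : ∀ s t, 0 < M s t) (hκ : 0 ≤ κ) (hθ : 0 < θ) (hθ1 : θ < 1)
    (hbound : ∀ μ ν : K → ℝ, (∀ s, 0 ≤ μ s) → (∀ s, 0 ≤ ν s) →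
      momentForm M θ μ ν ≤ κ * (∑ s, μ s) ^ θ * (∑ s, ν s) ^ θ)
    {μ ν : K × K → ℝ} (hμ : ∀ x, 0 ≤ μ x) (hν : ∀ x, 0 ≤ ν x)
    (hμ1 : ∀ s, 0 < ∑ s', μ (s, s')) (hν1 : ∃ t, 0 < ∑ t', ν (t, t'))
    (heq : κ ^ 2 * (∑ x, μ x) ^ θ * (∑ x, ν x) ^ θ ≤ momentForm (tensorSquare M) θ μ ν)
    (s₁ s₂ s : K) :
    μ (s₁, s) * ∑ s', μ (s₂, s') = μ (s₂, s) * ∑ s', μ (s₁, s') := by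
  obtain ⟨t, ht⟩ := hν1
  set m : K → ℝ := fun s => ∑ s', μ (s, s')
  -- By homogeneity all normalized rows of `μ` are maximizers against the same nonzero row of `ν`,
  -- hence equal.
  have hrow : ∀ s₀, momentForm M θ (fun s' => (m s₀)⁻¹ * μ (s₀, s')) (fun t' => ν (t, t')) =
      κ * (∑ t', ν (t, t')) ^ θ := by
    intro s₀
    have hm : 0 < m s₀ := hμ1 s₀
    rw [momentForm_smul_left _ (inv_nonneg.2 hm.le) fun s' => hμ _,
      momentForm_rows_eq hM hκ hbound hμ hν heq, Real.inv_rpow hm.le]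
    have := (Real.rpow_pos_of_pos hm θ).ne'
    change (m s₀ ^ θ)⁻¹ * (κ * m s₀ ^ θ * (∑ t', ν (t, t')) ^ θ) = _
    field_simp
  have hnn : ∀ s₀ s', 0 ≤ (m s₀)⁻¹ * μ (s₀, s') :=
    fun s₀ s' => mul_nonneg (inv_nonneg.2 (hμ1 s₀).le) (hμ _)
  have hone : ∀ s₀, ∑ s', (m s₀)⁻¹ * μ (s₀, s') = 1 := by
    intro s₀
    rw [← mul_sum]
    exact inv_mul_cancel₀ (hμ1 s₀).ne'
  have h := congrFun (momentForm_eq_unique hM hθ hθ1 hbound (hnn s₁) (hnn s₂) (fun _ => hν _)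
    (hone s₁) (hone s₂) ht (hrow s₁) (hrow s₂)) s
  have h1 : m s₁ ≠ 0 := (hμ1 s₁).ne'
  have h2 : m s₂ ≠ 0 := (hμ1 s₂).ne'
  change μ (s₁, s) * m s₂ = μ (s₂, s) * m s₁
  field_simp at h
  linarith

end Bilinear

/-! ### Rates and the bilinear form -/

section Gibbs

variable {K : Type} [Fintype K] [DecidableEq K]

/-- The growth rate of the contribution of a coupling `P` of `μ` and `ν`. -/
noncomputable def couplingRate (d : ℕ) (W : K → K → ℝ) (u : K → ℝ) (μ ν : K → ℝ)
    (P : K × K → ℝ) : ℝ :=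
  ∑ s, μ s * Real.log (u s) + ∑ s, ν s * Real.log (u s) - d * (entropy μ + entropy ν) +
    (d + 1) * tableRate W P

/-- The matrix of the bilinear form with edge weights `W` and vertex weights `u`. -/
noncomputable def formMatrix (d : ℕ) (W : K → K → ℝ) (u : K → ℝ) (s t : K) : ℝ :=
  W s t * (u s ^ (1 / (d + 1 : ℝ)) * u t ^ (1 / (d + 1 : ℝ)))

theorem couplingRate_eq {d : ℕ} {W : K → K → ℝ} {u μ ν : K → ℝ} {P : K × K → ℝ}
    (hP : IsTable P μ ν) : couplingRate d W u μ ν P =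
      (d + 1) * ∑ x : K × K, P x * (d / (d + 1) * Real.log (μ x.1) + Real.log (W x.1 x.2) +
        1 / (d + 1) * (Real.log (u x.1) + Real.log (u x.2)) + d / (d + 1) * Real.log (ν x.2) -
          Real.log (P x)) := by
  have hl : ∀ f : K → ℝ, ∑ s, μ s * f s = ∑ x : K × K, P x * f x.1 := by
    intro f
    rw [Fintype.sum_prod_type]
    refine sum_congr rfl fun s _ => ?_
    rw [← hP.1 s, sum_mul]
  have hr : ∀ f : K → ℝ, ∑ s, ν s * f s = ∑ x : K × K, P x * f x.2 := by
    intro f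
    rw [Fintype.sum_prod_type_right]
    refine sum_congr rfl fun s _ => ?_
    rw [← hP.2 s, sum_mul]
  have he : ∀ {ι : Type} [Fintype ι] (p : ι → ℝ), entropy p = -∑ s, p s * Real.log (p s) := by
    intro ι _ p
    rw [entropy, ← sum_neg_distrib]
    exact sum_congr rfl fun s _ => by rw [Real.negMulLog]; ring
  unfold couplingRate tableRate
  rw [he, he, he, hl, hr, hl fun s => Real.log (μ s), hr fun s => Real.log (ν s)]
  have hd : (d + 1 : ℝ) ≠ 0 := by positivity
  simp only [← sum_neg_distrib, mul_sum, mul_add, ← sum_add_distrib, ← sum_sub_distrib]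
  refine sum_congr rfl fun x _ => ?_
  field_simp
  ring

theorem log_formTerm {d : ℕ} {W : K → K → ℝ} (hW : ∀ s t, 0 < W s t) {u : K → ℝ}
    (hu : ∀ s, 0 < u s) {μ ν : K → ℝ} {s t : K} (hs : 0 < μ s) (ht : 0 < ν t) :
    Real.log (μ s ^ (d / (d + 1) : ℝ) * formMatrix d W u s t * ν t ^ (d / (d + 1) : ℝ)) =
      d / (d + 1) * Real.log (μ s) + Real.log (W s t) +
        1 / (d + 1) * (Real.log (u s) + Real.log (u t)) + d / (d + 1) * Real.log (ν t) := by
  have h1 := Real.rpow_pos_of_pos hs (d / (d + 1) : ℝ)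
  have h2 := Real.rpow_pos_of_pos ht (d / (d + 1) : ℝ)
  have h3 := Real.rpow_pos_of_pos (hu s) (1 / (d + 1) : ℝ)
  have h4 := Real.rpow_pos_of_pos (hu t) (1 / (d + 1) : ℝ)
  have h5 := hW s t
  unfold formMatrix
  rw [Real.log_mul (by positivity) h2.ne', Real.log_mul h1.ne' (by positivity),
    Real.log_mul h5.ne' (by positivity), Real.log_mul h3.ne' h4.ne', Real.log_rpow hs,
    Real.log_rpow ht, Real.log_rpow (hu s), Real.log_rpow (hu t)]
  ring

/-- Gibbs' inequality: after division by d + 1, log of the form minus the rate is the relative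
entropy of `P` with respect to the normalized terms of the form. It is nonnegative by log x ≤ x - 1,
applied cell by cell. -/
theorem couplingRate_le {d : ℕ} {W : K → K → ℝ} (hW : ∀ s t, 0 < W s t) {u : K → ℝ}
    (hu : ∀ s, 0 < u s) {μ ν : K → ℝ} {P : K × K → ℝ} (hP : P ∈ couplings μ ν)
    (hμ1 : ∑ s, μ s = 1) :
    0 < momentForm (formMatrix d W u) (d / (d + 1)) μ ν ∧ couplingRate d W u μ ν P ≤
      (d + 1) * Real.log (momentForm (formMatrix d W u) (d / (d + 1)) μ ν) := by
  obtain ⟨hP0, hPt⟩ := hP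
  have hμ0 : ∀ i, 0 ≤ μ i := fun i => hPt.1 i ▸ sum_nonneg fun j _ => hP0 _
  have hν0 : ∀ j, 0 ≤ ν j := fun j => hPt.2 j ▸ sum_nonneg fun i _ => hP0 _
  have hPμ : ∀ s t, P (s, t) ≤ μ s := fun s t =>
    hPt.1 s ▸ single_le_sum (f := fun t => P (s, t)) (fun _ _ => hP0 _) (mem_univ t)
  have hPν : ∀ s t, P (s, t) ≤ ν t := fun s t =>
    hPt.2 t ▸ single_le_sum (f := fun s => P (s, t)) (fun _ _ => hP0 _) (mem_univ s)
  have hM : ∀ s t, 0 < formMatrix d W u s t := fun s t => mul_pos (hW s t)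
    (mul_pos (Real.rpow_pos_of_pos (hu s) _) (Real.rpow_pos_of_pos (hu t) _))
  set Z : K × K → ℝ := fun x =>
    μ x.1 ^ (d / (d + 1) : ℝ) * formMatrix d W u x.1 x.2 * ν x.2 ^ (d / (d + 1) : ℝ) with hZ
  have hZ0 : ∀ x, 0 ≤ Z x := fun x => mul_nonneg (mul_nonneg (Real.rpow_nonneg (hμ0 _) _)
    (hM _ _).le) (Real.rpow_nonneg (hν0 _) _)
  have hZpos : ∀ x, 0 < P x → 0 < Z x := fun x hx => mul_pos (mul_pos
    (Real.rpow_pos_of_pos (hx.trans_le (hPμ _ _)) _) (hM _ _))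
    (Real.rpow_pos_of_pos (hx.trans_le (hPν _ _)) _)
  have hS : momentForm (formMatrix d W u) (d / (d + 1)) μ ν = ∑ x, Z x := by
    rw [Fintype.sum_prod_type]
    rfl
  have hsum : ∑ x, P x = 1 := (sum_table hPt).trans hμ1
  obtain ⟨x₀, -, hx₀⟩ := exists_lt_of_sum_lt (s := univ) (f := fun _ : K × K => (0 : ℝ)) (g := P)
    (by simp [hsum])
  have hSpos : 0 < ∑ x, Z x :=
    (hZpos x₀ hx₀).trans_le (single_le_sum (fun x _ => hZ0 x) (mem_univ x₀))
  rw [hS]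
  refine ⟨hSpos, ?_⟩
  rw [couplingRate_eq hPt]
  refine mul_le_mul_of_nonneg_left ?_ (by positivity)
  have hterm : ∀ x, P x * (d / (d + 1) * Real.log (μ x.1) + Real.log (W x.1 x.2) +
      1 / (d + 1) * (Real.log (u x.1) + Real.log (u x.2)) + d / (d + 1) * Real.log (ν x.2) -
        Real.log (P x)) ≤ P x * Real.log (∑ x, Z x) + (Z x / ∑ x, Z x) - P x := by
    intro x
    rcases (hP0 x).eq_or_lt with h | h
    · rw [← h]
      have := div_nonneg (hZ0 x) hSpos.le
      linarith
    · have hz := hZpos x h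
      rw [← log_formTerm hW hu (h.trans_le (hPμ _ _)) (h.trans_le (hPν _ _))]
      have hlog := Real.log_le_sub_one_of_pos (by positivity : 0 < Z x / (P x * ∑ x, Z x))
      rw [Real.log_div hz.ne' (by positivity), Real.log_mul h.ne' hSpos.ne'] at hlog
      have h2 := mul_le_mul_of_nonneg_left hlog h.le
      have h3 : P x * (Z x / (P x * ∑ x, Z x) - 1) = Z x / ∑ x, Z x - P x := by
        field_simp
      change P x * (Real.log (Z x) - Real.log (P x)) ≤ _
      linarith
  refine (sum_le_sum fun x _ => hterm x).trans (le_of_eq ?_)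
  rw [sum_sub_distrib, sum_add_distrib, ← sum_mul, ← sum_div, hsum, div_self hSpos.ne']
  ring

/-- The equality case of Gibbs' inequality: the normalized terms of the form are themselves a
coupling of `μ` and `ν`. -/
theorem couplingRate_eq_of_form {d : ℕ} {W : K → K → ℝ} (hW : ∀ s t, 0 < W s t) {u : K → ℝ}
    (hu : ∀ s, 0 < u s) {μ ν : K → ℝ} {P : K × K → ℝ} (hP : IsTable P μ ν)
    (hμ : ∀ s, 0 < μ s) (hν : ∀ s, 0 < ν s) (hμ1 : ∑ s, μ s = 1) {S : ℝ} (hS : 0 < S)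
    (hPS : ∀ s t, P (s, t) =
      μ s ^ (d / (d + 1) : ℝ) * formMatrix d W u s t * ν t ^ (d / (d + 1) : ℝ) / S) :
    couplingRate d W u μ ν P = (d + 1) * Real.log S := by
  rw [couplingRate_eq hP]
  congr 1
  have hterm : ∀ x : K × K, P x * (d / (d + 1) * Real.log (μ x.1) + Real.log (W x.1 x.2) +
      1 / (d + 1) * (Real.log (u x.1) + Real.log (u x.2)) + d / (d + 1) * Real.log (ν x.2) -
        Real.log (P x)) = P x * Real.log S := by
    rintro ⟨s, t⟩
    have hz : 0 < μ s ^ (d / (d + 1) : ℝ) * formMatrix d W u s t * ν t ^ (d / (d + 1) : ℝ) :=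
      mul_pos (mul_pos (Real.rpow_pos_of_pos (hμ s) _) (mul_pos (hW s t)
        (mul_pos (Real.rpow_pos_of_pos (hu s) _) (Real.rpow_pos_of_pos (hu t) _))))
        (Real.rpow_pos_of_pos (hν t) _)
    have hlogP : Real.log (P (s, t)) = _ := congrArg Real.log (hPS s t)
    rw [Real.log_div hz.ne' hS.ne', log_formTerm hW hu (hμ s) (hν t)] at hlogP
    dsimp only
    rw [hlogP]
    ring
  rw [sum_congr rfl fun x _ => hterm x, ← sum_mul, sum_table hP, hμ1, one_mul]

end Gibbs

section Concrete

variable {B₁ B₂ lam : ℝ} {d : ℕ}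

/-! ### The bound for the first moment form -/

/-- With odds written as lam x^(d+1), the fractional powers of the form become the polynomials of
the tree recursion. -/
theorem rpow_mul_rpow_eq (hlam : 0 < lam) {x : ℝ} (hx : 0 ≤ x) :
    (lam * x ^ (d + 1)) ^ (d / (d + 1) : ℝ) * lam ^ (1 / (d + 1) : ℝ) = lam * x ^ d := by
  have hd : (d + 1 : ℝ) ≠ 0 := by positivity
  have h1 : lam ^ (d / (d + 1) : ℝ) * lam ^ (1 / (d + 1) : ℝ) = lam := by
    rw [← Real.rpow_add hlam, ← add_div, div_self hd, Real.rpow_one]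
  have h2 : (x ^ (d + 1)) ^ (d / (d + 1) : ℝ) = x ^ d := by
    rw [← Real.rpow_natCast x (d + 1), ← Real.rpow_mul hx]
    push_cast
    rw [mul_div_cancel₀ _ hd, Real.rpow_natCast]
  rw [Real.mul_rpow hlam.le (by positivity), h2]
  linear_combination x ^ d * h1

theorem rpow_pow_eq {x : ℝ} (hx : 0 ≤ x) : (x ^ (d / (d + 1) : ℝ)) ^ (d + 1) = x ^ d := by
  have hd : (d + 1 : ℝ) ≠ 0 := by positivity
  rw [← Real.rpow_natCast, ← Real.rpow_mul hx]
  push_cast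
  rw [div_mul_cancel₀ _ hd, Real.rpow_natCast]

theorem one_div_rpow_pow {x : ℝ} (hx : 0 ≤ x) : (x ^ (1 / (d + 1) : ℝ)) ^ (d + 1) = x := by
  have hd : (d + 1 : ℝ) ≠ 0 := by positivity
  rw [← Real.rpow_natCast, ← Real.rpow_mul hx]
  push_cast
  rw [div_mul_cancel₀ _ hd, Real.rpow_one]

/-- The matrix of the first moment. -/
noncomputable abbrev spinMatrix (d : ℕ) (B₁ B₂ lam : ℝ) : ℤˣ → ℤˣ → ℝ :=
  formMatrix d (edgeWeight B₁ B₂) (vertexWeight lam)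

theorem edgeWeight_pos (hB₁ : 0 < B₁) (hB₂ : 0 < B₂) (s t : ℤˣ) : 0 < edgeWeight B₁ B₂ s t := by
  unfold edgeWeight
  split_ifs <;> positivity

theorem edgeWeight_comm (s t : ℤˣ) : edgeWeight B₁ B₂ s t = edgeWeight B₁ B₂ t s := by
  simp only [edgeWeight, and_comm]

theorem vertexWeight_pos (hlam : 0 < lam) (s : ℤˣ) : 0 < vertexWeight lam s := by
  unfold vertexWeight
  split_ifs <;> positivity

theorem sum_pow_columns_le (hlam : 0 < lam) {S : ℝ}
    (hN : ∀ x : ℝ, 0 ≤ x → lam * (B₁ * (lam * x ^ d) + 1) ^ (d + 1) +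
      (lam * x ^ d + B₂) ^ (d + 1) ≤ S ^ (d + 1) * (lam * x ^ (d + 1) + 1) ^ d)
    {μ : ℤˣ → ℝ} (hμ : ∀ s, 0 ≤ μ s) :
    ∑ t, (∑ s, μ s ^ (d / (d + 1) : ℝ) * spinMatrix d B₁ B₂ lam s t) ^ (d + 1) ≤
      S ^ (d + 1) * (∑ s, μ s) ^ d := by
  have hne : (1 : ℤˣ) ≠ -1 := by decide
  simp only [sum_units, spinMatrix, formMatrix, edgeWeight, vertexWeight, hne, hne.symm, and_self,
    and_true, and_false, if_true, if_false, Real.one_rpow, mul_one, one_mul]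
  set l := lam ^ (1 / (d + 1) : ℝ) with hl
  have hll : l ^ (d + 1) = lam := one_div_rpow_pow hlam.le
  set m := μ (-1)
  have hm : 0 ≤ m := hμ _
  have hθ : (0 : ℝ) ≤ d / (d + 1) := by positivity
  have key : ∀ p : ℝ, 0 < p →
      (m ^ (d / (d + 1) : ℝ) * (B₁ * (l * l)) + p ^ (d / (d + 1) : ℝ) * l) ^ (d + 1) +
      (m ^ (d / (d + 1) : ℝ) * l + p ^ (d / (d + 1) : ℝ) * B₂) ^ (d + 1) ≤
        S ^ (d + 1) * (m + p) ^ d := by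
    intro p hp
    -- Chosen so that m = lam x^(d+1) p: both sides are homogeneous of degree d in (m, p), and only
    -- the one-variable inequality `hN` is left.
    set x := (m / (lam * p)) ^ (1 / (d + 1) : ℝ)
    have hq : 0 ≤ m / (lam * p) := by positivity
    have hx : 0 ≤ x := Real.rpow_nonneg hq _
    have hxd : x ^ (d + 1) = m / (lam * p) := one_div_rpow_pow hq
    have hmx : m = lam * x ^ (d + 1) * p := by
      rw [hxd]
      field_simp
    have hrp := rpow_mul_rpow_eq (d := d) hlam hx
    rw [← hl] at hrp
    have hmθ : m ^ (d / (d + 1) : ℝ) =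
        (lam * x ^ (d + 1)) ^ (d / (d + 1) : ℝ) * p ^ (d / (d + 1) : ℝ) := by
      rw [← Real.mul_rpow (by positivity) hp.le, ← hmx]
    have e1 : m ^ (d / (d + 1) : ℝ) * (B₁ * (l * l)) + p ^ (d / (d + 1) : ℝ) * l =
        p ^ (d / (d + 1) : ℝ) * l * (B₁ * (lam * x ^ d) + 1) := by
      rw [hmθ, ← hrp]
      ring
    have e2 : m ^ (d / (d + 1) : ℝ) * l + p ^ (d / (d + 1) : ℝ) * B₂ =
        p ^ (d / (d + 1) : ℝ) * (lam * x ^ d + B₂) := by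
      rw [hmθ, ← hrp]
      ring
    have e3 : m + p = p * (lam * x ^ (d + 1) + 1) := by
      rw [hmx]
      ring
    rw [e1, e2, mul_pow, mul_pow, mul_pow, rpow_pow_eq hp.le, hll, e3, mul_pow]
    have := mul_le_mul_of_nonneg_left (hN x hx) (pow_nonneg hp.le d)
    linarith
  rcases (hμ 1).eq_or_lt with h | h
  · have hcp : Continuous fun p : ℝ => p ^ (d / (d + 1) : ℝ) :=
      Real.continuous_rpow_const hθ
    have hcf : Continuous fun p : ℝ =>
        (m ^ (d / (d + 1) : ℝ) * (B₁ * (l * l)) + p ^ (d / (d + 1) : ℝ) * l) ^ (d + 1) +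
        (m ^ (d / (d + 1) : ℝ) * l + p ^ (d / (d + 1) : ℝ) * B₂) ^ (d + 1) := by fun_prop
    have hcg : Continuous fun p : ℝ => S ^ (d + 1) * (m + p) ^ d := by fun_prop
    rw [← h]
    exact le_of_tendsto_of_tendsto ((hcf.tendsto 0).mono_left (nhdsWithin_le_nhds (s := Set.Ioi 0)))
      ((hcg.tendsto 0).mono_left nhdsWithin_le_nhds) (eventually_nhdsWithin_of_forall key)
  · exact key _ h

/-- Hölder's inequality with exponents d + 1 and (d + 1)/d eliminates `ν`, since (ν^θ)^((d+1)/d) =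
ν; the other factor is `sum_pow_columns_le`. -/
theorem momentForm_spinMatrix_le (hd : 1 ≤ d) (hB₁ : 0 < B₁) (hB₂ : 0 < B₂) (hlam : 0 < lam)
    {S : ℝ} (hS : 0 ≤ S)
    (hN : ∀ x : ℝ, 0 ≤ x → lam * (B₁ * (lam * x ^ d) + 1) ^ (d + 1) +
      (lam * x ^ d + B₂) ^ (d + 1) ≤ S ^ (d + 1) * (lam * x ^ (d + 1) + 1) ^ d)
    (μ ν : ℤˣ → ℝ) (hμ : ∀ s, 0 ≤ μ s) (hν : ∀ s, 0 ≤ ν s) :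
    momentForm (spinMatrix d B₁ B₂ lam) (d / (d + 1)) μ ν ≤
      S * (∑ s, μ s) ^ (d / (d + 1) : ℝ) * (∑ s, ν s) ^ (d / (d + 1) : ℝ) := by
  have hd0 : (0 : ℝ) < d := by exact_mod_cast hd
  have hd1 : (d + 1 : ℝ) ≠ 0 := by positivity
  set c : ℤˣ → ℝ := fun t => ∑ s, μ s ^ (d / (d + 1) : ℝ) * spinMatrix d B₁ B₂ lam s t with hc
  have hc0 : ∀ t, 0 ≤ c t := fun t => sum_nonneg fun s _ => mul_nonneg
    (Real.rpow_nonneg (hμ s) _) (mul_pos (edgeWeight_pos hB₁ hB₂ s t) (mul_pos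
      (Real.rpow_pos_of_pos (vertexWeight_pos hlam s) _)
      (Real.rpow_pos_of_pos (vertexWeight_pos hlam t) _))).le
  have hform : momentForm (spinMatrix d B₁ B₂ lam) (d / (d + 1)) μ ν =
      ∑ t, c t * ν t ^ (d / (d + 1) : ℝ) := by
    unfold momentForm
    rw [sum_comm]
    exact sum_congr rfl fun t _ => by rw [hc, sum_mul]
  have hpq : (d + 1 : ℝ).HolderConjugate ((d + 1) / d) := by
    rw [Real.holderConjugate_iff]
    refine ⟨by linarith, ?_⟩
    field_simp
    ring
  have hH := Real.inner_le_Lp_mul_Lq_of_nonneg univ hpq (f := c)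
    (g := fun t => ν t ^ (d / (d + 1) : ℝ)) (fun t _ => hc0 t)
    (fun t _ => Real.rpow_nonneg (hν t) _)
  rw [← hform] at hH
  have h1 : ∀ t, (ν t ^ (d / (d + 1) : ℝ)) ^ ((d + 1) / d : ℝ) = ν t := by
    intro t
    rw [← Real.rpow_mul (hν t)]
    have : (d / (d + 1) : ℝ) * ((d + 1) / d) = 1 := by field_simp
    rw [this, Real.rpow_one]
  have h2 : ∀ t, c t ^ (d + 1 : ℝ) = c t ^ (d + 1) := by
    intro t
    rw [← Real.rpow_natCast]
    push_cast
    rfl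
  simp only [h1, h2, one_div_div] at hH
  have hcol := sum_pow_columns_le hlam hN hμ
  have hsμ : 0 ≤ ∑ s, μ s := sum_nonneg fun s _ => hμ s
  have h3 : (∑ t, c t ^ (d + 1)) ^ (1 / (d + 1) : ℝ) ≤
      S * (∑ s, μ s) ^ (d / (d + 1) : ℝ) := by
    refine (Real.rpow_le_rpow (sum_nonneg fun t _ => pow_nonneg (hc0 t) _) hcol
      (by positivity)).trans (le_of_eq ?_)
    rw [← rpow_pow_eq hsμ, ← mul_pow, ← Real.rpow_natCast, ← Real.rpow_mul (by positivity)]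
    push_cast
    rw [mul_one_div_cancel hd1, Real.rpow_one]
  exact hH.trans (mul_le_mul_of_nonneg_right h3
    (Real.rpow_nonneg (sum_nonneg fun s _ => hν s) _))

/-! ### The extremal distributions -/

/-- The distribution of a spin with odds `lam * x ^ (d + 1)` of being `-1`. -/
noncomputable def spinDist (d : ℕ) (lam x : ℝ) (s : ℤˣ) : ℝ :=
  if s = -1 then lam * x ^ (d + 1) / (lam * x ^ (d + 1) + 1) else 1 / (lam * x ^ (d + 1) + 1)

theorem spinDist_pos (hlam : 0 < lam) {x : ℝ} (hx : 0 < x) (s : ℤˣ) : 0 < spinDist d lam x s := by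
  unfold spinDist
  split_ifs <;> positivity

theorem sum_spinDist (hlam : 0 < lam) {x : ℝ} (hx : 0 < x) : ∑ s, spinDist d lam x s = 1 := by
  have h : lam * x ^ (d + 1) + 1 ≠ 0 := by positivity
  have hne : (1 : ℤˣ) ≠ -1 := by decide
  simp only [sum_units, spinDist, hne, if_true, if_false]
  field_simp

/-- The maximal value of the first moment form. -/
noncomputable def formMax (d : ℕ) (B₂ lam x y : ℝ) : ℝ :=
  (lam * x ^ d + B₂) * (lam * y ^ (d + 1) + 1) /
    ((lam * y ^ (d + 1) + 1) ^ (d / (d + 1) : ℝ) * (lam * x ^ (d + 1) + 1) ^ (d / (d + 1) : ℝ))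

theorem formMax_pos (hB₂ : 0 < B₂) (hlam : 0 < lam) {x y : ℝ} (hx : 0 < x) (hy : 0 < y) :
    0 < formMax d B₂ lam x y := by
  unfold formMax
  have h1 : 0 < lam * x ^ (d + 1) + 1 := by positivity
  have h2 : 0 < lam * y ^ (d + 1) + 1 := by positivity
  have h3 := Real.rpow_pos_of_pos h1 (d / (d + 1) : ℝ)
  have h4 := Real.rpow_pos_of_pos h2 (d / (d + 1) : ℝ)
  positivity

/-- Identifies this value with the constant of `firstMoment_bound`. -/
theorem formMax_pow (hlam : 0 < lam) {x y : ℝ} (hx : 0 < x) (hy : 0 < y) :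
    formMax d B₂ lam x y ^ (d + 1) = (lam * x ^ d + B₂) ^ (d + 1) * (lam * y ^ (d + 1) + 1) /
      (lam * x ^ (d + 1) + 1) ^ d := by
  have h1 : 0 < lam * x ^ (d + 1) + 1 := by positivity
  have h2 : 0 < lam * y ^ (d + 1) + 1 := by positivity
  unfold formMax
  rw [div_pow, mul_pow, mul_pow, rpow_pow_eq h1.le, rpow_pow_eq h2.le]
  field_simp
  ring

theorem formMax_comm (hB₂ : 0 < B₂) (hlam : 0 < lam) {x y : ℝ} (hx : 0 < x) (hy : 0 < y)
    (hqx : treeMap B₁ B₂ lam d x = y) (hqy : treeMap B₁ B₂ lam d y = x) :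
    formMax d B₂ lam x y = formMax d B₂ lam y x := by
  unfold formMax
  rw [add_mul_eq_of_treeMap hB₂ hlam hx.le hqx, add_mul_eq_of_treeMap hB₂ hlam hy.le hqy, mul_comm
    ((lam * y ^ (d + 1) + 1) ^ (d / (d + 1) : ℝ))]
  congr 1
  ring

theorem spinMatrix_pos (hB₁ : 0 < B₁) (hB₂ : 0 < B₂) (hlam : 0 < lam) (s t : ℤˣ) :
    0 < spinMatrix d B₁ B₂ lam s t :=
  mul_pos (edgeWeight_pos hB₁ hB₂ s t) (mul_pos
    (Real.rpow_pos_of_pos (vertexWeight_pos hlam s) _)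
    (Real.rpow_pos_of_pos (vertexWeight_pos hlam t) _))

theorem spinMatrix_comm (s t : ℤˣ) : spinMatrix d B₁ B₂ lam s t = spinMatrix d B₁ B₂ lam t s := by
  unfold spinMatrix formMatrix
  rw [edgeWeight_comm, mul_comm (vertexWeight lam s ^ _)]

theorem spinDist_rpow (hlam : 0 < lam) {x : ℝ} (hx : 0 < x) (s : ℤˣ) :
    spinDist d lam x s ^ (d / (d + 1) : ℝ) * vertexWeight lam s ^ (1 / (d + 1) : ℝ) =
      (if s = -1 then lam * x ^ d else 1) / (lam * x ^ (d + 1) + 1) ^ (d / (d + 1) : ℝ) := by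
  have h1 : 0 < lam * x ^ (d + 1) + 1 := by positivity
  unfold spinDist vertexWeight
  split_ifs
  · rw [Real.div_rpow (by positivity) h1.le, div_mul_eq_mul_div, rpow_mul_rpow_eq hlam hx.le]
  · rw [Real.div_rpow zero_le_one h1.le, Real.one_rpow, Real.one_rpow, mul_one]

/-- The edge distribution of the extremal tree measure. -/
noncomputable def spinCoupling (d : ℕ) (B₁ B₂ lam x y : ℝ) (p : ℤˣ × ℤˣ) : ℝ :=
  spinDist d lam y p.1 ^ (d / (d + 1) : ℝ) * spinMatrix d B₁ B₂ lam p.1 p.2 *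
    spinDist d lam x p.2 ^ (d / (d + 1) : ℝ) / formMax d B₂ lam x y

/-- Consistency of the marginals is the fixed-point relation: the ratio of the sums over t for the
two values of s is `treeMap` at x, that is y. -/
theorem sum_spinCoupling (hB₂ : 0 < B₂) (hlam : 0 < lam) {x y : ℝ} (hx : 0 < x)
    (hy : 0 < y) (hqx : treeMap B₁ B₂ lam d x = y) (s : ℤˣ) :
    ∑ t, spinCoupling d B₁ B₂ lam x y (s, t) = spinDist d lam y s := by
  have h1 : 0 < lam * x ^ (d + 1) + 1 := by positivity
  have h2 : 0 < lam * y ^ (d + 1) + 1 := by positivity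
  have h3 := Real.rpow_pos_of_pos h1 (d / (d + 1) : ℝ)
  have h4 := Real.rpow_pos_of_pos h2 (d / (d + 1) : ℝ)
  have hS := formMax_pos (d := d) hB₂ hlam hx hy
  have hC : 0 < lam * x ^ d + B₂ := by positivity
  have hA : B₁ * (lam * x ^ d) + 1 = y * (lam * x ^ d + B₂) := by
    rw [← hqx, treeMap, div_mul_cancel₀ _ hC.ne']
  have hterm : ∀ t, spinCoupling d B₁ B₂ lam x y (s, t) =
      (if s = -1 then lam * y ^ d else 1) * (edgeWeight B₁ B₂ s t *
        (if t = -1 then lam * x ^ d else 1)) /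
        ((lam * x ^ d + B₂) * (lam * y ^ (d + 1) + 1)) := by
    intro t
    have e : spinCoupling d B₁ B₂ lam x y (s, t) =
        (spinDist d lam y s ^ (d / (d + 1) : ℝ) * vertexWeight lam s ^ (1 / (d + 1) : ℝ)) *
        edgeWeight B₁ B₂ s t *
        (spinDist d lam x t ^ (d / (d + 1) : ℝ) * vertexWeight lam t ^ (1 / (d + 1) : ℝ)) /
          formMax d B₂ lam x y := by
      unfold spinCoupling spinMatrix formMatrix
      ring
    rw [e, spinDist_rpow hlam hy, spinDist_rpow hlam hx]
    unfold formMax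
    field_simp
  rw [sum_congr rfl fun t _ => hterm t, ← sum_div, ← mul_sum, sum_units]
  have hne : (1 : ℤˣ) ≠ -1 := by decide
  rcases Int.units_eq_one_or s with rfl | rfl
  · simp only [edgeWeight, spinDist, hne, hne.symm, if_true, if_false, and_self, and_true,
      and_false, one_mul, mul_one]
    field_simp
  · simp only [edgeWeight, spinDist, hne, hne.symm, if_true, if_false, and_self, and_true,
      and_false, mul_one]
    rw [hA]
    field_simp
    ring

theorem spinCoupling_isTable (hB₂ : 0 < B₂) (hlam : 0 < lam) {x y : ℝ} (hx : 0 < x)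
    (hy : 0 < y) (hqx : treeMap B₁ B₂ lam d x = y) (hqy : treeMap B₁ B₂ lam d y = x) :
    IsTable (spinCoupling d B₁ B₂ lam x y) (spinDist d lam y) (spinDist d lam x) := by
  refine ⟨sum_spinCoupling hB₂ hlam hx hy hqx, fun t => ?_⟩
  rw [← sum_spinCoupling hB₂ hlam hy hx hqy t]
  refine sum_congr rfl fun s _ => ?_
  unfold spinCoupling
  rw [formMax_comm hB₂ hlam hx hy hqx hqy, spinMatrix_comm]
  ring

end Concrete

section Overlap

variable {B₁ B₂ lam : ℝ} {d : ℕ}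

/-! ### Overlap distributions -/

/-- The vertex weight of a pair of configurations. -/
noncomputable def pairVertexWeight (lam : ℝ) (s : ℤˣ × ℤˣ) : ℝ :=
  vertexWeight lam s.1 * vertexWeight lam s.2

theorem pairVertexWeight_pos (hlam : 0 < lam) (s : ℤˣ × ℤˣ) : 0 < pairVertexWeight lam s :=
  mul_pos (vertexWeight_pos hlam _) (vertexWeight_pos hlam _)

theorem pairEdgeWeight_pos (hB₁ : 0 < B₁) (hB₂ : 0 < B₂) (s t : ℤˣ × ℤˣ) :
    0 < pairEdgeWeight B₁ B₂ s t :=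
  mul_pos (edgeWeight_pos hB₁ hB₂ _ _) (edgeWeight_pos hB₁ hB₂ _ _)

theorem formMatrix_pair (hlam : 0 < lam) :
    formMatrix d (pairEdgeWeight B₁ B₂) (pairVertexWeight lam) =
      tensorSquare (spinMatrix d B₁ B₂ lam) := by
  funext s t
  unfold tensorSquare spinMatrix formMatrix pairEdgeWeight pairVertexWeight
  rw [Real.mul_rpow (vertexWeight_pos hlam _).le (vertexWeight_pos hlam _).le,
    Real.mul_rpow (vertexWeight_pos hlam _).le (vertexWeight_pos hlam _).le]
  ring

/-- The joint distribution of two spins that are `-1` with probability `α` each and both `-1`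
with probability `γ`. -/
noncomputable def overlapDist (α γ : ℝ) (s : ℤˣ × ℤˣ) : ℝ :=
  if s = (-1, -1) then γ else if s = (1, 1) then 1 - 2 * α + γ else α - γ

theorem overlapDist_nonneg {α γ : ℝ} (h1 : 0 ≤ γ) (h2 : 0 ≤ α - γ) (h3 : 0 ≤ 1 - 2 * α + γ)
    (s : ℤˣ × ℤˣ) : 0 ≤ overlapDist α γ s := by
  unfold overlapDist
  split_ifs <;> assumption

theorem overlapDist_row (α γ : ℝ) (s : ℤˣ) :
    ∑ s', overlapDist α γ (s, s') = if s = -1 then α else 1 - α := by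
  have hne : (1 : ℤˣ) ≠ -1 := by decide
  rcases Int.units_eq_one_or s with rfl | rfl <;>
    simp only [sum_units, overlapDist, Prod.mk.injEq, hne, hne.symm, and_true, and_false,
      if_true, if_false] <;> ring

theorem sum_overlapDist (α γ : ℝ) : ∑ s, overlapDist α γ s = 1 := by
  have hne : (1 : ℤˣ) ≠ -1 := by decide
  rw [Fintype.sum_prod_type, sum_congr rfl fun s _ => overlapDist_row α γ s, sum_units]
  simp only [hne, if_true, if_false]
  ring

theorem overlapDist_sq_eq {x : ℝ} (hlam : 0 < lam) (hx : 0 < x) (s t : ℤˣ) :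
    overlapDist (spinDist d lam x (-1)) (spinDist d lam x (-1) ^ 2) (s, t) =
      spinDist d lam x s * spinDist d lam x t := by
  have hne : (1 : ℤˣ) ≠ -1 := by decide
  have h1 : spinDist d lam x 1 = 1 - spinDist d lam x (-1) := by
    rw [← sum_spinDist hlam hx (d := d), sum_units]
    ring
  rcases Int.units_eq_one_or s with rfl | rfl <;> rcases Int.units_eq_one_or t with rfl | rfl <;>
    simp only [overlapDist, Prod.mk.injEq, hne, hne.symm, and_true, and_false, if_true,
      if_false, h1] <;> ring

/-- Comparing the entries of the two rows at spin -1 gives γ(1 - α) = (α - γ)α. -/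
theorem eq_sq_of_proportional {α γ : ℝ}
    (h : ∀ s₁ s₂ s : ℤˣ, overlapDist α γ (s₁, s) * ∑ s', overlapDist α γ (s₂, s') =
      overlapDist α γ (s₂, s) * ∑ s', overlapDist α γ (s₁, s')) : γ = α ^ 2 := by
  have hne : (1 : ℤˣ) ≠ -1 := by decide
  have := h (-1) 1 (-1)
  rw [overlapDist_row, overlapDist_row] at this
  simp only [overlapDist, Prod.mk.injEq, hne, hne.symm, and_true, and_false, if_true,
    if_false] at this
  linarith

theorem sum_overlapDist_mul_log (hlam : 0 < lam) (α γ : ℝ) :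
    ∑ s, overlapDist α γ s * Real.log (pairVertexWeight lam s) = 2 * α * Real.log lam := by
  have hne : (1 : ℤˣ) ≠ -1 := by decide
  rw [sum_units_prod]
  simp only [overlapDist, pairVertexWeight, vertexWeight, Prod.mk.injEq, hne, hne.symm, and_true,
    and_false, if_true, if_false, mul_one, one_mul, Real.log_one, mul_zero,
    Real.log_mul hlam.ne' hlam.ne']
  ring

theorem exists_coupling_isMaxOn {K : Type} [Fintype K] [DecidableEq K] (W : K → K → ℝ)
    {μ ν : K → ℝ} (hμ : ∀ s, 0 ≤ μ s) (hν : ∀ s, 0 ≤ ν s) (hμ1 : ∑ s, μ s = 1)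
    (hν1 : ∑ s, ν s = 1) :
    ∃ P ∈ couplings μ ν, ∀ P' ∈ couplings μ ν, tableRate W P' ≤ tableRate W P := by
  have hprod : (fun x : K × K => μ x.1 * ν x.2) ∈ couplings μ ν := by
    refine ⟨fun x => mul_nonneg (hμ _) (hν _), fun i => ?_, fun j => ?_⟩
    · dsimp only
      rw [← mul_sum, hν1, mul_one]
    · dsimp only
      rw [← sum_mul, hμ1, one_mul]
  have hsub : couplings μ ν ⊆ stdSimplex ℝ (K × K) :=
    fun P hP => ⟨hP.1, (sum_table hP.2).trans hμ1⟩
  have hclosed : IsClosed (couplings μ ν) := by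
    have heq : couplings μ ν = (⋂ x, {P | 0 ≤ P x}) ∩ ((⋂ i, {P | ∑ j, P (i, j) = μ i}) ∩
        ⋂ j, {P | ∑ i, P (i, j) = ν j}) := by
      ext P
      simp [couplings, IsTable]
    rw [heq]
    refine (isClosed_iInter fun x => isClosed_le continuous_const (continuous_apply x)).inter
      ((isClosed_iInter fun i => isClosed_eq ?_ continuous_const).inter
        (isClosed_iInter fun j => isClosed_eq ?_ continuous_const)) <;>
    exact continuous_finsetSum _ fun _ _ => continuous_apply _
  obtain ⟨P, hP, hmax⟩ := ((isCompact_stdSimplex ℝ (K × K)).of_isClosed_subset hclosed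
    hsub).exists_isMaxOn ⟨_, hprod⟩ (continuous_tableRate W).continuousOn
  exact ⟨P, hP, fun P' hP' => hmax hP'⟩

/-! ### The growth rate -/

theorem tendsto_floor_mul_div {c : ℝ} (hc : 0 ≤ c) :
    Tendsto (fun n : ℕ => (⌊c * n⌋₊ : ℝ) / n) atTop (𝓝 c) := by
  refine tendsto_floor_div (fun n => by positivity) ?_
  refine tendsto_const_nhds.congr' ?_
  filter_upwards [eventually_gt_atTop 0] with n hn
  have : (n : ℝ) ≠ 0 := by positivity
  field_simp

theorem exists_counts {α γ : ℝ} (h1 : 0 ≤ γ) (h2 : 0 ≤ α - γ) (h3 : 0 ≤ 1 - 2 * α + γ) :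
    ∃ a g : ℕ → ℕ, Tendsto (fun n : ℕ => (a n : ℝ) / n) atTop (𝓝 α) ∧
      Tendsto (fun n : ℕ => (g n : ℝ) / n) atTop (𝓝 γ) ∧ ∀ n, g n ≤ a n ∧ 2 * a n ≤ n + g n := by
  -- Rounding the cell masses γ and α - γ, instead of α itself, makes the counts realizable for
  -- every n.
  refine ⟨fun n => ⌊γ * n⌋₊ + ⌊(α - γ) * n⌋₊, fun n => ⌊γ * n⌋₊, ?_, tendsto_floor_mul_div h1,
    fun n => ⟨Nat.le_add_right _ _, ?_⟩⟩
  · have h := (tendsto_floor_mul_div h1).add (tendsto_floor_mul_div h2)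
    rw [add_sub_cancel] at h
    refine h.congr fun n => ?_
    push_cast
    ring
  · have e1 := Nat.floor_le (by positivity : 0 ≤ γ * n)
    have e2 := Nat.floor_le (by positivity : 0 ≤ (α - γ) * n)
    have e3 : 0 ≤ (1 - 2 * α + γ) * n := by positivity
    have : (⌊γ * n⌋₊ + 2 * ⌊(α - γ) * n⌋₊ : ℝ) ≤ n := by nlinarith
    have h : ⌊γ * n⌋₊ + 2 * ⌊(α - γ) * n⌋₊ ≤ n := by exact_mod_cast this
    dsimp only
    omega

theorem tendsto_overlapCounts {α γ : ℝ} {a g : ℕ → ℕ}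
    (ha : Tendsto (fun n : ℕ => (a n : ℝ) / n) atTop (𝓝 α))
    (hg : Tendsto (fun n : ℕ => (g n : ℝ) / n) atTop (𝓝 γ))
    (h : ∀ᶠ n in atTop, g n ≤ a n ∧ 2 * a n ≤ n + g n) (s : ℤˣ × ℤˣ) :
    Tendsto (fun n : ℕ => (overlapCounts n (a n) (g n) s : ℝ) / n) atTop
      (𝓝 (overlapDist α γ s)) := by
  unfold overlapCounts overlapDist
  split_ifs
  · exact hg
  · have hlim := (tendsto_const_nhds (x := (1 : ℝ))).sub (ha.const_mul 2) |>.add hg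
    refine hlim.congr' ?_
    filter_upwards [h, eventually_gt_atTop 0] with n hn h0
    have : (n : ℝ) ≠ 0 := by positivity
    rw [Nat.cast_sub hn.2]
    push_cast
    field_simp
    ring
  · refine (ha.sub hg).congr' ?_
    filter_upwards [h] with n hn
    rw [Nat.cast_sub hn.1]
    ring

theorem pairSum_pos {K : Type} [Fintype K] [DecidableEq K] {W : K → K → ℝ}
    (hW : ∀ i j, 0 < W i j) {n : ℕ} {r c : K → ℕ} (hr : ∑ k, r k = n) (hc : ∑ k, c k = n) :
    0 < pairSum W n r c :=
  sum_pos (fun _ _ => sum_pos (fun _ _ => prod_pos fun _ _ => hW _ _) (words_nonempty hc))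
    (words_nonempty hr)

/-- Taking logarithms in `expectedOverlapSum_eq` with Δ = d + 1, the numbers of words enter with
exponent 1 - Δ = -d and the pair sum with exponent d + 1. The limit involves only the limiting
frequencies. -/
theorem hasGrowthRate_couplingRate (hB₁ : 0 < B₁) (hB₂ : 0 < B₂) (hlam : 0 < lam) {α β : ℝ}
    {x : ℝ × ℝ} (hx : x ∈ overlapRegion α β) {P : (ℤˣ × ℤˣ) × (ℤˣ × ℤˣ) → ℝ}
    (hP : P ∈ couplings (overlapDist α x.1) (overlapDist β x.2))
    (hmax : ∀ P' ∈ couplings (overlapDist α x.1) (overlapDist β x.2),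
      tableRate (pairEdgeWeight B₁ B₂) P' ≤ tableRate (pairEdgeWeight B₁ B₂) P) :
    HasGrowthRate (d + 1) B₁ B₂ lam α β x.1 x.2
      (couplingRate d (pairEdgeWeight B₁ B₂) (pairVertexWeight lam) (overlapDist α x.1)
        (overlapDist β x.2) P) := by
  obtain ⟨h1, h2, h3, h4, h5, h6⟩ := hx
  constructor
  · obtain ⟨a, g, ha, hg, hag⟩ := exists_counts h1 h2 h3
    obtain ⟨b, k, hb, hk, hbk⟩ := exists_counts h4 h5 h6
    exact ⟨a, b, g, k, ha, hb, hg, hk, Eventually.of_forall fun n =>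
      overlapPairs_nonempty_iff.2 ⟨hag n, hbk n⟩⟩
  · rintro a b g k ⟨ha, hb, hg, hk, hne⟩
    have hag : ∀ᶠ n in atTop, g n ≤ a n ∧ 2 * a n ≤ n + g n :=
      hne.mono fun n hn => (overlapPairs_nonempty_iff.1 hn).1
    have hbk : ∀ᶠ n in atTop, k n ≤ b n ∧ 2 * b n ≤ n + k n :=
      hne.mono fun n hn => (overlapPairs_nonempty_iff.1 hn).2
    have hr : ∀ᶠ n in atTop, ∑ s, overlapCounts n (a n) (g n) s = n :=
      hag.mono fun n hn => sum_overlapCounts hn.1 hn.2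
    have hc : ∀ᶠ n in atTop, ∑ s, overlapCounts n (b n) (k n) s = n :=
      hbk.mono fun n hn => sum_overlapCounts hn.1 hn.2
    have hμ := tendsto_overlapCounts ha hg hag
    have hν := tendsto_overlapCounts hb hk hbk
    have lim1 := tendsto_log_card_words hr hμ
    have lim2 := tendsto_log_card_words hc hν
    have lim3 := tendsto_log_pairSum (pairEdgeWeight_pos hB₁ hB₂) hP hmax hr hc hμ hν
    have lim := ((((ha.add hb).const_mul (2 * Real.log lam)).sub
      ((lim1.add lim2).const_mul (d : ℝ))).add (lim3.const_mul (d + 1 : ℝ)))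
    have hval : couplingRate d (pairEdgeWeight B₁ B₂) (pairVertexWeight lam) (overlapDist α x.1)
        (overlapDist β x.2) P = 2 * Real.log lam * (α + β) -
          d * (entropy (overlapDist α x.1) + entropy (overlapDist β x.2)) +
          (d + 1) * tableRate (pairEdgeWeight B₁ B₂) P := by
      unfold couplingRate
      rw [sum_overlapDist_mul_log hlam, sum_overlapDist_mul_log hlam]
      ring
    rw [hval]
    refine lim.congr' ?_
    filter_upwards [hne, hr, hc] with n hn hrn hcn
    rw [expectedOverlapSum_eq B₁ B₂ lam hn]
    have p1 : (0 : ℝ) < (words n (overlapCounts n (a n) (g n))).card := by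
      exact_mod_cast card_pos.2 (words_nonempty hrn)
    have p2 : (0 : ℝ) < (words n (overlapCounts n (b n) (k n))).card := by
      exact_mod_cast card_pos.2 (words_nonempty hcn)
    have p3 := pairSum_pos (pairEdgeWeight_pos hB₁ hB₂) hrn hcn
    rw [Real.log_mul (by positivity) (by positivity), Real.log_mul (by positivity) (by positivity),
      Real.log_pow, Real.log_pow, Real.log_div (by positivity) (by positivity),
      Real.log_mul (by positivity) (by positivity)]
    push_cast
    ring

end Overlap

/-! ### The maximum of the second moment -/

theorem momentForm_comm {K : Type} [Fintype K] {M : K → K → ℝ} (hM : ∀ s t, M s t = M t s)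
    (θ : ℝ) (μ ν : K → ℝ) : momentForm M θ μ ν = momentForm M θ ν μ := by
  unfold momentForm
  rw [sum_comm]
  refine sum_congr rfl fun s _ => sum_congr rfl fun t _ => ?_
  rw [hM]
  ring

end TwoSpin

theorem mainTheorem6 (d : ℕ) (hd : 2 ≤ d) (B₁ B₂ lam : ℝ)
    (hB₁ : 0 ≤ B₁) (hB₂ : 0 ≤ B₂) (hlam : 0 ≤ lam) (hanti : B₁ * B₂ < 1)
    (hnon : TwoSpin.NonUniqueness d B₁ B₂ lam)
    (hB : (Real.sqrt d - 1) / (Real.sqrt d + 1) ≤ Real.sqrt (B₁ * B₂)) :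
    ∃ α β : ℝ, TwoSpin.IsPPlus d B₁ B₂ lam α ∧ TwoSpin.IsPMinus d B₁ B₂ lam β ∧
      ∃ φ : ℝ × ℝ → ℝ,
        (∀ x ∈ TwoSpin.overlapRegion α β,
          TwoSpin.HasGrowthRate (d + 1) B₁ B₂ lam α β x.1 x.2 (φ x)) ∧
        (α ^ 2, β ^ 2) ∈ TwoSpin.overlapRegion α β ∧
        ∀ x ∈ TwoSpin.overlapRegion α β, x ≠ (α ^ 2, β ^ 2) → φ x < φ (α ^ 2, β ^ 2) := by
  open TwoSpin in
  have hlam' : 0 < lam := lam_pos_of_nonUniqueness hlam hnon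
  -- As d ≥ 2, the lower bound on √(B₁B₂) is positive, so neither edge weight vanishes.
  have hprod : 0 < B₁ * B₂ := by
    have h1 : 1 < Real.sqrt d := by
      rw [Real.lt_sqrt zero_le_one]
      have : (2 : ℝ) ≤ d := by exact_mod_cast hd
      linarith
    exact Real.sqrt_pos.1 (lt_of_lt_of_le (div_pos (by linarith) (by linarith)) hB)
  have hB₁' : 0 < B₁ := lt_of_le_of_ne hB₁ fun h => by simp [← h] at hprod
  have hB₂' : 0 < B₂ := lt_of_le_of_ne hB₂ fun h => by simp [← h] at hprod
  have hd1 : 1 ≤ d := by omega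
  obtain ⟨L, U, hL, hLU, hqL, hqU, htL, htU, hlow, hup⟩ :=
    exists_treeMap_limits (d := d) hB₁' hB₂' hlam' hanti
  have hU : 0 < U := hL.trans_le hLU
  have hcont : ∀ {y : ℝ}, 0 < y → Tendsto (fun x => lam * x ^ (d + 1) / (lam * x ^ (d + 1) + 1))
      (𝓝 y) (𝓝 (spinDist d lam y (-1))) := by
    intro y hy
    have h0 : lam * y ^ (d + 1) + 1 ≠ 0 := by positivity
    have : ContinuousAt (fun x : ℝ => lam * x ^ (d + 1) / (lam * x ^ (d + 1) + 1)) y :=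
      ContinuousAt.div (by fun_prop) (by fun_prop) h0
    simpa [spinDist, ContinuousAt] using this
  -- Even levels correspond to odd iterates, whose limit is `U`; hence p⁺ belongs to `U` and p⁻ to
  -- `L`.
  set α := spinDist d lam U (-1) with hα
  set β := spinDist d lam L (-1) with hβ
  have hα0 : 0 < α := spinDist_pos hlam' hU _
  have hβ0 : 0 < β := spinDist_pos hlam' hL _
  have hα1 : 0 < 1 - α := by
    have h1 := sum_spinDist (d := d) hlam' hU
    have h2 := spinDist_pos (d := d) hlam' hU 1
    rw [sum_units] at h1
    linarith
  have hβ1 : 0 < 1 - β := by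
    have h1 := sum_spinDist (d := d) hlam' hL
    have h2 := spinDist_pos (d := d) hlam' hL 1
    rw [sum_units] at h1
    linarith
  set S := formMax d B₂ lam L U with hS
  have hSpos : 0 < S := formMax_pos hB₂' hlam' hL hU
  have hM : ∀ s t, 0 < spinMatrix d B₁ B₂ lam s t := spinMatrix_pos hB₁' hB₂' hlam'
  have hbound := momentForm_spinMatrix_le (S := S) hd1 hB₁' hB₂' hlam' hSpos.le fun x hx => by
    rw [hS, formMax_pow hlam' hL hU]
    exact firstMoment_bound hd1 hB₁' hB₂' hlam' hanti hL hLU hqL hqU hlow hup hx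
  have hθ : (0 : ℝ) < d / (d + 1) := by
    have : (0 : ℝ) < d := by exact_mod_cast hd1
    positivity
  have hθ1 : (d / (d + 1) : ℝ) < 1 := by
    rw [div_lt_one (by positivity)]
    linarith
  have hex : ∀ x : ℝ × ℝ, ∃ P, x ∈ overlapRegion α β →
      P ∈ couplings (overlapDist α x.1) (overlapDist β x.2) ∧
      ∀ P' ∈ couplings (overlapDist α x.1) (overlapDist β x.2),
        tableRate (pairEdgeWeight B₁ B₂) P' ≤ tableRate (pairEdgeWeight B₁ B₂) P := by
    intro x
    by_cases hx : x ∈ overlapRegion α β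
    · obtain ⟨h1, h2, h3, h4, h5, h6⟩ := hx
      obtain ⟨P, hP, hmax⟩ := exists_coupling_isMaxOn (pairEdgeWeight B₁ B₂)
        (overlapDist_nonneg h1 h2 h3) (overlapDist_nonneg h4 h5 h6) (sum_overlapDist α x.1)
        (sum_overlapDist β x.2)
      exact ⟨P, fun _ => ⟨hP, hmax⟩⟩
    · exact ⟨0, fun h => absurd h hx⟩
  choose P hP using hex
  have hmem : (α ^ 2, β ^ 2) ∈ overlapRegion α β := by
    refine ⟨sq_nonneg _, ?_, ?_, sq_nonneg _, ?_, ?_⟩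
    · nlinarith
    · nlinarith
    · nlinarith
    · nlinarith
  refine ⟨α, β, ?_, ?_, fun x => couplingRate d (pairEdgeWeight B₁ B₂) (pairVertexWeight lam)
    (overlapDist α x.1) (overlapDist β x.2) (P x), ?_, hmem, ?_⟩
  · unfold IsPPlus
    -- Skip level 0; level 2(n + 1) corresponds to the iterate 2n + 1.
    rw [← tendsto_add_atTop_iff_nat 1]
    refine ((hcont hU).comp htU).congr fun n => ?_
    exact (rootMarginal_succ hB₁' hB₂' hlam' (2 * n + 1)).symm
  · refine ((hcont hL).comp htL).congr fun n => ?_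
    exact (rootMarginal_succ hB₁' hB₂' hlam' (2 * n)).symm
  · intro x hx
    exact hasGrowthRate_couplingRate hB₁' hB₂' hlam' hx (hP x hx).1 (hP x hx).2
  · rintro ⟨γ, δ⟩ hx hne
    have hlower : (d + 1) * Real.log (S ^ 2) ≤ couplingRate d (pairEdgeWeight B₁ B₂)
        (pairVertexWeight lam) (overlapDist α (α ^ 2)) (overlapDist β (β ^ 2))
        (P (α ^ 2, β ^ 2)) := by
      -- Two independent copies of the extremal edge distribution couple the product overlap
      -- distributions and attain S².
      set Q : (ℤˣ × ℤˣ) × (ℤˣ × ℤˣ) → ℝ := fun z =>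
        spinCoupling d B₁ B₂ lam L U (z.1.1, z.2.1) * spinCoupling d B₁ B₂ lam L U (z.1.2, z.2.2)
      have htab := spinCoupling_isTable hB₂' hlam' hL hU hqL hqU
      have hQtab : IsTable Q (overlapDist α (α ^ 2)) (overlapDist β (β ^ 2)) := by
        constructor
        · rintro ⟨s, t⟩
          rw [overlapDist_sq_eq hlam' hU, ← htab.1 s, ← htab.1 t, Finset.sum_mul_sum,
            Fintype.sum_prod_type]
        · rintro ⟨s, t⟩
          rw [overlapDist_sq_eq hlam' hL, ← htab.2 s, ← htab.2 t, Finset.sum_mul_sum,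
            Fintype.sum_prod_type]
      have hQ0 : ∀ z, 0 ≤ Q z := by
        have h0 : ∀ z, 0 ≤ spinCoupling d B₁ B₂ lam L U z := fun z =>
          div_nonneg (mul_nonneg (mul_nonneg (Real.rpow_nonneg (spinDist_pos hlam' hU _).le _)
            (hM _ _).le) (Real.rpow_nonneg (spinDist_pos hlam' hL _).le _)) hSpos.le
        exact fun z => mul_nonneg (h0 _) (h0 _)
      have hQrate := couplingRate_eq_of_form (d := d) (pairEdgeWeight_pos hB₁' hB₂')
        (pairVertexWeight_pos hlam') hQtab
        (fun ⟨s, t⟩ => by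
          rw [overlapDist_sq_eq hlam' hU]
          exact mul_pos (spinDist_pos hlam' hU _) (spinDist_pos hlam' hU _))
        (fun ⟨s, t⟩ => by
          rw [overlapDist_sq_eq hlam' hL]
          exact mul_pos (spinDist_pos hlam' hL _) (spinDist_pos hlam' hL _))
        (sum_overlapDist _ _) (pow_pos hSpos 2) (fun ⟨s, s'⟩ ⟨t, t'⟩ => by
          rw [overlapDist_sq_eq hlam' hU, overlapDist_sq_eq hlam' hL, formMatrix_pair hlam',
            Real.mul_rpow (spinDist_pos hlam' hU _).le (spinDist_pos hlam' hU _).le,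
            Real.mul_rpow (spinDist_pos hlam' hL _).le (spinDist_pos hlam' hL _).le]
          change spinCoupling d B₁ B₂ lam L U (s, t) * spinCoupling d B₁ B₂ lam L U (s', t') = _
          unfold spinCoupling tensorSquare
          rw [← hS]
          field_simp)
      rw [← hQrate]
      have := (hP _ hmem).2 Q ⟨hQ0, hQtab⟩
      unfold couplingRate
      have hd' : (0 : ℝ) ≤ d + 1 := by positivity
      have := mul_le_mul_of_nonneg_left this hd'
      linarith
    refine lt_of_lt_of_le ?_ hlower
    obtain ⟨h1, h2, h3, h4, h5, h6⟩ := id hx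
    have hμ0 := overlapDist_nonneg h1 h2 h3
    have hν0 := overlapDist_nonneg h4 h5 h6
    obtain ⟨hpos, hle⟩ := couplingRate_le (d := d) (pairEdgeWeight_pos hB₁' hB₂')
      (pairVertexWeight_pos hlam') (hP _ hx).1 (sum_overlapDist α γ)
    refine hle.trans_lt (mul_lt_mul_of_pos_left (Real.log_lt_log hpos ?_) (by positivity))
    rw [formMatrix_pair hlam']
    -- Reaching S² makes the rows of both overlap distributions proportional, by applying
    -- `momentForm_proportional` to the form and, through its symmetry, with the two sides
    -- exchanged.
    by_contra hcon
    rw [not_lt] at hcon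
    apply hne
    have hrowα : ∀ s, 0 < ∑ s', overlapDist α γ (s, s') := fun s => by
      rw [overlapDist_row]
      split_ifs <;> assumption
    have hrowβ : ∀ s, 0 < ∑ s', overlapDist β δ (s, s') := fun s => by
      rw [overlapDist_row]
      split_ifs <;> assumption
    have hγ := eq_sq_of_proportional (momentForm_proportional hM hSpos.le hθ hθ1 hbound hμ0 hν0
      hrowα ⟨1, hrowβ 1⟩ (by
        rw [sum_overlapDist, sum_overlapDist, Real.one_rpow, mul_one, mul_one]
        exact hcon))
    have hδ := eq_sq_of_proportional (momentForm_proportional hM hSpos.le hθ hθ1 hbound hν0 hμ0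
      hrowβ ⟨1, hrowα 1⟩ (by
        rw [sum_overlapDist, sum_overlapDist, Real.one_rpow, mul_one, mul_one, momentForm_comm]
        · exact hcon
        · intro s t
          unfold tensorSquare
          rw [spinMatrix_comm, spinMatrix_comm s.2]))
    exact Prod.ext hγ hδ
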